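/- All graphs are finite and simple. A path decomposition of a graph \(G\) is a collection of pairwise edge-disjoint paths of \(G\) that covers all edges of \(G\); the path number \(\mathrm{pn}(G)\) is the minimum cardinality of a path decomposition of \(G\). The E-subgraph \(\mathrm{EV}(G)\) is the subgraph of \(G\) induced by the vertices whose degree in \(G\) is even. A graph \(G\) on \(n\) vertices is a Gallai graph if \(\mathrm{pn}(G)\le\lfloor n/2\rfloor\). A graph \(G\) is a SET graph (single even triangle graph) if \(\mathrm{EV}(G)\) is a triangle and every vertex of odd degree in \(G\) has at least two neighbours of even degree in \(G\). Theorem. Let \(G\) be a connected graph such that \(\Delta(\mathrm{EV}(G))\le 3\), where \(\Delta\) denotes the maximum degree. Then \(G\) is a Gallai graph or \(G\) is a SET graph (possibly both). -/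

import Mathlib

namespace SimpleGraph

section PathDecomposition

variable {V : Type*} (G : SimpleGraph V)

/-- A path decomposition of `G`: a finite collection of paths of `G` (sequences of distinct
vertices, consecutive ones adjacent) which are pairwise edge-disjoint and cover all edges
of `G`. -/
structure IsPathDecomposition (D : Finset (Σ u v : V, G.Path u v)) : Prop where
  edge_disjoint : ∀ P ∈ D, ∀ Q ∈ D, P ≠ Q →
    ∀ e : Sym2 V, e ∈ P.2.2.1.edges → e ∉ Q.2.2.1.edges
  covers : ∀ e ∈ G.edgeSet, ∃ P ∈ D, e ∈ P.2.2.1.edges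

/-- The path number `pn(G)`: the cardinality of a minimum path decomposition of `G`. -/
noncomputable def pathNumber : ℕ :=
  sInf {k : ℕ | ∃ D : Finset (Σ u v : V, G.Path u v), G.IsPathDecomposition D ∧ D.card = k}

/-- A finite graph has a path decomposition, namely into single edges, so that the minimum in
the definition of the path number is attained. -/
theorem exists_isPathDecomposition [Finite V] :
    ∃ D : Finset (Σ u v : V, G.Path u v), G.IsPathDecomposition D := by
  classical
  have h : ∀ e : G.edgeSet, ∃ P : (Σ u v : V, G.Path u v), P.2.2.1.edges = [e.1] := by
    rintro ⟨e, he⟩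
    induction e using Sym2.ind with
    | _ u v =>
      have huv : G.Adj u v := he
      exact ⟨⟨u, v, Path.singleton huv⟩, by simp [Path.singleton]⟩
  choose f hf using h
  have : Fintype G.edgeSet := Fintype.ofFinite _
  refine ⟨Finset.univ.image f, ?_, ?_⟩
  · intro P hP Q hQ hPQ e heP heQ
    obtain ⟨a, -, rfl⟩ := Finset.mem_image.1 hP
    obtain ⟨b, -, rfl⟩ := Finset.mem_image.1 hQ
    rw [hf, List.mem_singleton] at heP heQ
    exact hPQ (congrArg f (Subtype.ext (heP.symm.trans heQ)))
  · intro e he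
    exact ⟨f ⟨e, he⟩, Finset.mem_image_of_mem _ (Finset.mem_univ _), by simp [hf]⟩

end PathDecomposition

section ESubgraph

variable {V : Type*} [Fintype V] (G : SimpleGraph V) [DecidableRel G.Adj]

/-- The E-subgraph of `G`: the subgraph induced by the vertices of even degree in `G`. -/
abbrev eSubgraph : SimpleGraph {v : V // Even (G.degree v)} :=
  G.comap Subtype.val

/-- Gallai graphs: `pn(G) ≤ ⌊n / 2⌋`, where `n` is the number of vertices. -/
def IsGallai {V : Type*} [Fintype V] (G : SimpleGraph V) : Prop :=
  G.pathNumber ≤ Fintype.card V / 2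

/-- Single even triangle graphs: the E-subgraph is a triangle, and every vertex of odd degree
has at least two neighbours of even degree. -/
structure IsSET : Prop where
  triangle : Nonempty (G.eSubgraph ≃g completeGraph (Fin 3))
  two_le : ∀ v : V, Odd (G.degree v) →
    2 ≤ ((G.neighborFinset v).filter fun w => Even (G.degree w)).card

end ESubgraph

end SimpleGraph

/-! The proof is an induction on the number of edges. A few edges are removed, the rest is
decomposed by induction, and the removed edges are put back without using a new path. The rest need
not be connected, so the induction runs over `Admissible` edge sets, in which no component is a SET
graph; connectedness enters only when the result is transferred to `G`.

What allows an edge to return is a free path end. `DecGE E k g` records a decomposition into `k`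
paths together with a lower bound `g` on the number of ends at each vertex. One-vertex paths are
allowed and count as two ends. By parity, some path ends at every vertex of odd degree. The engine
is `DecGE.exchange`: cut the paths through `a` into arms and turn arms around, so that the free end
of an arm becomes attached to `a` in place of its first vertex. Following these turns from the
missing edges `ax`, one either meets a path that avoids `a` and can be prolonged to `a`, or finds by
counting ends many neighbours of `a` that can replace `x`. Hence `ax` can be added as soon as more
ends are known at `x` than there are neighbours of `a` without a known end (`DecGE.add`). Applied to
several edges at one centre `w`, this gives the lemmas on stars: some leaves are joined at `w`, each
creating an end there, and those ends pay for joining the other leaves (`DecGE.add_star`,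
`StarState.complete_last`).

A removal is useful if the even vertices involved become odd, because then they carry ends, and if
it creates no SET component (`Admissible.sdiff`). In a counterexample with the fewest edges this
excludes an even vertex with exactly three or exactly one even neighbours and a path on four even
vertices; so the components of the E-subgraph are isolated vertices and triangles (`Tame`).

Next, fix an odd vertex `w` and remove edges between `w` and its even neighbours, sometimes with
triangle edges opposite to them. A distinction by the parity of the number of even neighbours, with
Hall's theorem in the last case, shows that the even neighbours of `w`, if any, lie in a single
triangle, at least two of whose vertices are adjacent to `w` (`Tame.attached`). If an edge leads
from a vertex attached to a triangle to an odd vertex that does not touch that triangle, the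
attachments at both ends can be removed and restored (`Tame.decomposable_of_exit`). Without such an
edge the component of the triangle is a SET graph, which is excluded.

So all vertices on edges have odd degree. Then `Admissible.decomposable_of_forall_odd` removes two
edges `wu`, `wv` and adds a pendant edge at `u` from a new vertex; the handshake lemma absorbs the
cost of that vertex. A graph of maximum degree at most one remains, and there single edges suffice.
-/

namespace GallaiPath

/-! ### Paths as lists of vertices, their edges and ends. -/

section

variable {V : Type*}

/-- The multiset of edges traversed by a list of vertices. -/
def pathEdges : List V → Multiset (Sym2 V)
  | [] => 0
  | [_] => 0
  | a :: b :: l => s(a, b) ::ₘ pathEdges (b :: l)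

/-- The first vertex of a list, as a multiset. -/
def hd (l : List V) : Multiset V := (l.head?.toList : Multiset V)

/-- The last vertex of a list, as a multiset. -/
def lst (l : List V) : Multiset V := (l.getLast?.toList : Multiset V)

/-- The two end vertices of a list (a list with one vertex has that vertex twice). -/
def ends (l : List V) : Multiset V := hd l + lst l

@[simp] lemma hd_nil : hd ([] : List V) = 0 := rfl
@[simp] lemma hd_cons (a : V) (l : List V) : hd (a :: l) = {a} := rfl
@[simp] lemma lst_nil : lst ([] : List V) = 0 := rfl
@[simp] lemma lst_append_singleton (a : V) (l : List V) : lst (l ++ [a]) = {a} := by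
  simp [lst]
@[simp] lemma hd_reverse (l : List V) : hd l.reverse = lst l := by
  simp [hd, lst]
@[simp] lemma lst_reverse (l : List V) : lst l.reverse = hd l := by
  simp [hd, lst]

lemma ends_reverse (l : List V) : ends l.reverse = ends l := by
  simp [ends, add_comm]

lemma lst_cons_of_ne_nil (a : V) {l : List V} (h : l ≠ []) : lst (a :: l) = lst l := by
  obtain ⟨b, l, rfl⟩ := List.exists_cons_of_ne_nil h
  simp [lst]

lemma pathEdges_cons (a : V) (l : List V) :
    pathEdges (a :: l) = (hd l).map (fun v => s(a, v)) + pathEdges l := by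
  cases l with
  | nil => simp [pathEdges]
  | cons b l => simp [pathEdges]

lemma pathEdges_reverse_append_cons (l₁ : List V) (a : V) (l₂ : List V) :
    pathEdges (l₁.reverse ++ a :: l₂) = pathEdges (a :: l₁) + pathEdges (a :: l₂) := by
  induction l₁ generalizing a l₂ with
  | nil => simp [pathEdges]
  | cons b t ih =>
    rw [List.reverse_cons, List.append_assoc, List.singleton_append, ih]
    simp only [pathEdges, Sym2.eq_swap (a := b) (b := a), ← Multiset.singleton_add]
    abel

lemma pathEdges_reverse (l : List V) : pathEdges l.reverse = pathEdges l := by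
  cases l with
  | nil => rfl
  | cons a l => rw [List.reverse_cons, pathEdges_reverse_append_cons]; simp [pathEdges]

/-- Prepending `a` makes the formula correct for an empty arm as well, whose free end is then `a`
itself. -/
lemma ends_reverse_append_cons (l₁ : List V) (a : V) (l₂ : List V) :
    ends (l₁.reverse ++ a :: l₂) = lst (a :: l₁) + lst (a :: l₂) := by
  have h1 : hd (l₁.reverse ++ a :: l₂) = lst (a :: l₁) := by
    rw [← hd_reverse (a :: l₁), List.reverse_cons]
    cases h : l₁.reverse <;> simp
  have h2 : lst (l₁.reverse ++ a :: l₂) = lst (a :: l₂) := by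
    simp only [lst, List.getLast?_append]
    rw [List.getLast?_eq_some_getLast (List.cons_ne_nil a l₂), Option.some_or]
  rw [ends, h1, h2]

/-- Turning around an arm `l` at `a` exchanges its attached and its free end. -/
lemma lst_cons_reverse_add_hd (a : V) (l : List V) :
    lst (a :: l.reverse) + hd l.reverse = lst (a :: l) + hd l := by
  by_cases h : l = []
  · simp [h]
  · rw [lst_cons_of_ne_nil _ h, lst_cons_of_ne_nil _ (by simpa using h), lst_reverse, hd_reverse,
      add_comm]

lemma mem_of_mem_pathEdges {l : List V} {e : Sym2 V} (he : e ∈ pathEdges l) {v : V}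
    (hv : v ∈ e) : v ∈ l := by
  induction l with
  | nil => simp [pathEdges] at he
  | cons a l ih =>
    cases l with
    | nil => simp [pathEdges] at he
    | cons b l =>
      simp only [pathEdges, Multiset.mem_cons] at he
      rcases he with rfl | he
      · rcases Sym2.mem_iff.1 hv with rfl | rfl <;> simp
      · exact List.mem_cons_of_mem _ (ih he)

lemma not_isDiag_of_mem_pathEdges {l : List V} (hl : l.Nodup) {e : Sym2 V}
    (he : e ∈ pathEdges l) : ¬ e.IsDiag := by
  induction l with
  | nil => simp [pathEdges] at he
  | cons a l ih =>
    cases l with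
    | nil => simp [pathEdges] at he
    | cons b l =>
      simp only [pathEdges, Multiset.mem_cons] at he
      rcases he with rfl | he
      · simp only [Sym2.mk_isDiag_iff]
        rintro rfl
        simp at hl
      · exact ih (List.nodup_cons.1 hl).2 he

/-- `p` is a decomposition of the edge set `E` into paths, given as lists of vertices. -/
structure IsDec (E : Finset (Sym2 V)) {k : ℕ} (p : Fin k → List V) : Prop where
  ne_nil : ∀ i, p i ≠ []
  nodup : ∀ i, (p i).Nodup
  sum_eq : ∑ i, pathEdges (p i) = E.val

/-- Both arms are read outwards from `a`: the head of an arm is the neighbour of `a` on the path,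
its last vertex is the free end. -/
lemma exists_arms (a : V) (l : List V) (h : a ∈ l) :
    ∃ arms : Bool → List V, l = (arms false).reverse ++ a :: arms true := by
  obtain ⟨s, t, rfl⟩ := List.append_of_mem h
  exact ⟨fun b => if b then t else s.reverse, by simp⟩

/-! ### The exchange lemma. -/

variable [DecidableEq V]

/-- `E` decomposes into `k` paths such that every vertex `v` occurs at least `g v` times as an
end of a path. -/
def DecGE (E : Finset (Sym2 V)) (k : ℕ) (g : V → ℕ) : Prop :=
  ∃ p : Fin k → List V, IsDec E p ∧ ∀ v, g v ≤ (∑ i, ends (p i)).count v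

lemma DecGE.mono {E : Finset (Sym2 V)} {k : ℕ} {g g' : V → ℕ} (h : DecGE E k g)
    (hg : ∀ v, g' v ≤ g v) : DecGE E k g' := by
  obtain ⟨p, hp, h⟩ := h
  exact ⟨p, hp, fun v => (hg v).trans (h v)⟩

/-- Turning around arms of the paths through `a`, and attaching paths that avoid `a`, one can
add one of the edges `ax` with `x ∈ X`, or exchange one of them for an edge `ay`, for all the
vertices `y` of a set `Z` that is large. -/
theorem DecGE.exchange {E : Finset (Sym2 V)} {k : ℕ} {g : V → ℕ} (h : DecGE E k g) (a : V)
    (X : Finset V) (hXa : ∀ x ∈ X, x ≠ a) (hXE : ∀ x ∈ X, s(a, x) ∉ E)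
    (hno : ∀ x ∈ X, ¬ DecGE (insert s(a, x) E) k
      (fun v => g v + (if v = a then 1 else 0) - (if v = x then 1 else 0))) :
    ∃ Z : Finset V, ∑ x ∈ X, g x ≤ Z.card ∧ ∀ y ∈ Z, g y = 0 ∧ s(a, y) ∈ E ∧
      ∃ x ∈ X, DecGE ((insert s(a, x) E).erase s(a, y)) k
        (fun v => g v + (if v = y then 1 else 0) - (if v = x then 1 else 0)) := by
  classical
  obtain ⟨p, hp, hg⟩ := h
  have harms : ∀ i, ∃ arms : Bool → List V,
      (a ∈ p i → p i = (arms false).reverse ++ a :: arms true) ∧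
      (a ∉ p i → ∀ b, arms b = []) := by
    intro i
    by_cases hi : a ∈ p i
    · obtain ⟨arms, h⟩ := exists_arms a (p i) hi
      exact ⟨arms, fun _ => h, fun h' => absurd hi h'⟩
    · exact ⟨fun _ => [], fun h' => absurd h' hi, fun _ _ => rfl⟩
  choose arms harm_in harm_out using harms
  -- the family obtained by turning around the arms marked by `Φ`
  let fl : (Fin k × Bool → Bool) → Fin k × Bool → List V :=
    fun Φ θ => if Φ θ then (arms θ.1 θ.2).reverse else arms θ.1 θ.2
  let q : (Fin k × Bool → Bool) → Fin k → List V := fun Φ i =>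
    if a ∈ p i then (fl Φ (i, false)).reverse ++ a :: fl Φ (i, true) else p i
  let attM : (Fin k × Bool → Bool) → Multiset V := fun Φ => ∑ θ, hd (fl Φ θ)
  have fl_cases : ∀ Φ θ, fl Φ θ = arms θ.1 θ.2 ∨ fl Φ θ = (arms θ.1 θ.2).reverse := by
    intro Φ θ
    by_cases h : Φ θ <;> simp [fl, h]
  have fl_edges : ∀ Φ θ, pathEdges (fl Φ θ) = pathEdges (arms θ.1 θ.2) := by
    intro Φ θ
    rcases fl_cases Φ θ with h | h <;> rw [h]
    exact pathEdges_reverse _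
  have fl_ends : ∀ Φ θ, lst (a :: fl Φ θ) + hd (fl Φ θ) =
      lst (a :: arms θ.1 θ.2) + hd (arms θ.1 θ.2) := by
    intro Φ θ
    rcases fl_cases Φ θ with h | h <;> rw [h]
    exact lst_cons_reverse_add_hd _ _
  have fl_perm : ∀ Φ θ, (fl Φ θ).Perm (arms θ.1 θ.2) := by
    intro Φ θ
    rcases fl_cases Φ θ with h | h <;> rw [h]
    exact List.reverse_perm _
  let Φ₀ : Fin k × Bool → Bool := fun _ => false
  have fl0 : ∀ θ, fl Φ₀ θ = arms θ.1 θ.2 := fun θ => by simp [fl, Φ₀]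
  have q0 : q Φ₀ = p := by
    funext i
    by_cases hi : a ∈ p i
    · simp only [q, hi, if_true, fl0]; exact (harm_in i hi).symm
    · simp [q, hi]
  have q_perm : ∀ Φ i, (q Φ i).Perm (p i) := by
    intro Φ i
    by_cases hi : a ∈ p i
    · simp only [q, hi, if_true]
      rw [harm_in i hi]
      refine List.Perm.append ?_ (List.Perm.cons _ (fl_perm Φ (i, true)))
      exact (List.reverse_perm _).trans ((fl_perm Φ (i, false)).trans (List.reverse_perm _).symm)
    · simp [q, hi]
  have q_ne : ∀ Φ i, q Φ i ≠ [] := fun Φ i h => hp.ne_nil i (by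
    have := q_perm Φ i; rw [h] at this; exact this.symm.eq_nil)
  have q_nodup : ∀ Φ i, (q Φ i).Nodup := fun Φ i => (q_perm Φ i).nodup_iff.2 (hp.nodup i)
  have attM_eq : ∀ Φ, attM Φ = ∑ i, (hd (fl Φ (i, true)) + hd (fl Φ (i, false))) := by
    intro Φ
    simp only [attM, Fintype.sum_prod_type, Fintype.sum_bool]
  have q_edges : ∀ Φ, ∑ i, pathEdges (q Φ i) =
      ∑ i, (if a ∈ p i then pathEdges (arms i false) + pathEdges (arms i true)
        else pathEdges (p i)) + (attM Φ).map (fun v => s(a, v)) := by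
    intro Φ
    rw [attM_eq, ← Multiset.coe_mapAddMonoidHom, map_sum, ← Finset.sum_add_distrib]
    refine Finset.sum_congr rfl fun i _ => ?_
    by_cases hi : a ∈ p i
    · simp only [q, hi, if_true]
      rw [pathEdges_reverse_append_cons, pathEdges_cons, pathEdges_cons, fl_edges, fl_edges,
        map_add, Multiset.coe_mapAddMonoidHom]
      abel
    · have h1 := fl_cases Φ (i, true)
      have h2 := fl_cases Φ (i, false)
      simp only [harm_out i hi, List.reverse_nil, or_self] at h1 h2
      simp [q, hi, h1, h2]
  have q_ends : ∀ Φ, ∑ i, ends (q Φ i) + attM Φ = ∑ i, ends (p i) + attM Φ₀ := by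
    intro Φ
    rw [attM_eq, attM_eq, ← Finset.sum_add_distrib, ← Finset.sum_add_distrib]
    refine Finset.sum_congr rfl fun i _ => ?_
    by_cases hi : a ∈ p i
    · have e1 := fl_ends Φ (i, true)
      have e2 := fl_ends Φ (i, false)
      have hpi : ends (p i) = lst (a :: arms i false) + lst (a :: arms i true) := by
        rw [← ends_reverse_append_cons, ← harm_in i hi]
      simp only [q, hi, if_true, fl0]
      rw [ends_reverse_append_cons, hpi]
      calc _ = (lst (a :: fl Φ (i, true)) + hd (fl Φ (i, true))) +
          (lst (a :: fl Φ (i, false)) + hd (fl Φ (i, false))) := by abel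
        _ = _ := by rw [e1, e2]; abel
    · have h1 := fl_cases Φ (i, true)
      have h2 := fl_cases Φ (i, false)
      simp only [harm_out i hi, List.reverse_nil, or_self] at h1 h2
      simp [q, hi, h1, h2, fl0, harm_out i hi]
  let B : Multiset (Sym2 V) := ∑ i, (if a ∈ p i then pathEdges (arms i false) + pathEdges (arms i true)
        else pathEdges (p i))
  have hE : E.val = B + (attM Φ₀).map (fun v => s(a, v)) := by
    rw [← hp.sum_eq, ← q_edges, q0]
  have hatt_nodup : (attM Φ₀).Nodup := by
    have := E.nodup
    rw [hE] at this
    exact Multiset.Nodup.of_map _ (Multiset.nodup_add.1 this).2.1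
  have hatt_mem : ∀ y ∈ attM Φ₀, s(a, y) ∈ E := by
    intro y hy
    rw [← Finset.mem_val, hE]
    exact Multiset.mem_add.2 (Or.inr (Multiset.mem_map_of_mem _ hy))
  have ha_att : a ∉ attM Φ₀ := by
    intro h
    have h1 := hatt_mem a h
    rw [← Finset.mem_val, ← hp.sum_eq, Multiset.mem_sum] at h1
    obtain ⟨i, -, hi⟩ := h1
    exact not_isDiag_of_mem_pathEdges (hp.nodup i) hi (by simp)
  -- After the turns marked by `Φ`, the edges covered are those of `E` with `ax` added and `ay`
  -- missing.
  let State : V → V → (Fin k × Bool → Bool) → Prop := fun x y Φ => attM Φ + {y} = attM Φ₀ + {x}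
  have st_edges : ∀ x y Φ, State x y Φ →
      ∑ i, pathEdges (q Φ i) + {s(a, y)} = E.val + {s(a, x)} := by
    intro x y Φ h
    have := congrArg (Multiset.map fun v => s(a, v)) h
    simp only [Multiset.map_add, Multiset.map_singleton] at this
    rw [q_edges, hE, add_assoc, add_assoc, this]
  have st_ends : ∀ x y Φ, State x y Φ →
      ∑ i, ends (q Φ i) + {x} = ∑ i, ends (p i) + {y} := by
    intro x y Φ h
    apply add_right_cancel (b := attM Φ)
    calc _ = (∑ i, ends (q Φ i) + attM Φ) + {x} := by abel
      _ = ∑ i, ends (p i) + (attM Φ₀ + {x}) := by rw [q_ends, add_assoc]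
      _ = ∑ i, ends (p i) + (attM Φ + {y}) := by rw [h]
      _ = _ := by abel
  -- vertices whose edge to `a` can be made the missing one
  let R : Finset V := (X ∪ (attM Φ₀).toFinset).filter (fun y => ∃ x ∈ X, ∃ Φ, State x y Φ)
  have memR : ∀ y, y ∈ R ↔ ∃ x ∈ X, ∃ Φ, State x y Φ := by
    intro y
    simp only [R, Finset.mem_filter, and_iff_right_iff_imp]
    rintro ⟨x, hx, Φ, h⟩
    have : y ∈ attM Φ₀ + {x} := by rw [← h]; simp
    simp only [Multiset.mem_add, Multiset.mem_singleton] at this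
    rcases this with h | rfl
    · exact Finset.mem_union_right _ (by simpa using h)
    · exact Finset.mem_union_left _ hx
  have hXR : X ⊆ R := fun x hx => (memR x).2 ⟨x, hx, Φ₀, rfl⟩
  have hRatt : ∀ y ∈ R, y ∉ X → y ∈ attM Φ₀ := by
    intro y hy hyX
    have := (Finset.mem_filter.1 hy).1
    simpa [hyX] using this
  have hXatt : ∀ x ∈ X, x ∉ attM Φ₀ := fun x hx h => hXE x hx (hatt_mem x h)
  -- This covers the empty arms: a path that ends at `a` contributes no end in `R` there.
  have haR : a ∉ R := by
    intro h
    by_cases haX : a ∈ X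
    · exact hXa a haX rfl
    · exact ha_att (hRatt a h haX)
  -- ends of paths that avoid `a` are not in `R`
  have hout : ∀ i, a ∉ p i → ∀ y ∈ ends (p i), y ∉ R := by
    intro i hi y hy hyR
    obtain ⟨x, hx, Φ, hΦ⟩ := (memR y).1 hyR
    obtain ⟨l, hl, hly, hedge, hends⟩ : ∃ l : List V, l.Perm (p i) ∧ hd l = {y} ∧
        pathEdges l = pathEdges (p i) ∧ ends l = ends (p i) := by
      rcases Multiset.mem_add.1 hy with hy | hy
      · refine ⟨p i, List.Perm.refl _, ?_, rfl, rfl⟩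
        cases hpi : p i with
        | nil => simp [hpi] at hy
        | cons b l => rw [hpi] at hy; simp at hy; simp [hy]
      · refine ⟨(p i).reverse, List.reverse_perm _, ?_, pathEdges_reverse _, ends_reverse _⟩
        rw [← hd_reverse] at hy
        cases hpi : (p i).reverse with
        | nil => simp [hpi] at hy
        | cons b l => rw [hpi] at hy; simp at hy; simp [hy]
    have hlne : l ≠ [] := fun h => hp.ne_nil i (by rw [h] at hl; exact hl.symm.eq_nil)
    have hqi : q Φ i = p i := by simp [q, hi]
    have key : ∀ f : List V → Multiset V, ∀ z : List V,
        ∑ j, f (Function.update (q Φ) i z j) + f (p i) = ∑ j, f (q Φ j) + f z := by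
      intro f z
      rw [← Finset.add_sum_erase _ _ (Finset.mem_univ i),
        ← Finset.add_sum_erase _ (fun j => f (q Φ j)) (Finset.mem_univ i)]
      rw [Function.update_self, hqi, Finset.sum_congr rfl (g := fun j => f (q Φ j))]
      · abel
      · intro j hj
        rw [Function.update_of_ne (Finset.ne_of_mem_erase hj)]
    have keyE : ∀ f : List V → Multiset (Sym2 V), ∀ z : List V,
        ∑ j, f (Function.update (q Φ) i z j) + f (p i) = ∑ j, f (q Φ j) + f z := by
      intro f z
      rw [← Finset.add_sum_erase _ _ (Finset.mem_univ i),
        ← Finset.add_sum_erase _ (fun j => f (q Φ j)) (Finset.mem_univ i)]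
      rw [Function.update_self, hqi, Finset.sum_congr rfl (g := fun j => f (q Φ j))]
      · abel
      · intro j hj
        rw [Function.update_of_ne (Finset.ne_of_mem_erase hj)]
    -- In the state where only `ay` is missing, the path that ends at `y` and avoids `a` is
    -- prolonged by `ya`. This would add `ax`.
    refine hno x hx ⟨Function.update (q Φ) i (a :: l), ⟨?_, ?_, ?_⟩, ?_⟩
    · intro j
      by_cases hj : j = i
      · subst hj; simp
      · rw [Function.update_of_ne hj]; exact q_ne Φ j
    · intro j
      by_cases hj : j = i
      · subst hj
        rw [Function.update_self, List.nodup_cons]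
        exact ⟨fun h => hi (hl.mem_iff.1 h), hl.nodup_iff.2 (hp.nodup j)⟩
      · rw [Function.update_of_ne hj]; exact q_nodup Φ j
    · have h1 := keyE pathEdges (a :: l)
      rw [pathEdges_cons, hly, hedge, Multiset.map_singleton, ← add_assoc, st_edges x y Φ hΦ] at h1
      rw [add_right_cancel h1, Finset.insert_val_of_notMem (hXE x hx), ← Multiset.singleton_add,
        add_comm]
    · have h1 := key ends (a :: l)
      have h2 : ends (a :: l) + {y} = ends (p i) + {a} := by
        rw [← hends, ends, ends, hd_cons, lst_cons_of_ne_nil _ hlne, hly]; abel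
      have h3 : ∑ j, ends (Function.update (q Φ) i (a :: l) j) + {x} =
          ∑ i, ends (p i) + {a} := by
        apply add_right_cancel (b := ends (p i) + {y})
        calc _ = (∑ j, ends (Function.update (q Φ) i (a :: l) j) + ends (p i)) + {x} + {y} := by
              abel
          _ = (∑ j, ends (q Φ j) + {x}) + (ends (a :: l) + {y}) := by rw [h1]; abel
          _ = _ := by rw [st_ends x y Φ hΦ, h2]; abel
      intro v
      have h4 := congrArg (Multiset.count v) h3
      simp only [Multiset.count_add, Multiset.count_singleton] at h4
      have := hg v
      dsimp only
      omega
  -- an arm with one end in `R` has both ends in `R`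
  have hin : ∀ θ : Fin k × Bool, ∀ y ∈ R, ∀ z, hd (arms θ.1 θ.2) + lst (arms θ.1 θ.2) = {y} + {z} →
      z ∈ R := by
    intro θ y hy z hyz
    obtain ⟨x, hx, Φ, hΦ⟩ := (memR y).1 hy
    -- The edge `ay` is the missing one, and no vertex is attached twice; so `y` can only be the
    -- free end of its arm, with `z` attached.
    have hy1 : y ∉ attM Φ := by
      intro hyΦ
      have h1 := congrArg (Multiset.count y) hΦ
      simp only [Multiset.count_add, Multiset.count_singleton] at h1
      have h2 := Multiset.one_le_count_iff_mem.2 hyΦ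
      have h3 := Multiset.nodup_iff_count_le_one.1 hatt_nodup y
      by_cases hyx : y = x
      · have h4 := Multiset.count_eq_zero.2 (hXatt x hx)
        subst hyx
        simp at h1
        omega
      · simp [hyx] at h1
        omega
    have hsum : hd (fl Φ θ) + lst (fl Φ θ) = {y} + {z} := by
      rw [← hyz]
      rcases fl_cases Φ θ with h | h <;> rw [h]
      rw [hd_reverse, lst_reverse, add_comm]
    have hhd : ∀ u, hd (fl Φ θ) = {u} → u ∈ attM Φ := by
      intro u hu
      refine Multiset.mem_sum.2 ⟨θ, Finset.mem_univ _, ?_⟩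
      rw [hu]; simp
    have hhz : hd (fl Φ θ) = {z} ∧ lst (fl Φ θ) = {y} := by
      cases hfl : fl Φ θ with
      | nil => simp [hfl] at hsum
      | cons u l =>
        have hu : u ≠ y := fun h => hy1 (hhd y (by rw [hfl, h]; rfl))
        rw [hfl, hd_cons] at hsum
        have : u ∈ ({y} + {z} : Multiset V) := by rw [← hsum]; simp
        simp [hu] at this
        subst this
        refine ⟨rfl, ?_⟩
        rw [add_comm ({y} : Multiset V)] at hsum
        exact add_left_cancel hsum
    -- Turning this arm around attaches `y` and makes `az` the missing edge.
    refine (memR z).2 ⟨x, hx, Function.update Φ θ (!Φ θ), ?_⟩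
    have hflip : fl (Function.update Φ θ (!Φ θ)) θ = (fl Φ θ).reverse := by
      by_cases h : Φ θ <;> simp [fl, h]
    have hsame : ∀ θ' ≠ θ, fl (Function.update Φ θ (!Φ θ)) θ' = fl Φ θ' := by
      intro θ' h
      simp [fl, Function.update_of_ne h]
    have : attM (Function.update Φ θ (!Φ θ)) + {z} = attM Φ + {y} := by
      simp only [attM]
      rw [← Finset.add_sum_erase _ _ (Finset.mem_univ θ),
        ← Finset.add_sum_erase _ (fun θ' => hd (fl Φ θ')) (Finset.mem_univ θ), hflip, hd_reverse,
        hhz.1, hhz.2, Finset.sum_congr rfl (g := fun θ' => hd (fl Φ θ'))]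
      · abel
      · intro j hj
        rw [hsame j (Finset.ne_of_mem_erase hj)]
    exact this.trans hΦ
  -- Every path end in `R` is the free end of a nonempty arm, whose attached end is then in `R` too.
  have hcount : (∑ i, ends (p i)).countP (· ∈ R) ≤ (attM Φ₀).countP (· ∈ R) := by
    rw [attM_eq, ← Multiset.coe_countPAddMonoidHom, map_sum, map_sum]
    refine Finset.sum_le_sum fun i _ => ?_
    simp only [Multiset.coe_countPAddMonoidHom, fl0, Multiset.countP_add]
    by_cases hi : a ∈ p i
    · have hpi : ends (p i) = lst (a :: arms i false) + lst (a :: arms i true) := by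
        rw [← ends_reverse_append_cons, ← harm_in i hi]
      have hone : ∀ b, (lst (a :: arms i b)).countP (· ∈ R) ≤ (hd (arms i b)).countP (· ∈ R) := by
        intro b
        rcases List.eq_nil_or_concat (arms i b) with hb | ⟨l, u, hb⟩
        · rw [hb]; simp [lst, haR, Multiset.countP_eq_zero]
        · have hlst : lst (arms i b) = {u} := by rw [hb]; simp
          have hne : arms i b ≠ [] := by rw [hb]; simp
          rw [lst_cons_of_ne_nil _ hne, hlst]
          obtain ⟨w, l', hw⟩ := List.exists_cons_of_ne_nil hne
          have hhd : hd (arms i b) = {w} := by rw [hw]; rfl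
          rw [hhd]
          by_cases hu : u ∈ R
          · have := hin (i, b) u hu w (by rw [hlst, hhd, add_comm])
            simp [← Multiset.cons_zero, Multiset.countP_cons_of_pos, hu, this]
          · simp [← Multiset.cons_zero, Multiset.countP_cons_of_neg, hu]
      have := hone true
      have := hone false
      rw [hpi, Multiset.countP_add]
      omega
    · have : (ends (p i)).countP (· ∈ R) = 0 := by
        rw [Multiset.countP_eq_zero]
        exact fun y hy => hout i hi y hy
      omega
  have hsumcount : ∀ m : Multiset V, m.countP (· ∈ R) = ∑ v ∈ R, m.count v := by
    intro m
    induction m using Multiset.induction_on with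
    | empty => simp
    | cons u m ih =>
      simp only [Multiset.countP_cons, Multiset.count_cons, Finset.sum_add_distrib, ih,
        Finset.sum_ite_eq']
  set d : V → ℕ := fun v => (∑ i, ends (p i)).count v with hd_def
  have h1 : ∑ v ∈ R, d v ≤ (R \ X).card := by
    calc ∑ v ∈ R, d v = (∑ i, ends (p i)).countP (· ∈ R) := (hsumcount _).symm
      _ ≤ _ := hcount
      _ = ∑ v ∈ R, (attM Φ₀).count v := hsumcount _
      _ = ∑ v ∈ R \ X, (attM Φ₀).count v := by
          rw [← Finset.sum_sdiff hXR]
          simp only [Nat.add_eq_left]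
          exact Finset.sum_eq_zero fun x hx => Multiset.count_eq_zero.2 (hXatt x hx)
      _ ≤ ∑ v ∈ R \ X, 1 := Finset.sum_le_sum fun v _ =>
          Multiset.nodup_iff_count_le_one.1 hatt_nodup v
      _ = _ := by simp
  -- The vertices of `R \ X` are attached once each. Those with an end are paid for by their own
  -- ends, so the ends in `X` must be matched by vertices of `R \ X` without any end; these form
  -- `Z`.
  have h2 : (R \ X).card ≤ ((R \ X).filter (fun v => d v = 0)).card + ∑ v ∈ R \ X, d v := by
    rw [Finset.card_filter, ← Finset.sum_add_distrib, Finset.card_eq_sum_ones]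
    refine Finset.sum_le_sum fun v _ => ?_
    split_ifs <;> omega
  rw [← Finset.sum_sdiff hXR] at h1
  refine ⟨(R \ X).filter (fun v => d v = 0), ?_, ?_⟩
  · have : ∑ x ∈ X, g x ≤ ∑ x ∈ X, d x := Finset.sum_le_sum fun x _ => hg x
    omega
  · intro y hy
    obtain ⟨hy1, hy0⟩ := Finset.mem_filter.1 hy
    obtain ⟨hyR, hyX⟩ := Finset.mem_sdiff.1 hy1
    have hyE := hatt_mem y (hRatt y hyR hyX)
    refine ⟨Nat.le_zero.1 (hy0 ▸ hg y), hyE, ?_⟩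
    obtain ⟨x, hx, Φ, hΦ⟩ := (memR y).1 hyR
    refine ⟨x, hx, q Φ, ⟨q_ne Φ, q_nodup Φ, ?_⟩, ?_⟩
    · apply add_right_cancel (b := {s(a, y)})
      rw [st_edges x y Φ hΦ, add_comm _ {s(a, y)}, Multiset.singleton_add, Finset.erase_val,
        Multiset.cons_erase (by simp [hyE]), Finset.insert_val_of_notMem (hXE x hx),
        ← Multiset.singleton_add, add_comm]
    · intro v
      have h4 := congrArg (Multiset.count v) (st_ends x y Φ hΦ)
      simp only [Multiset.count_add, Multiset.count_singleton] at h4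
      have := hg v
      dsimp only
      omega

end

/-! ### Degrees, parity, and the addition of single edges. -/

section

variable {V : Type*} [DecidableEq V]

/-- The degree of a vertex in a finite set of edges. -/
def deg (E : Finset (Sym2 V)) (v : V) : ℕ := (E.filter (v ∈ ·)).card

lemma deg_eq_countP (E : Finset (Sym2 V)) (v : V) : deg E v = E.val.countP (v ∈ ·) := by
  rw [deg, Finset.card_def, Finset.filter_val, Multiset.countP_eq_card_filter]

/-- An inner vertex of a path lies on two of its edges and an end on one. A one-vertex path agrees
with this because its vertex counts as two ends. -/
lemma countP_pathEdges_mod_two {l : List V} (hl : l.Nodup) (v : V) :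
    (pathEdges l).countP (v ∈ ·) % 2 = (ends l).count v % 2 := by
  induction l with
  | nil => simp [pathEdges, ends]
  | cons a l ih =>
    cases l with
    | nil =>
      simp only [pathEdges, ends, hd, lst]
      by_cases h : v = a <;> simp [h]
    | cons b l =>
      have ih := ih (List.nodup_cons.1 hl).2
      have hab : a ≠ b := by rintro rfl; simp at hl
      simp only [ends, hd_cons, Multiset.count_add, Multiset.count_singleton] at ih ⊢
      rw [lst_cons_of_ne_nil a (List.cons_ne_nil b l)]
      simp only [pathEdges, Multiset.countP_cons, Sym2.mem_iff]
      by_cases h1 : v = a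
      · have h2 : v ≠ b := fun h => hab (h1.symm.trans h)
        simp only [h1, true_or, if_true] at ih ⊢
        simp only [hab, if_false] at ih
        omega
      · by_cases h2 : v = b
        · simp only [h2, or_true, if_true] at ih ⊢
          simp only [hab.symm, if_false]
          omega
        · simp only [h1, h2, or_self, if_false] at ih ⊢
          omega

lemma IsDec.count_mod_two {E : Finset (Sym2 V)} {k : ℕ} {p : Fin k → List V} (hp : IsDec E p)
    (v : V) : (∑ i, ends (p i)).count v % 2 = deg E v % 2 := by
  rw [deg_eq_countP, ← hp.sum_eq, Multiset.count_sum', ← Multiset.coe_countPAddMonoidHom, map_sum,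
    Finset.sum_nat_mod]
  refine Eq.trans ?_ (Finset.sum_nat_mod _ _ _).symm
  congr 1
  exact Finset.sum_congr rfl fun i _ => (countP_pathEdges_mod_two (hp.nodup i) v).symm

/-- Any bound on ends may be forgotten in favour of the one that parity gives for free. It therefore
suffices to end each reduction with the bound `0`. -/
lemma DecGE.deg_mod_two {E : Finset (Sym2 V)} {k : ℕ} {g : V → ℕ} (h : DecGE E k g) :
    DecGE E k (fun v => deg E v % 2) := by
  obtain ⟨p, hp, -⟩ := h
  exact ⟨p, hp, fun v => by dsimp only; rw [← hp.count_mod_two]; exact Nat.mod_le _ _⟩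

lemma DecGE.not_isDiag {E : Finset (Sym2 V)} {k : ℕ} {g : V → ℕ} (h : DecGE E k g)
    {e : Sym2 V} (he : e ∈ E) : ¬ e.IsDiag := by
  obtain ⟨p, hp, -⟩ := h
  rw [← Finset.mem_val, ← hp.sum_eq, Multiset.mem_sum] at he
  obtain ⟨i, -, hi⟩ := he
  exact not_isDiag_of_mem_pathEdges (hp.nodup i) hi

lemma DecGE.adj_ne {E : Finset (Sym2 V)} {k : ℕ} {g : V → ℕ} (h : DecGE E k g)
    {a b : V} (he : s(a, b) ∈ E) : a ≠ b := fun hab => h.not_isDiag he (by simp [hab])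

/-- If more paths end at `x` than there are neighbours of `a` at which no path ends, then the
edge `ax` can be added to a decomposition. -/
lemma DecGE.add {E : Finset (Sym2 V)} {k : ℕ} {g : V → ℕ} (h : DecGE E k g) {a x : V}
    (hax : x ≠ a) (hE : s(a, x) ∉ E) {Z : Finset V}
    (hZ : ∀ y, s(a, y) ∈ E → g y = 0 → y ∈ Z) (hc : Z.card < g x) {g' : V → ℕ}
    (hg' : ∀ v, g' v ≤ g v + (if v = a then 1 else 0) - (if v = x then 1 else 0)) :
    DecGE (insert s(a, x) E) k g' := by
  by_contra hcon
  obtain ⟨Z', h1, h2⟩ := h.exchange a {x} (by simpa using hax) (by simpa using hE)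
    (by simpa using fun h => hcon (h.mono hg'))
  have : Z' ⊆ Z := fun y hy => hZ y (h2 y hy).2.1 (h2 y hy).1
  have := Finset.card_le_card this
  simp at h1
  omega

/-- The edges joining `w` to the vertices in `X`. -/
def star (w : V) (X : Finset V) : Finset (Sym2 V) := X.image (fun v => s(w, v))

lemma mk_mem_star {w a b : V} {X : Finset V} :
    s(a, b) ∈ star w X ↔ (a = w ∧ b ∈ X) ∨ (b = w ∧ a ∈ X) := by
  simp only [star, Finset.mem_image, Sym2.eq_iff]
  constructor
  · rintro ⟨v, hv, ⟨rfl, rfl⟩ | ⟨rfl, rfl⟩⟩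
    · exact Or.inl ⟨rfl, hv⟩
    · exact Or.inr ⟨rfl, hv⟩
  · rintro (⟨rfl, h⟩ | ⟨rfl, h⟩)
    · exact ⟨b, h, Or.inl ⟨rfl, rfl⟩⟩
    · exact ⟨a, h, Or.inr ⟨rfl, rfl⟩⟩

@[simp] lemma star_empty (w : V) : star w ∅ = ∅ := rfl

lemma star_insert (w v : V) (X : Finset V) : star w (insert v X) = insert s(w, v) (star w X) := by
  simp [star]

lemma star_union (w : V) (X Y : Finset V) : star w (X ∪ Y) = star w X ∪ star w Y := by
  simp [star, Finset.image_union]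

/-- The edges of `star w A` have been added at `w` to a decomposition of `E`. -/
def StarState (E : Finset (Sym2 V)) (k : ℕ) (g : V → ℕ) (w : V) (A : Finset V) : Prop :=
  DecGE (E ∪ star w A) k
    (fun v => if v = w then g w + A.card else if v ∈ A then g v - 1 else g v)

/-! ### Adding the edges of a star. -/

section Star

variable {E : Finset (Sym2 V)} {k : ℕ} {g : V → ℕ} {w : V} {X A : Finset V}

lemma DecGE.starState_empty (h : DecGE E k g) : StarState E k g w ∅ := by
  unfold StarState
  rw [star_empty, Finset.union_empty]
  refine h.mono fun v => ?_
  by_cases hv : v = w <;> simp [hv]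

lemma DecGE.exists_max_starState (h : DecGE E k g) (X : Finset V) :
    ∃ A ⊆ X, StarState E k g w A ∧ ∀ B ⊆ X, StarState E k g w B → B.card ≤ A.card := by
  classical
  obtain ⟨A, hA, hmax⟩ := Finset.exists_max_image
    (X.powerset.filter fun A => StarState E k g w A) Finset.card
    ⟨∅, by simp [h.starState_empty]⟩
  simp only [Finset.mem_filter, Finset.mem_powerset] at hA hmax
  exact ⟨A, hA.1, hA.2, fun B hB hB' => hmax B ⟨hB, hB'⟩⟩

/-- Since `A` has maximum size, no further edge can simply be added, so `DecGE.exchange` at `w` must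
offer exchanges. As `g` is positive on `X` and on the old neighbours of `w`, only leaves in `A` can
lack a known end; the edges given up thus belong to the star. With `X'` varying, this is Hall's
condition for exchanging missing leaves with leaves in `A`. -/
lemma StarState.exchange (hA : StarState E k g w A) (hwX : w ∉ X)
    (hXE : ∀ x ∈ X, s(w, x) ∉ E) (hX : ∀ x ∈ X, 1 ≤ g x) (hN : ∀ y, s(w, y) ∈ E → 1 ≤ g y)
    (hAX : A ⊆ X) (hmax : ∀ B ⊆ X, StarState E k g w B → B.card ≤ A.card)
    {X' : Finset V} (hX' : X' ⊆ X \ A) :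
    ∃ Z ⊆ A, X'.card ≤ Z.card ∧ ∀ y ∈ Z, ∃ x ∈ X', StarState E k g w (insert x (A.erase y)) := by
  have hX'' : ∀ x ∈ X', x ∈ X ∧ x ∉ A := fun x hx => Finset.mem_sdiff.1 (hX' hx)
  have hnew : ∀ x ∈ X', s(w, x) ∉ E ∪ star w A := by
    intro x hx h
    rcases Finset.mem_union.1 h with h | h
    · exact hXE x (hX'' x hx).1 h
    · rcases mk_mem_star.1 h with h | h
      · exact (hX'' x hx).2 h.2
      · exact hwX (h.1 ▸ (hX'' x hx).1)
  obtain ⟨Z, hZ1, hZ2⟩ := DecGE.exchange hA w X' (fun x hx h => hwX (h ▸ (hX'' x hx).1)) hnew (by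
    intro x hx hcon
    have h1 : StarState E k g w (insert x A) := by
      unfold StarState
      rw [star_insert, Finset.union_insert]
      refine hcon.mono fun v => ?_
      have hxA := (hX'' x hx).2
      have hxw : x ≠ w := fun h => hwX (h ▸ (hX'' x hx).1)
      rw [Finset.card_insert_of_notMem hxA]
      by_cases hv : v = w
      · subst hv; simp [hxw.symm]; omega
      · by_cases hvx : v = x
        · subst hvx; simp [hv, hxA]
        · simp [hv, hvx]
    have h2 := hmax _ (Finset.insert_subset (hX'' x hx).1 hAX) h1
    rw [Finset.card_insert_of_notMem (hX'' x hx).2] at h2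
    omega)
  have hZA : Z ⊆ A := by
    intro y hy
    obtain ⟨h1, h2, -⟩ := hZ2 y hy
    have hyw : y ≠ w := (DecGE.adj_ne hA h2).symm
    by_contra hyA
    rcases Finset.mem_union.1 h2 with h | h
    · have := hN y h
      simp [hyw, hyA] at h1
      omega
    · rcases mk_mem_star.1 h with h | h
      · exact hyA h.2
      · exact hyw h.1
  refine ⟨Z, hZA, ?_, ?_⟩
  · refine le_trans ?_ hZ1
    rw [Finset.card_eq_sum_ones]
    refine Finset.sum_le_sum fun x hx => ?_
    have hxw : x ≠ w := fun h => hwX (h ▸ (hX'' x hx).1)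
    simp [hxw, (hX'' x hx).2, hX x (hX'' x hx).1]
  · intro y hy
    obtain ⟨-, -, x, hx, h⟩ := hZ2 y hy
    refine ⟨x, hx, ?_⟩
    have hyA := hZA hy
    have hxA := (hX'' x hx).2
    have hxy : x ≠ y := fun h => hxA (h ▸ hyA)
    have hxw : x ≠ w := fun h => hwX (h ▸ (hX'' x hx).1)
    have hyw : y ≠ w := fun h => hwX (h ▸ hAX hyA)
    have hset : (insert s(w, x) (E ∪ star w A)).erase s(w, y) =
        E ∪ star w (insert x (A.erase y)) := by
      have hyE := hXE y (hAX hyA)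
      ext e
      simp only [Finset.mem_erase, Finset.mem_insert, Finset.mem_union, star, Finset.mem_image]
      constructor
      · rintro ⟨h1, rfl | h2 | ⟨v, hv, rfl⟩⟩
        · exact Or.inr ⟨x, Or.inl rfl, rfl⟩
        · exact Or.inl h2
        · exact Or.inr ⟨v, Or.inr ⟨fun h => h1 (by rw [h]), hv⟩, rfl⟩
      · rintro (h | ⟨v, rfl | ⟨h1, h2⟩, rfl⟩)
        · exact ⟨fun h' => hyE (h' ▸ h), Or.inr (Or.inl h)⟩
        · exact ⟨fun h => hxy (Sym2.congr_right.1 h), Or.inl rfl⟩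
        · exact ⟨fun h => h1 (Sym2.congr_right.1 h), Or.inr (Or.inr ⟨v, h2, rfl⟩)⟩
    unfold StarState
    rw [← hset]
    refine h.mono fun v => ?_
    have hcard : (insert x (A.erase y)).card = A.card := by
      rw [Finset.card_insert_of_notMem (fun h => hxA (Finset.mem_of_mem_erase h)),
        Finset.card_erase_add_one hyA]
    rw [hcard]
    by_cases hv : v = w
    · subst hv; simp [hxw.symm, hyw.symm]
    · by_cases hvx : v = x
      · subst hvx; simp [hv, hxA, hxy]
      · by_cases hvy : v = y
        · subst hvy
          have := hX v (hAX hyA)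
          simp [hv, hxy.symm, hyA]; omega
        · simp [hv, hvx, hvy]

lemma StarState.card_sdiff_le (hA : StarState E k g w A) (hwX : w ∉ X)
    (hXE : ∀ x ∈ X, s(w, x) ∉ E) (hX : ∀ x ∈ X, 1 ≤ g x) (hN : ∀ y, s(w, y) ∈ E → 1 ≤ g y)
    (hAX : A ⊆ X) (hmax : ∀ B ⊆ X, StarState E k g w B → B.card ≤ A.card) :
    (X \ A).card ≤ A.card := by
  obtain ⟨Z, h1, h2, -⟩ := hA.exchange hwX hXE hX hN hAX hmax (Finset.Subset.refl _)
  exact h2.trans (Finset.card_le_card h1)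

/-- The edges of a star with centre `w` can be added at the leaves if sufficiently many paths end
at `w`. -/
lemma DecGE.add_star_at_leaves (h : DecGE E k g) {R : Finset V} (hwR : w ∉ R)
    (hE : ∀ v ∈ R, s(w, v) ∉ E) {Z : V → Finset V}
    (hZ : ∀ v ∈ R, ∀ y, s(v, y) ∈ E → g y = 0 → y ∈ Z v) (hc : ∀ v ∈ R, (Z v).card ≤ 2)
    (hg : R.card + 2 ≤ g w) :
    DecGE (E ∪ star w R) k
      (fun v => if v = w then g w - R.card else if v ∈ R then g v + 1 else g v) := by
  induction R using Finset.induction_on with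
  | empty =>
    rw [star_empty, Finset.union_empty]
    refine h.mono fun v => ?_
    by_cases hv : v = w <;> simp [hv]
  | insert v R hvR ih =>
    rw [Finset.card_insert_of_notMem hvR] at hg
    have hvw : v ≠ w := fun h => hwR (by simp [h])
    have hwR' : w ∉ R := fun h => hwR (Finset.mem_insert_of_mem h)
    have ih := ih hwR' (fun u hu => hE u (Finset.mem_insert_of_mem hu))
      (fun u hu => hZ u (Finset.mem_insert_of_mem hu))
      (fun u hu => hc u (Finset.mem_insert_of_mem hu)) (by omega)
    rw [star_insert, Finset.union_insert, Sym2.eq_swap]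
    refine ih.add (Z := Z v) hvw.symm ?_ ?_ ?_ ?_
    · intro h
      rcases Finset.mem_union.1 h with h | h
      · exact hE v (Finset.mem_insert_self _ _) (by rwa [Sym2.eq_swap])
      · rcases mk_mem_star.1 h with h | h
        · exact hvw h.1
        · exact hvR h.2
    · intro y hy hgy
      by_cases hyw : y = w
      · simp [hyw] at hgy; omega
      · refine hZ v (Finset.mem_insert_self _ _) y ?_ ?_
        · rcases Finset.mem_union.1 hy with h | h
          · exact h
          · rcases mk_mem_star.1 h with h | h
            · exact absurd h.1 hvw
            · exact absurd h.1 hyw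
        · rw [if_neg hyw] at hgy
          split_ifs at hgy
          exact hgy
    -- Of the ends at `w` at least three are left when the edge to `v` is added, against at most two
    -- neighbours of `v` without a known end. This is the role of the summand `2` in `hg`.
    · have := hc v (Finset.mem_insert_self _ _)
      simp only [if_true]
      omega
    · intro u
      rw [Finset.card_insert_of_notMem hvR]
      by_cases hu : u = w
      · subst hu; simp [hvw.symm]; omega
      · by_cases huv : u = v
        · subst huv; simp [hu, hvR]
        · simp [hu, huv]

/-- The leaves in `A` were joined at `w` and created ends there; each leaf in `R` now uses up one of
these ends and gains one itself. In return, a leaf in `A` may have lost its only known end and has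
to be counted in `Z`. -/
lemma StarState.complete (hA : StarState E k g w A) (hwX : w ∉ X)
    (hXE : ∀ x ∈ X, s(w, x) ∉ E) {R : Finset V} (hR : R ⊆ X \ A)
    {Z : V → Finset V}
    (hZ : ∀ v ∈ R, ∀ y, s(v, y) ∈ E → g y = 0 ∨ y ∈ A → y ∈ Z v) (hc : ∀ v ∈ R, (Z v).card ≤ 2)
    (hg : R.card + 2 ≤ g w + A.card) :
    DecGE (E ∪ star w (A ∪ R)) k
      (fun v => if v = w then g w + A.card - R.card else if v ∈ A then g v - 1 else
        if v ∈ R then g v + 1 else g v) := by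
  have hwR : w ∉ R := fun h => hwX (Finset.mem_sdiff.1 (hR h)).1
  have h := DecGE.add_star_at_leaves hA (w := w) (R := R) (Z := Z) hwR ?_ ?_ hc (by simpa using hg)
  · rw [star_union, ← Finset.union_assoc]
    refine h.mono fun v => ?_
    by_cases hv : v = w
    · simp [hv]
    · by_cases hvA : v ∈ A
      · simp only [hv, if_false, hvA, if_true]
        split_ifs <;> omega
      · simp [hv, hvA]
  · intro v hv h
    obtain ⟨h1, h2⟩ := Finset.mem_sdiff.1 (hR hv)
    rcases Finset.mem_union.1 h with h | h
    · exact hXE v h1 h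
    · rcases mk_mem_star.1 h with h | h
      · exact h2 h.2
      · exact hwX (h.1 ▸ h1)
  · intro v hv y hy hgy
    have hvw : v ≠ w := fun h => hwR (h ▸ hv)
    by_cases hyw : y = w
    · simp only [hyw, if_true] at hgy; omega
    · refine hZ v hv y ?_ ?_
      · rcases Finset.mem_union.1 hy with h | h
        · exact h
        · rcases mk_mem_star.1 h with h | h
          · exact absurd h.1 hvw
          · exact absurd h.1 hyw
      · by_cases hyA : y ∈ A
        · exact Or.inr hyA
        · simp [hyw, hyA] at hgy
          exact Or.inl hgy

/-- A star with an odd number of leaves can be added if paths end at all relevant vertices. -/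
lemma DecGE.add_star (h : DecGE E k g) (hwX : w ∉ X)
    (hXE : ∀ x ∈ X, s(w, x) ∉ E) (hX : ∀ x ∈ X, 1 ≤ g x) (hN : ∀ y, s(w, y) ∈ E → 1 ≤ g y)
    (hw : 1 ≤ g w) (hodd : Odd X.card) {Z : V → Finset V}
    (hZ : ∀ v ∈ X, ∀ y, s(v, y) ∈ E → g y = 0 ∨ y ∈ X → y ∈ Z v)
    (hc : ∀ v ∈ X, (Z v).card ≤ 2) :
    DecGE (E ∪ star w X) k (fun v => if v = w then 2 else if v ∈ X then 0 else g v) := by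
  obtain ⟨A, hAX, hA, hmax⟩ := h.exists_max_starState (w := w) X
  have h1 := hA.card_sdiff_le hwX hXE hX hN hAX hmax
  have h2 := Finset.card_sdiff_add_card_eq_card hAX
  -- Parity improves `|X \ A| ≤ |A|` to `|X \ A| + 1 ≤ |A|`; together with an end at `w` this gives
  -- the two spare ends that `StarState.complete` needs.
  obtain ⟨m, hm⟩ := hodd
  have h3 := hA.complete hwX hXE (Finset.Subset.refl _) (Z := Z)
    (fun v hv y hy h => hZ v (Finset.mem_sdiff.1 hv).1 y hy (h.imp_right fun h => hAX h))
    (fun v hv => hc v (Finset.mem_sdiff.1 hv).1) (by omega)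
  rw [Finset.union_sdiff_of_subset hAX] at h3
  refine h3.mono fun v => ?_
  by_cases hv : v = w
  · simp only [hv, if_true]; omega
  · by_cases hvX : v ∈ X
    · simp [hv, hvX]
    · have : v ∉ A := fun h => hvX (hAX h)
      simp [hv, hvX, this]

/-- A star can be completed if some edge `wx` that is still missing can be added last. -/
lemma StarState.complete_last (hA : StarState E k g w A) (hwX : w ∉ X)
    (hXE : ∀ x ∈ X, s(w, x) ∉ E) (hAX : A ⊆ X) {Z : V → Finset V}
    (hZ : ∀ v ∈ X, ∀ y, s(v, y) ∈ E → g y = 0 ∨ y ∈ A → y ∈ Z v)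
    (hc : ∀ v ∈ X, (Z v).card ≤ 2) {x : V} (hx : x ∈ X \ A) {Zx : Finset V}
    (hZx : ∀ y, s(x, y) ∈ E → g y = 0 ∨ y ∈ A → y ∈ Zx) (hcx : Zx.card ≤ 1)
    (hcard : (X \ A).card + 1 ≤ g w + A.card) :
    DecGE (E ∪ star w X) k 0 := by
  obtain ⟨hxX, hxA⟩ := Finset.mem_sdiff.1 hx
  have hxw : x ≠ w := fun h => hwX (h ▸ hxX)
  have hsub : (X \ A).erase x ⊆ X \ A := Finset.erase_subset _ _
  have hcd := Finset.card_erase_add_one hx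
  -- With `wx` set aside, two known ends remain at `w`. They suffice for `wx`, since at most one
  -- neighbour of `x` lacks a known end.
  have h1 := hA.complete hwX hXE hsub (Z := Z)
    (fun v hv => hZ v (Finset.mem_sdiff.1 (hsub hv)).1)
    (fun v hv => hc v (Finset.mem_sdiff.1 (hsub hv)).1) (by omega)
  have hset : insert x (A ∪ (X \ A).erase x) = X := by
    ext v
    simp only [Finset.mem_insert, Finset.mem_union, Finset.mem_erase, Finset.mem_sdiff]
    constructor
    · rintro (rfl | h | h)
      · exact hxX
      · exact hAX h
      · exact h.2.1
    · intro h
      tauto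
  rw [← hset, star_insert, Finset.union_insert, Sym2.eq_swap]
  refine h1.add (Z := Zx) hxw.symm ?_ ?_ ?_ ?_
  · intro h
    rcases Finset.mem_union.1 h with h | h
    · exact hXE x hxX (by rwa [Sym2.eq_swap])
    · rcases mk_mem_star.1 h with h | h
      · exact hxw h.1
      · simp [hxA] at h
  · intro y hy hgy
    have hyw : y ≠ w := by
      rintro rfl
      simp at hgy; omega
    refine hZx y ?_ ?_
    · rcases Finset.mem_union.1 hy with h | h
      · exact h
      · rcases mk_mem_star.1 h with h | h
        · exact absurd h.1 hxw
        · exact absurd h.1 hyw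
    · by_cases hyA : y ∈ A
      · exact Or.inr hyA
      · simp only [hyw, hyA, if_false] at hgy
        split_ifs at hgy
        exact Or.inl hgy
  · simp only [if_true]; omega
  · intro v; simp

end Star

end

/-! ### Even vertices, admissible edge sets, and the removal of edges. -/

section

variable {V : Type*} [DecidableEq V]

section Deg

variable {E M : Finset (Sym2 V)} {v : V}

lemma deg_sdiff_add (hM : M ⊆ E) (v : V) : deg (E \ M) v + deg M v = deg E v := by
  have : Disjoint ((E \ M).filter (v ∈ ·)) (M.filter (v ∈ ·)) :=
    Finset.disjoint_filter_filter Finset.sdiff_disjoint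
  rw [deg, deg, ← Finset.card_union_of_disjoint this, ← Finset.filter_union,
    Finset.sdiff_union_of_subset hM, deg]

lemma deg_union (h : Disjoint E M) (v : V) : deg (E ∪ M) v = deg E v + deg M v := by
  rw [deg, Finset.filter_union, Finset.card_union_of_disjoint
    (Finset.disjoint_filter_filter h), deg, deg]

lemma deg_insert {e : Sym2 V} (h : e ∉ E) (v : V) :
    deg (insert e E) v = deg E v + if v ∈ e then 1 else 0 := by
  rw [deg, Finset.filter_insert]
  split_ifs with hv
  · rw [Finset.card_insert_of_notMem (by simp [h]), deg]
  · rfl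

@[simp] lemma deg_empty (v : V) : deg (∅ : Finset (Sym2 V)) v = 0 := rfl

lemma deg_singleton (e : Sym2 V) (v : V) : deg {e} v = if v ∈ e then 1 else 0 := by
  rw [← insert_empty_eq, deg_insert (by simp)]; simp

lemma deg_star {w : V} {X : Finset V} (hw : w ∉ X) (v : V) :
    deg (star w X) v = if v = w then X.card else if v ∈ X then 1 else 0 := by
  induction X using Finset.induction_on with
  | empty => simp
  | insert x X hx ih =>
    have hwx : w ≠ x := fun h => hw (by simp [h])
    have hwX : w ∉ X := fun h => hw (Finset.mem_insert_of_mem h)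
    have : s(w, x) ∉ star w X := by rw [mk_mem_star]; simp [hx, hwX]
    rw [star_insert, deg_insert this, ih hwX, Finset.card_insert_of_notMem hx]
    by_cases h1 : v = w
    · simp [h1]
    · by_cases h2 : v = x
      · subst h2; simp [h1, hx]
      · simp [h1, h2]

lemma deg_eq_zero_iff : deg E v = 0 ↔ ∀ e ∈ E, v ∉ e := by
  simp [deg, Finset.filter_eq_empty_iff]

lemma deg_sdiff_of_untouched (hv : ∀ e ∈ M, v ∉ e) : deg (E \ M) v = deg E v := by
  rw [deg, deg]
  congr 1
  ext e
  simp only [Finset.mem_filter, Finset.mem_sdiff]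
  exact ⟨fun h => ⟨h.1.1, h.2⟩, fun h => ⟨⟨h.1, fun h' => hv e h' h.2⟩, h.2⟩⟩

lemma mem_sdiff_of_untouched (hv : ∀ e ∈ M, v ∉ e) {u : V} :
    s(v, u) ∈ E \ M ↔ s(v, u) ∈ E := by
  simp only [Finset.mem_sdiff, and_iff_left_iff_imp]
  exact fun _ h => hv _ h (by simp)

end Deg

/-- The neighbours of even degree of a vertex. -/
def evenNbrs (E : Finset (Sym2 V)) (v : V) : Finset V :=
  (E.biUnion Sym2.toFinset).filter (fun u => s(v, u) ∈ E ∧ Even (deg E u))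

lemma mem_evenNbrs {E : Finset (Sym2 V)} {u v : V} :
    u ∈ evenNbrs E v ↔ s(v, u) ∈ E ∧ Even (deg E u) := by
  simp only [evenNbrs, Finset.mem_filter, Finset.mem_biUnion, Sym2.mem_toFinset,
    and_iff_right_iff_imp]
  exact fun h => ⟨_, h.1, by simp⟩

/-- The vertex `v` is adjacent to one of `x`, `y`, `z`. -/
def Touches (E : Finset (Sym2 V)) (x y z v : V) : Prop :=
  s(v, x) ∈ E ∨ s(v, y) ∈ E ∨ s(v, z) ∈ E

/-- The component of the triangle `xyz` is a SET graph. -/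
structure IsSETAt (E : Finset (Sym2 V)) (x y z : V) : Prop where
  xy : s(x, y) ∈ E
  yz : s(y, z) ∈ E
  xz : s(x, z) ∈ E
  even_x : Even (deg E x)
  even_y : Even (deg E y)
  even_z : Even (deg E z)
  odd : ∀ v, v ≠ x → v ≠ y → v ≠ z → Touches E x y z v → Odd (deg E v)
  two : ∀ v, v ≠ x → v ≠ y → v ≠ z → Touches E x y z v →
    (s(v, x) ∈ E ∧ s(v, y) ∈ E) ∨ (s(v, y) ∈ E ∧ s(v, z) ∈ E) ∨ (s(v, x) ∈ E ∧ s(v, z) ∈ E)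
  closed : ∀ v, v ≠ x → v ≠ y → v ≠ z → Touches E x y z v → ∀ u, s(v, u) ∈ E →
    u = x ∨ u = y ∨ u = z ∨ Touches E x y z u

/-- The hypotheses of the theorem, for a graph with edge set `E` on the vertex set `U` that need
not be connected. -/
structure Admissible (E : Finset (Sym2 V)) (U : Finset V) : Prop where
  loopless : ∀ e ∈ E, ¬ e.IsDiag
  supp : ∀ e ∈ E, ∀ v ∈ e, v ∈ U
  card_le : ∀ v, Even (deg E v) → (evenNbrs E v).card ≤ 3
  noSET : ∀ x y z, ¬ IsSETAt E x y z

/-- The path number is at most half the number of vertices. -/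
def Decomposable (E : Finset (Sym2 V)) (U : Finset V) : Prop :=
  ∃ k, 2 * k ≤ U.card ∧ DecGE E k (fun v => deg E v % 2)

section Reduction

variable {E M : Finset (Sym2 V)} {U : Finset V}

lemma Admissible.ne (h : Admissible E U) {a b : V} (hab : s(a, b) ∈ E) : a ≠ b :=
  fun he => h.loopless _ hab (by simp [he])

/-- A touched vertex that is even after the removal is isolated in the new E-subgraph, by `h1`; so
every edge of the new E-subgraph joins untouched vertices and was there before. By `h2` no touched
vertex is adjacent to two vertices of an even triangle. A new SET component would thus be untouched
altogether, and a SET component of `E` already. -/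
lemma Admissible.sdiff (h : Admissible E U)
    (h1 : ∀ v, (∃ e ∈ M, v ∈ e) → Even (deg (E \ M) v) → ∀ u, s(v, u) ∈ E \ M →
      Odd (deg (E \ M) u))
    (h2 : ∀ v, (∃ e ∈ M, v ∈ e) → ∀ p q r, Even (deg (E \ M) p) → Even (deg (E \ M) q) →
      Even (deg (E \ M) r) → s(p, q) ∈ E \ M → s(q, r) ∈ E \ M → s(p, r) ∈ E \ M →
      s(v, p) ∈ E \ M → s(v, q) ∈ E \ M → False) : Admissible (E \ M) U := by
  have hunt : ∀ v u, Even (deg (E \ M) v) → s(v, u) ∈ E \ M → Even (deg (E \ M) u) →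
      ∀ e ∈ M, v ∉ e := by
    intro v u hv hvu hu e he hve
    exact (Nat.not_even_iff_odd.2 (h1 v ⟨e, he, hve⟩ hv u hvu)) hu
  refine ⟨fun e he => h.loopless e (Finset.mem_sdiff.1 he).1,
    fun e he => h.supp e (Finset.mem_sdiff.1 he).1, ?_, ?_⟩
  · intro v hv
    by_cases hex : ∃ u, u ∈ evenNbrs (E \ M) v
    · obtain ⟨u, hu⟩ := hex
      rw [mem_evenNbrs] at hu
      have hv' := hunt v u hv hu.1 hu.2
      refine (Finset.card_le_card ?_).trans (h.card_le v (by rwa [← deg_sdiff_of_untouched hv']))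
      intro u hu
      rw [mem_evenNbrs] at hu ⊢
      have hu' := hunt u v hu.2 (by rw [Sym2.eq_swap]; exact hu.1) hv
      rw [deg_sdiff_of_untouched hu'] at hu
      exact ⟨(Finset.mem_sdiff.1 hu.1).1, hu.2⟩
    · push Not at hex
      rw [Finset.eq_empty_of_forall_notMem hex]
      simp
  · intro x y z hs
    have swap : ∀ {E : Finset (Sym2 V)} {a b : V}, s(a, b) ∈ E → s(b, a) ∈ E := by
      intro E a b hab; rwa [Sym2.eq_swap]
    have hx := hunt x y hs.even_x hs.xy hs.even_y
    have hy := hunt y z hs.even_y hs.yz hs.even_z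
    have hz := hunt z x hs.even_z (swap hs.xz) hs.even_x
    have ht : ∀ v, v ≠ x → v ≠ y → v ≠ z → Touches (E \ M) x y z v → ∀ e ∈ M, v ∉ e := by
      intro v h1 h3 h4 hT e he hve
      rcases hs.two v h1 h3 h4 hT with h | h | h
      · exact h2 v ⟨e, he, hve⟩ x y z hs.even_x hs.even_y hs.even_z hs.xy hs.yz hs.xz h.1 h.2
      · exact h2 v ⟨e, he, hve⟩ y z x hs.even_y hs.even_z hs.even_x hs.yz (swap hs.xz)
          (swap hs.xy) h.1 h.2
      · exact h2 v ⟨e, he, hve⟩ x z y hs.even_x hs.even_z hs.even_y hs.xz (swap hs.yz) hs.xy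
          h.1 h.2
    have hT : ∀ v, Touches (E \ M) x y z v ↔ Touches E x y z v := by
      intro v
      have a1 := mem_sdiff_of_untouched (E := E) hx (u := v)
      have a2 := mem_sdiff_of_untouched (E := E) hy (u := v)
      have a3 := mem_sdiff_of_untouched (E := E) hz (u := v)
      rw [Sym2.eq_swap] at a1 a2 a3
      rw [Touches, Touches, a1, a2, a3]
    refine h.noSET x y z ⟨(mem_sdiff_of_untouched hx).1 hs.xy, (mem_sdiff_of_untouched hy).1 hs.yz,
      (mem_sdiff_of_untouched hx).1 hs.xz, ?_, ?_, ?_, ?_, ?_, ?_⟩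
    · rw [← deg_sdiff_of_untouched hx]; exact hs.even_x
    · rw [← deg_sdiff_of_untouched hy]; exact hs.even_y
    · rw [← deg_sdiff_of_untouched hz]; exact hs.even_z
    · intro v h1 h2 h3 h4
      have h4 := (hT v).2 h4
      rw [← deg_sdiff_of_untouched (ht v h1 h2 h3 h4)]
      exact hs.odd v h1 h2 h3 h4
    · intro v h1 h2 h3 h4
      have h4 := (hT v).2 h4
      have h5 := hs.two v h1 h2 h3 h4
      have h6 := fun u => mem_sdiff_of_untouched (E := E) (ht v h1 h2 h3 h4) (u := u)
      rwa [h6, h6, h6] at h5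
    · intro v h1 h2 h3 h4 u hu
      have h4 := (hT v).2 h4
      rw [← hT u]
      exact hs.closed v h1 h2 h3 h4 u ((mem_sdiff_of_untouched (ht v h1 h2 h3 h4)).2 hu)

/-- `Admissible.sdiff` for graphs in which every even vertex has at most two even neighbours. -/
lemma Admissible.sdiff_of_card_le_two (h : Admissible E U)
    (hE : ∀ v, Even (deg E v) → (evenNbrs E v).card ≤ 2)
    (h1 : ∀ v, (∃ e ∈ M, v ∈ e) → Odd (deg E v) ∨ Even (deg (E \ M) v) →
      ∀ u, s(v, u) ∈ E \ M → Odd (deg (E \ M) u)) : Admissible (E \ M) U := by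
  refine h.sdiff (fun v hv he => h1 v hv (Or.inr he)) ?_
  intro v hv p q r hp hq hr hpq hqr hpr hvp hvq
  rcases Nat.even_or_odd (deg E v) with hev | hov
  swap
  · exact Nat.not_even_iff_odd.2 (h1 v hv (Or.inl hov) p hvp) hp
  have hunt : ∀ v u, Even (deg (E \ M) v) → s(v, u) ∈ E \ M → Even (deg (E \ M) u) →
      ∀ e ∈ M, v ∉ e := by
    intro v u hv hvu hu e he hve
    exact (Nat.not_even_iff_odd.2 (h1 v ⟨e, he, hve⟩ (Or.inr hv) u hvu)) hu
  have hp' := hunt p q hp hpq hq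
  have hq' := hunt q r hq hqr hr
  have hr' := hunt r p hr (by rwa [Sym2.eq_swap]) hp
  rw [deg_sdiff_of_untouched hp'] at hp
  rw [deg_sdiff_of_untouched hq'] at hq
  rw [deg_sdiff_of_untouched hr'] at hr
  have mem : ∀ {e}, e ∈ E \ M → e ∈ E := fun he => (Finset.mem_sdiff.1 he).1
  have hvr : v ≠ r := by rintro rfl; obtain ⟨e, he, hve⟩ := hv; exact hr' e he hve
  -- What remains is that `v` was even and became odd; then `p` had the three even neighbours `v`,
  -- `q`, `r`.
  have hsub : {v, q, r} ⊆ evenNbrs E p := by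
    intro u hu
    simp only [Finset.mem_insert, Finset.mem_singleton] at hu
    rw [mem_evenNbrs]
    rcases hu with rfl | rfl | rfl
    · exact ⟨by rw [Sym2.eq_swap]; exact mem hvp, hev⟩
    · exact ⟨mem hpq, hq⟩
    · exact ⟨mem hpr, hr⟩
  have h3 := (Finset.card_le_card hsub).trans (hE p hp)
  rw [Finset.card_eq_three.2 ⟨v, q, r, h.ne (mem hvq), hvr, h.ne (mem hqr), rfl⟩] at h3
  omega

lemma Decomposable.of_decGE {k : ℕ} {g : V → ℕ} (hk : 2 * k ≤ U.card) (h : DecGE E k g) :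
    Decomposable E U := ⟨k, hk, h.deg_mod_two⟩

lemma card_sdiff_lt (hM : M ⊆ E) {e : Sym2 V} (he : e ∈ M) : (E \ M).card < E.card :=
  Finset.card_lt_card (Finset.sdiff_ssubset hM ⟨e, he⟩)

lemma eq_of_mem_of_card_le_two {S : Finset V} (hS : S.card ≤ 2) {a b u : V} (ha : a ∈ S)
    (hb : b ∈ S) (hab : a ≠ b) (hu : u ∈ S) : u = a ∨ u = b := by
  by_contra! h
  have := Finset.card_le_card (s := {a, b, u}) (t := S) (by
    intro v hv; simp only [Finset.mem_insert, Finset.mem_singleton] at hv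
    rcases hv with rfl | rfl | rfl <;> assumption)
  rw [Finset.card_eq_three.2 ⟨a, b, u, hab, h.1.symm, h.2.symm, rfl⟩] at this
  omega

lemma eq_of_mem_of_card_le_three {S : Finset V} (hS : S.card ≤ 3) {a b c u : V} (ha : a ∈ S)
    (hb : b ∈ S) (hc : c ∈ S) (hab : a ≠ b) (hac : a ≠ c) (hbc : b ≠ c) (hu : u ∈ S) :
    u = a ∨ u = b ∨ u = c := by
  by_contra! h
  have := eq_of_mem_of_card_le_two (S := S.erase u) (a := a) (b := b) (u := c)
    (by rw [Finset.card_erase_of_mem hu]; omega) (by simp [ha, h.1.symm])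
    (by simp [hb, h.2.1.symm]) hab (by simp [hc, h.2.2.symm])
  rcases this with h | h
  · exact hac h.symm
  · exact hbc h.symm

end Reduction

/-- The inductive hypothesis. -/
def IH (E : Finset (Sym2 V)) : Prop :=
  ∀ (E' : Finset (Sym2 V)) (U' : Finset V), E'.card < E.card → Admissible E' U' →
    Decomposable E' U'

/-! ### Even vertices with three even neighbours. -/

section Cases

variable {E : Finset (Sym2 V)} {U : Finset V}

lemma star_subset {w : V} {X : Finset V} (h : ∀ x ∈ X, s(w, x) ∈ E) : star w X ⊆ E := by
  intro e he
  obtain ⟨x, hx, rfl⟩ := Finset.mem_image.1 he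
  exact h x hx

lemma touched_star {w v : V} {X : Finset V} (h : ∃ e ∈ star w X, v ∈ e) : v = w ∨ v ∈ X := by
  obtain ⟨e, he, hv⟩ := h
  obtain ⟨x, hx, rfl⟩ := Finset.mem_image.1 he
  rcases Sym2.mem_iff.1 hv with rfl | rfl
  · exact Or.inl rfl
  · exact Or.inr hx

lemma not_odd_of_even {n : ℕ} (h : Even n) : ¬ Odd n := Nat.not_odd_iff_even.2 h

/-- Removing the edges from `x` to its three even neighbours makes these four vertices odd, and
`DecGE.add_star` restores the star, three being odd. Each leaf has at most two even neighbours
besides `x`. The condition `h2` is what keeps a SET component from arising around an even triangle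
next to a leaf. -/
lemma decomposable_of_three_evenNbrs_aux (hE : Admissible E U) (ih : IH E) {x : V}
    (hx : Even (deg E x)) (hc : (evenNbrs E x).card = 3)
    (h2 : ∀ v, v ∈ evenNbrs E x → ∀ p q r, p ∉ evenNbrs E x → q ∉ evenNbrs E x →
      r ∉ evenNbrs E x → p ≠ x → q ≠ x → r ≠ x →
      Even (deg E p) → Even (deg E q) → Even (deg E r) → s(p, q) ∈ E → s(q, r) ∈ E →
      s(p, r) ∈ E → s(v, p) ∈ E → s(v, q) ∈ E → False) : Decomposable E U := by
  set X := evenNbrs E x with hX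
  have hxX : x ∉ X := fun h => hE.ne (mem_evenNbrs.1 h).1 rfl
  have hsub : star x X ⊆ E := star_subset fun v hv => (mem_evenNbrs.1 hv).1
  have hdeg : ∀ v, deg (E \ star x X) v + (if v = x then 3 else if v ∈ X then 1 else 0) =
      deg E v := by
    intro v
    rw [← deg_sdiff_add hsub v, deg_star hxX, hc]
  have hodd : ∀ v, v = x ∨ v ∈ X → Odd (deg (E \ star x X) v) := by
    rintro v (rfl | hv)
    · have := hdeg v
      simp only [if_true] at this
      rw [Nat.even_iff] at hx; rw [Nat.odd_iff]; omega
    · have := hdeg v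
      have hvx : v ≠ x := fun h => hxX (h ▸ hv)
      have h3 := (mem_evenNbrs.1 hv).2
      simp only [hvx, if_false, hv, if_true] at this
      rw [Nat.even_iff] at h3; rw [Nat.odd_iff]; omega
  have heven : ∀ v, Even (deg (E \ star x X) v) → v ≠ x ∧ v ∉ X ∧ Even (deg E v) := by
    intro v hv
    have h1 : v ≠ x := fun h => not_odd_of_even hv (hodd v (Or.inl h))
    have h2 : v ∉ X := fun h => not_odd_of_even hv (hodd v (Or.inr h))
    have := hdeg v
    simp only [h1, h2, if_false] at this
    exact ⟨h1, h2, by rw [← this]; exact hv⟩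
  have mem : ∀ {e}, e ∈ E \ star x X → e ∈ E := fun he => (Finset.mem_sdiff.1 he).1
  have hadm : Admissible (E \ star x X) U := by
    refine hE.sdiff (fun v hv he => absurd (hodd v (touched_star hv)) (not_odd_of_even he)) ?_
    intro v hv p q r hp hq hr hpq hqr hpr hvp hvq
    obtain ⟨hp1, hp2, hp3⟩ := heven p hp
    obtain ⟨hq1, hq2, hq3⟩ := heven q hq
    obtain ⟨hr1, hr2, hr3⟩ := heven r hr
    rcases touched_star hv with rfl | hvX
    · exact hp2 (mem_evenNbrs.2 ⟨mem hvp, hp3⟩)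
    · exact h2 v hvX p q r hp2 hq2 hr2 hp1 hq1 hr1 hp3 hq3 hr3 (mem hpq) (mem hqr) (mem hpr)
        (mem hvp) (mem hvq)
  obtain ⟨v₀, hv₀⟩ : X.Nonempty := Finset.card_pos.1 (by omega)
  obtain ⟨k, hk, hD⟩ := ih _ U (card_sdiff_lt hsub (e := s(x, v₀))
    (mk_mem_star.2 (Or.inl ⟨rfl, hv₀⟩))) hadm
  have hfin := hD.add_star (w := x) (X := X) (Z := fun v => (evenNbrs E v).erase x) hxX ?_ ?_ ?_
    ?_ ?_ ?_ ?_
  · rw [Finset.sdiff_union_of_subset hsub] at hfin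
    exact .of_decGE hk hfin
  · intro v hv h
    exact (Finset.mem_sdiff.1 h).2 (mk_mem_star.2 (Or.inl ⟨rfl, hv⟩))
  · intro v hv
    rw [Nat.odd_iff.1 (hodd v (Or.inr hv))]
  · intro y hy
    by_contra! h0
    have hy0 : Even (deg (E \ star x X) y) := by rw [Nat.even_iff]; omega
    exact (heven y hy0).2.1 (mem_evenNbrs.2 ⟨mem hy, (heven y hy0).2.2⟩)
  · rw [Nat.odd_iff.1 (hodd x (Or.inl rfl))]
  · rw [hc]; decide
  · intro v hv y hy h
    rw [Finset.mem_erase, mem_evenNbrs]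
    rcases h with h | h
    · have hy0 := heven y (Nat.even_iff.2 h)
      exact ⟨hy0.1, mem hy, hy0.2.2⟩
    · exact ⟨fun h' => hxX (h' ▸ h), mem hy, (mem_evenNbrs.1 h).2⟩
  · intro v hv
    have h1 := mem_evenNbrs.1 hv
    have := hE.card_le v h1.2
    rw [Finset.card_erase_of_mem (mem_evenNbrs.2 ⟨by rw [Sym2.eq_swap]; exact h1.1, hx⟩)]
    omega

/-- If a triangle `pqr` next to a neighbour `v` of `x` obstructs the removal at `x`, then `v`, `q`,
`r` are the even neighbours of `p`. The removal at `p` is not obstructed, since the bound three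
leaves these vertices no room for another triangle. -/
lemma decomposable_of_three_evenNbrs (hE : Admissible E U) (ih : IH E) {x : V}
    (hx : Even (deg E x)) (hc : (evenNbrs E x).card = 3) : Decomposable E U := by
  by_contra hcon
  refine hcon (decomposable_of_three_evenNbrs_aux hE ih hx hc ?_)
  intro v hv p q r hpX hqX hrX hpx hqx hrx hp hq hr hpq hqr hpr hvp hvq
  have swap : ∀ {a b : V}, s(a, b) ∈ E → s(b, a) ∈ E := by
    intro a b hab; rwa [Sym2.eq_swap]
  have hvx := (mem_evenNbrs.1 hv).1
  have hve := (mem_evenNbrs.1 hv).2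
  have hvr : v ≠ r := fun h => hrX (h ▸ hv)
  have nv : ∀ u ∈ evenNbrs E v, u = x ∨ u = p ∨ u = q := fun u hu =>
    eq_of_mem_of_card_le_three (hE.card_le v hve) (mem_evenNbrs.2 ⟨swap hvx, hx⟩)
      (mem_evenNbrs.2 ⟨hvp, hp⟩) (mem_evenNbrs.2 ⟨hvq, hq⟩) hpx.symm hqx.symm (hE.ne hpq) hu
  have vp : v ∈ evenNbrs E p := mem_evenNbrs.2 ⟨swap hvp, hve⟩
  have qp : q ∈ evenNbrs E p := mem_evenNbrs.2 ⟨hpq, hq⟩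
  have rp : r ∈ evenNbrs E p := mem_evenNbrs.2 ⟨hpr, hr⟩
  have np : ∀ u ∈ evenNbrs E p, u = v ∨ u = q ∨ u = r := fun u hu =>
    eq_of_mem_of_card_le_three (hE.card_le p hp) vp qp rp (hE.ne hvq) hvr (hE.ne hqr) hu
  have nq : ∀ u ∈ evenNbrs E q, u = v ∨ u = p ∨ u = r := fun u hu =>
    eq_of_mem_of_card_le_three (hE.card_le q hq) (mem_evenNbrs.2 ⟨swap hvq, hve⟩)
      (mem_evenNbrs.2 ⟨swap hpq, hp⟩)
      (mem_evenNbrs.2 ⟨hqr, hr⟩) (hE.ne hvp) hvr (hE.ne hpr) hu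
  have hc' : (evenNbrs E p).card = 3 := by
    have : {v, q, r} ⊆ evenNbrs E p := by
      intro u hu
      simp only [Finset.mem_insert, Finset.mem_singleton] at hu
      rcases hu with rfl | rfl | rfl <;> assumption
    have := Finset.card_le_card this
    rw [Finset.card_eq_three.2 ⟨v, q, r, hE.ne hvq, hvr, hE.ne hqr, rfl⟩] at this
    have := hE.card_le p hp
    omega
  refine hcon (decomposable_of_three_evenNbrs_aux hE ih hp hc' ?_)
  intro t ht p' q' r' hp'X hq'X hr'X hpp hqp hrp hpe hqe hre hpq' hqr' hpr' htp htq
  have hne := hE.ne hpq'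
  have hp' : p' ∈ evenNbrs E t := mem_evenNbrs.2 ⟨htp, hpe⟩
  have hq' : q' ∈ evenNbrs E t := mem_evenNbrs.2 ⟨htq, hqe⟩
  rcases np t ht with rfl | rfl | rfl
  · rcases nv p' hp' with h | h | h
    · rcases nv q' hq' with h' | h' | h'
      · exact hne (h.trans h'.symm)
      · exact hqp h'
      · exact hq'X (h' ▸ qp)
    · exact hpp h
    · exact hp'X (h ▸ qp)
  · rcases nq p' hp' with h | h | h
    · exact hp'X (h ▸ vp)
    · exact hpp h
    · exact hp'X (h ▸ rp)
  · have := eq_of_mem_of_card_le_three (hE.card_le t hr)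
      (mem_evenNbrs.2 ⟨swap hpr, hp⟩) (mem_evenNbrs.2 ⟨swap hqr, hq⟩) hp' (hE.ne hpq)
      hpp.symm (fun h => hp'X (h ▸ qp)) hq'
    rcases this with h | h | h
    · exact hqp h
    · exact hq'X (h ▸ qp)
    · exact hne h.symm

end Cases

end

/-! ### Reducing the E-subgraph to isolated vertices and triangles. -/

section

variable {V : Type*} [DecidableEq V]

section

variable {E M : Finset (Sym2 V)} {U : Finset V}

lemma swap_mem {V : Type*} {E : Finset (Sym2 V)} {a b : V} (h : s(a, b) ∈ E) : s(b, a) ∈ E := by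
  rwa [Sym2.eq_swap]

lemma mem_of_mem_sdiff {e : Sym2 V} (h : e ∈ E \ M) : e ∈ E := (Finset.mem_sdiff.1 h).1

lemma exists_decGE_sdiff (hE : Admissible E U) (ih : IH E)
    (h2 : ∀ v, Even (deg E v) → (evenNbrs E v).card ≤ 2) (hM : M ⊆ E) (hne : M.Nonempty)
    (h1 : ∀ v, (∃ e ∈ M, v ∈ e) → Odd (deg E v) ∨ Even (deg (E \ M) v) →
      ∀ u, s(v, u) ∈ E \ M → Odd (deg (E \ M) u)) :
    ∃ k, 2 * k ≤ U.card ∧ DecGE (E \ M) k (fun v => deg (E \ M) v % 2) := by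
  obtain ⟨e, he⟩ := hne
  exact ih _ U (card_sdiff_lt hM he) (hE.sdiff_of_card_le_two h2 h1)

/-- Without the edge `xy` both vertices are odd, so `y` has an end and all neighbours of `x` have
ends; the edge returns at `x`. -/
lemma decomposable_of_one_evenNbr (hE : Admissible E U) (ih : IH E)
    (h2 : ∀ v, Even (deg E v) → (evenNbrs E v).card ≤ 2) {x : V}
    (hx : Even (deg E x)) (hc : (evenNbrs E x).card = 1) : Decomposable E U := by
  obtain ⟨y, hy⟩ := Finset.card_eq_one.1 hc
  obtain ⟨hxy, hye⟩ := mem_evenNbrs.1 (hy ▸ Finset.mem_singleton_self y : y ∈ evenNbrs E x)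
  have hsub : {s(x, y)} ⊆ E := by simpa using hxy
  have hdeg := deg_sdiff_add hsub
  simp only [deg_singleton, Sym2.mem_iff] at hdeg
  have hodd : ∀ v, v = x ∨ v = y → Odd (deg (E \ {s(x, y)}) v) := by
    intro v hv
    have := hdeg v
    rw [if_pos hv] at this
    rw [Nat.even_iff] at hx hye
    rw [Nat.odd_iff]
    rcases hv with rfl | rfl <;> omega
  have heven : ∀ v, Even (deg (E \ {s(x, y)}) v) → v ≠ x ∧ v ≠ y ∧ Even (deg E v) := by
    intro v hv
    have h1 : ¬ (v = x ∨ v = y) := fun h => not_odd_of_even hv (hodd v h)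
    have := hdeg v
    rw [if_neg h1] at this
    push Not at h1
    exact ⟨h1.1, h1.2, by rw [← this]; exact hv⟩
  obtain ⟨k, hk, hD⟩ := exists_decGE_sdiff hE ih h2 hsub ⟨_, Finset.mem_singleton_self _⟩ (by
    rintro v ⟨e, he, hv⟩ hv'
    rw [Finset.mem_singleton.1 he, Sym2.mem_iff] at hv
    exfalso
    rcases hv' with hv' | hv'
    · rcases hv with rfl | rfl
      · exact not_odd_of_even hx hv'
      · exact not_odd_of_even hye hv'
    · exact not_odd_of_even hv' (hodd v hv))
  have hfin := hD.add (a := x) (x := y) (Z := ∅) (g' := 0) (hE.ne hxy).symm (by simp) ?_ ?_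
    (by simp)
  · rw [← Finset.union_singleton, Finset.sdiff_union_of_subset hsub] at hfin
    exact .of_decGE hk hfin
  · intro u hu h0
    obtain ⟨-, h3, h4⟩ := heven u (Nat.even_iff.2 h0)
    have : u ∈ evenNbrs E x := mem_evenNbrs.2 ⟨mem_of_mem_sdiff hu, h4⟩
    rw [hy] at this
    exact absurd (Finset.mem_singleton.1 this) h3
  · rw [Nat.odd_iff.1 (hodd y (Or.inr rfl))]; simp

/-- Without `ab` and `cd` all four vertices are odd. First `ba` returns at `b`, using the end at
`a`; this does no harm at `c`, because `a` is not adjacent to `c`. Then `cd` returns at `c`. -/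
lemma decomposable_of_even_path (hE : Admissible E U) (ih : IH E)
    (h2 : ∀ v, Even (deg E v) → (evenNbrs E v).card ≤ 2) {a b c d : V}
    (ha : Even (deg E a)) (hb : Even (deg E b)) (hc : Even (deg E c)) (hd : Even (deg E d))
    (hab : s(a, b) ∈ E) (hbc : s(b, c) ∈ E) (hcd : s(c, d) ∈ E) (hac : a ≠ c) (hbd : b ≠ d)
    (had : a ≠ d) : Decomposable E U := by
  have nab := hE.ne hab
  have nbc := hE.ne hbc
  have ncd := hE.ne hcd
  have nb : ∀ u ∈ evenNbrs E b, u = a ∨ u = c := fun u hu =>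
    eq_of_mem_of_card_le_two (h2 b hb) (mem_evenNbrs.2 ⟨swap_mem hab, ha⟩)
      (mem_evenNbrs.2 ⟨hbc, hc⟩) hac hu
  have nc : ∀ u ∈ evenNbrs E c, u = b ∨ u = d := fun u hu =>
    eq_of_mem_of_card_le_two (h2 c hc) (mem_evenNbrs.2 ⟨swap_mem hbc, hb⟩)
      (mem_evenNbrs.2 ⟨hcd, hd⟩) hbd hu
  set M : Finset (Sym2 V) := {s(c, d), s(b, a)} with hM
  have hsub : M ⊆ E := by
    intro e he
    simp only [hM, Finset.mem_insert, Finset.mem_singleton] at he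
    rcases he with rfl | rfl
    · exact hcd
    · exact swap_mem hab
  have hdeg := deg_sdiff_add hsub
  have hne : s(c, d) ∉ ({s(b, a)} : Finset (Sym2 V)) := by
    simp only [Finset.mem_singleton, Sym2.eq_iff]; tauto
  simp only [hM, deg_insert hne, deg_singleton, Sym2.mem_iff] at hdeg
  rw [← hM] at hdeg
  have hodd : ∀ v, v = a ∨ v = b ∨ v = c ∨ v = d → Odd (deg (E \ M) v) := by
    intro v hv
    have := hdeg v
    rw [Nat.even_iff] at ha hb hc hd
    rw [Nat.odd_iff]
    rcases hv with rfl | rfl | rfl | rfl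
    · rw [if_pos (Or.inr rfl), if_neg (by tauto)] at this; omega
    · rw [if_pos (Or.inl rfl), if_neg (by tauto)] at this; omega
    · rw [if_neg (by tauto), if_pos (Or.inl rfl)] at this; omega
    · rw [if_neg (by tauto), if_pos (Or.inr rfl)] at this; omega
  have heven : ∀ v, Even (deg (E \ M) v) →
      v ≠ a ∧ v ≠ b ∧ v ≠ c ∧ v ≠ d ∧ Even (deg E v) := by
    intro v hv
    have h1 : ¬ (v = a ∨ v = b ∨ v = c ∨ v = d) := fun h => not_odd_of_even hv (hodd v h)
    have := hdeg v
    rw [if_neg (by tauto), if_neg (by tauto)] at this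
    push Not at h1
    exact ⟨h1.1, h1.2.1, h1.2.2.1, h1.2.2.2, by rw [← this]; exact hv⟩
  obtain ⟨k, hk, hD⟩ := exists_decGE_sdiff hE ih h2 hsub ⟨s(c, d), by simp [hM]⟩ (by
    rintro v ⟨e, he, hv⟩ hv'
    have hv3 : v = a ∨ v = b ∨ v = c ∨ v = d := by
      simp only [hM, Finset.mem_insert, Finset.mem_singleton] at he
      rcases he with rfl | rfl
      · rw [Sym2.mem_iff] at hv; tauto
      · rw [Sym2.mem_iff] at hv; tauto
    exfalso
    rcases hv' with hv' | hv'
    · rcases hv3 with rfl | rfl | rfl | rfl <;>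
        exact absurd hv' (not_odd_of_even (by assumption))
    · exact not_odd_of_even hv' (hodd v hv3))
  have h1 := hD.add (a := b) (x := a) (Z := ∅) (g' := fun v => if v = b then 2 else
    if v = a then 0 else deg (E \ M) v % 2) nab (by simp [hM]) ?_ ?_ ?_
  · have h2 := h1.add (a := c) (x := d) (Z := ∅) (g' := 0) ncd.symm ?_ ?_ ?_ (by simp)
    · rw [show insert s(c, d) (insert s(b, a) (E \ M)) = E \ M ∪ M by
        rw [hM, Finset.union_insert, Finset.union_singleton],
        Finset.sdiff_union_of_subset hsub] at h2
      exact .of_decGE hk h2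
    · intro h
      rcases Finset.mem_insert.1 h with h | h
      · exact hne (by simp [h])
      · simp [hM] at h
    · intro u hu h0
      exfalso
      have hub : u ≠ b := by rintro rfl; simp at h0
      rcases Finset.mem_insert.1 hu with hu | hu
      · rcases Sym2.eq_iff.1 hu with h | h
        · exact nbc h.1.symm
        · exact hac h.1.symm
      · rw [if_neg hub] at h0
        by_cases hua : u = a
        · subst hua
          rcases nc u (mem_evenNbrs.2 ⟨mem_of_mem_sdiff hu, ha⟩) with h | h
          · exact nab h
          · exact had h
        · rw [if_neg hua] at h0
          obtain ⟨-, -, -, h3, h4⟩ := heven u (Nat.even_iff.2 h0)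
          rcases nc u (mem_evenNbrs.2 ⟨mem_of_mem_sdiff hu, h4⟩) with h | h
          · exact hub h
          · exact h3 h
    · rw [if_neg hbd.symm, if_neg had.symm, Nat.odd_iff.1 (hodd d (by tauto))]; simp
  · intro u hu h0
    obtain ⟨h3, h4, h5, h6, h7⟩ := heven u (Nat.even_iff.2 h0)
    rcases nb u (mem_evenNbrs.2 ⟨mem_of_mem_sdiff hu, h7⟩) with h | h
    · exact absurd h h3
    · exact absurd h h5
  · rw [Nat.odd_iff.1 (hodd a (by tauto))]; simp
  · intro u
    by_cases h3 : u = b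
    · rw [if_pos h3, if_pos h3, if_neg (fun h => nab (h.symm.trans h3)), h3,
        Nat.odd_iff.1 (hodd b (by tauto))]
    · by_cases h4 : u = a
      · rw [if_neg h3, if_pos h4]; exact Nat.zero_le _
      · simp [h3, h4]

/-- A triangle of even vertices that is a component of the E-subgraph. -/
structure IsTri (E : Finset (Sym2 V)) (x y z : V) : Prop where
  xy : s(x, y) ∈ E
  yz : s(y, z) ∈ E
  xz : s(x, z) ∈ E
  even_x : Even (deg E x)
  even_y : Even (deg E y)
  even_z : Even (deg E z)
  nx : ∀ u ∈ evenNbrs E x, u = y ∨ u = z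
  ny : ∀ u ∈ evenNbrs E y, u = x ∨ u = z
  nz : ∀ u ∈ evenNbrs E z, u = x ∨ u = y

lemma IsTri.swap_yz {x y z : V} (h : IsTri E x y z) : IsTri E x z y :=
  ⟨h.xz, swap_mem h.yz, h.xy, h.even_x, h.even_z, h.even_y, fun u hu => (h.nx u hu).symm,
    h.nz, h.ny⟩

/-- The components of the E-subgraph are isolated vertices and triangles. -/
structure Tame (E : Finset (Sym2 V)) (U : Finset V) : Prop extends Admissible E U where
  two : ∀ v, Even (deg E v) → (evenNbrs E v).card ≤ 2
  tri : ∀ x y, Even (deg E x) → y ∈ evenNbrs E x → ∃ z, IsTri E x y z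

/-- An even vertex has zero or two even neighbours. A component with an edge is thus a cycle, and
one longer than a triangle contains a path on four vertices. -/
lemma tame_of_not_decomposable (hE : Admissible E U) (ih : IH E) (hn : ¬ Decomposable E U) :
    Tame E U := by
  have two : ∀ v, Even (deg E v) → (evenNbrs E v).card ≤ 2 := by
    intro v hv
    by_contra! h
    have := hE.card_le v hv
    exact hn (decomposable_of_three_evenNbrs hE ih hv (by omega))
  refine ⟨hE, two, ?_⟩
  have other : ∀ x y, Even (deg E x) → y ∈ evenNbrs E x → ∃ z ∈ evenNbrs E x, z ≠ y := by
    intro x y hx hy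
    by_contra! h
    refine hn (decomposable_of_one_evenNbr hE ih two hx (Finset.card_eq_one.2 ⟨y, ?_⟩))
    ext u
    rw [Finset.mem_singleton]
    exact ⟨h u, fun h => h ▸ hy⟩
  intro x y hx hy
  obtain ⟨hxy, hye⟩ := mem_evenNbrs.1 hy
  obtain ⟨z, hz, hzy⟩ := other x y hx hy
  have hx' : x ∈ evenNbrs E y := mem_evenNbrs.2 ⟨swap_mem hxy, hx⟩
  obtain ⟨z', hz', hzx'⟩ := other y x hye hx'
  obtain ⟨hxz, hze⟩ := mem_evenNbrs.1 hz
  obtain ⟨hyz', hze'⟩ := mem_evenNbrs.1 hz'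
  have hzz : z = z' := by
    by_contra h
    exact hn (decomposable_of_even_path hE ih two hze hx hye hze' (swap_mem hxz) hxy hyz' hzy
      hzx'.symm h)
  subst hzz
  refine ⟨z, hxy, hyz', hxz, hx, hye, hze, ?_, ?_, ?_⟩
  · exact fun u hu => eq_of_mem_of_card_le_two (two x hx) hy hz hzy.symm hu
  · exact fun u hu => eq_of_mem_of_card_le_two (two y hye) hx' hz' hzx'.symm hu
  · exact fun u hu => eq_of_mem_of_card_le_two (two z hze) (mem_evenNbrs.2 ⟨swap_mem hxz, hx⟩)
      (mem_evenNbrs.2 ⟨swap_mem hyz', hye⟩) (hE.ne hxy) hu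

/-- Without `wv` the vertex `w` is even, but all its neighbours are odd. So it is isolated in the
E-subgraph and the edge can return at `w`. -/
lemma Tame.decomposable_of_one_evenNbr (hE : Tame E U) (ih : IH E) {w : V}
    (hw : Odd (deg E w)) (hc : (evenNbrs E w).card = 1) : Decomposable E U := by
  obtain ⟨v, hv⟩ := Finset.card_eq_one.1 hc
  obtain ⟨hwv, hve⟩ := mem_evenNbrs.1 (hv ▸ Finset.mem_singleton_self v : v ∈ evenNbrs E w)
  have hsub : {s(w, v)} ⊆ E := by simpa using hwv
  have hdeg := deg_sdiff_add hsub
  simp only [deg_singleton, Sym2.mem_iff] at hdeg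
  have hv1 : Odd (deg (E \ {s(w, v)}) v) := by
    have := hdeg v
    rw [if_pos (Or.inr rfl)] at this
    rw [Nat.even_iff] at hve; rw [Nat.odd_iff]; omega
  have hN : ∀ u, s(w, u) ∈ E \ {s(w, v)} → Odd (deg (E \ {s(w, v)}) u) := by
    intro u hu
    by_contra h
    rw [Nat.not_odd_iff_even] at h
    have huw : u ≠ w := (hE.ne (mem_of_mem_sdiff hu)).symm
    have huv : u ≠ v := by rintro rfl; simp at hu
    have := hdeg u
    rw [if_neg (by tauto)] at this
    have : u ∈ evenNbrs E w := mem_evenNbrs.2 ⟨mem_of_mem_sdiff hu, by rw [← this]; exact h⟩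
    rw [hv] at this
    exact huv (Finset.mem_singleton.1 this)
  obtain ⟨k, hk, hD⟩ := exists_decGE_sdiff hE.toAdmissible ih hE.two hsub
    ⟨_, Finset.mem_singleton_self _⟩ (by
    rintro u ⟨e, he, hu⟩ hu'
    rw [Finset.mem_singleton.1 he, Sym2.mem_iff] at hu
    rcases hu with rfl | rfl
    · exact hN
    · rcases hu' with h | h
      · exact absurd h (not_odd_of_even hve)
      · exact absurd hv1 (not_odd_of_even h))
  have hfin := hD.add (a := w) (x := v) (Z := ∅) (g' := 0) (hE.ne hwv).symm (by simp) ?_ ?_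
    (by simp)
  · rw [← Finset.union_singleton, Finset.sdiff_union_of_subset hsub] at hfin
    exact .of_decGE hk hfin
  · intro u hu h0
    exact absurd (hN u hu) (not_odd_of_even (Nat.even_iff.2 h0))
  · rw [Nat.odd_iff.1 hv1]; simp

end

end

/-! ### Odd vertices with an even number of even neighbours. -/

section

variable {V : Type*} [DecidableEq V] {E M : Finset (Sym2 V)} {U : Finset V}

lemma sdiff_union_insert_insert {H : Finset (Sym2 V)} {e f : Sym2 V}
    (hM : insert e (insert f M) ⊆ E) (hH : H = E \ insert e (insert f M)) :
    insert e (insert f (H ∪ M)) = E := by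
  rw [hH, ← Finset.union_insert, ← Finset.union_insert, Finset.sdiff_union_of_subset hM]

lemma even_deg_of_eq_zero {g : V → ℕ} (hgo : ∀ v, Odd (deg E v) → 1 ≤ g v) {v : V}
    (hv : g v = 0) : Even (deg E v) := by
  by_contra h
  have := hgo v (Nat.not_even_iff_odd.1 h)
  omega

/-- Adding back the edges from `w` to `X ∪ {x}` and the edge `yz`, where `xyz` is a triangle. -/
lemma Tame.add_reserved (hE : Tame E U) {w x y z : V} (hw : Odd (deg E w))
    (ht : IsTri E x y z) {X : Finset V} (hXS : X ⊆ evenNbrs E w) (hx : x ∈ evenNbrs E w)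
    (hxX : x ∉ X) (hyX : y ∉ X) (hzX : z ∉ X) (hodd : Odd X.card) {k : ℕ} {g : V → ℕ}
    (hD : DecGE (E \ insert s(x, w) (insert s(y, z) (star w X))) k g) (hgy : 1 ≤ g y)
    (hgz : 1 ≤ g z) (hN : ∀ v, s(w, v) ∈ E → 1 ≤ g v) (hgo : ∀ v, Odd (deg E v) → 1 ≤ g v) :
    DecGE E k 0 := by
  have hev : ∀ v, g v = 0 → Even (deg E v) := fun v hv => even_deg_of_eq_zero hgo hv
  have hXe : ∀ v ∈ X, s(w, v) ∈ E ∧ Even (deg E v) := fun v hv => mem_evenNbrs.1 (hXS hv)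
  have hnw : ∀ v, Even (deg E v) → v ≠ w := fun v hv h => not_odd_of_even hv (h ▸ hw)
  have hwX : w ∉ X := fun h => hnw w (hXe w h).2 rfl
  obtain ⟨hwx, -⟩ := mem_evenNbrs.1 hx
  have hyw := hnw y ht.even_y
  have hzw := hnw z ht.even_z
  have hxw := hnw x ht.even_x
  set H := E \ insert s(x, w) (insert s(y, z) (star w X)) with hH
  have hHE : ∀ {e}, e ∈ H → e ∈ E := fun he => mem_of_mem_sdiff he
  -- The star with an odd number of leaves comes first, since it leaves two known ends at `w`.
  have h1 := hD.add_star (w := w) (X := X) (Z := evenNbrs E) hwX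
    (fun v hv h => (Finset.mem_sdiff.1 h).2 (by
      simp only [Finset.mem_insert, mk_mem_star]; tauto))
    (fun v hv => hN v (hXe v hv).1) (fun v hv => hN v (hHE hv)) (hgo w hw) hodd
    (fun v hv u hu h => mem_evenNbrs.2 ⟨hHE hu, h.elim (hev u) fun h => (hXe u h).2⟩)
    (fun v hv => hE.two v (hXe v hv).2)
  have hmem : ∀ {v u}, v ≠ w → u ≠ w → s(v, u) ∈ H ∪ star w X → s(v, u) ∈ H := by
    intro v u hv hu h
    rcases Finset.mem_union.1 h with h | h
    · exact h
    · rcases mk_mem_star.1 h with h | h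
      · exact absurd h.1 hv
      · exact absurd h.1 hu
  have hyzH : s(y, z) ∉ H := fun h => (Finset.mem_sdiff.1 h).2 (by simp)
  have hxwH : s(x, w) ∉ H := fun h => (Finset.mem_sdiff.1 h).2 (by simp)
  -- No neighbour of `y` lacks an end: `z` is not yet adjacent to `y`, and `x` is adjacent to `w`
  -- but not in `X`, so its end has not been used.
  have h2 := h1.add (a := y) (x := z) (Z := ∅)
    (g' := fun v => if v = w then 2 else if v ∈ X then 0 else if v = z then 0 else g v)
    (hE.ne ht.yz).symm (fun h => hyzH (hmem hyw hzw h)) ?_ ?_ ?_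
  -- Of the neighbours of `x` only `z` can lack a known end, as `y` has just gained one. The two
  -- ends at `w` outnumber it.
  · have h3 := h2.add (a := x) (x := w) (Z := {z}) (g' := 0) hxw.symm ?_ ?_ ?_ (by simp)
    · rw [sdiff_union_insert_insert ?_ hH] at h3
      · exact h3
      · intro e he
        simp only [Finset.mem_insert] at he
        rcases he with rfl | rfl | he
        · exact swap_mem hwx
        · exact ht.yz
        · exact star_subset (fun v hv => (hXe v hv).1) he
    · intro h
      rcases Finset.mem_insert.1 h with h | h
      · rcases Sym2.eq_iff.1 h with h | h
        · exact hzw h.2.symm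
        · exact hyw h.2.symm
      · rcases Finset.mem_union.1 h with h | h
        · exact hxwH h
        · rcases mk_mem_star.1 h with h | h
          · exact hxw h.1
          · exact hxX h.2
    · intro u hu h0
      have huw : u ≠ w := by rintro rfl; simp at h0
      rw [if_neg huw] at h0
      rw [Finset.mem_singleton]
      rcases Finset.mem_insert.1 hu with hu | hu
      · rcases Sym2.eq_iff.1 hu with h | h
        · exact h.2
        · exact absurd h.1 (hE.ne ht.xz)
      · have huE := hHE (hmem hxw huw hu)
        by_cases huX : u ∈ X
        · rcases ht.nx u (mem_evenNbrs.2 ⟨huE, (hXe u huX).2⟩) with rfl | rfl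
          · exact absurd huX hyX
          · rfl
        · by_contra huz
          rw [if_neg huX, if_neg huz] at h0
          rcases ht.nx u (mem_evenNbrs.2 ⟨huE, hev u h0⟩) with rfl | rfl
          · omega
          · exact huz rfl
    · simp
  · intro u hu h0
    exfalso
    have huw : u ≠ w := by rintro rfl; simp at h0
    rw [if_neg huw] at h0
    have huH := hmem hyw huw hu
    have huz : u ≠ z := by rintro rfl; exact hyzH huH
    by_cases huX : u ∈ X
    · rcases ht.ny u (mem_evenNbrs.2 ⟨hHE huH, (hXe u huX).2⟩) with rfl | rfl
      · exact hxX huX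
      · exact huz rfl
    · rw [if_neg huX] at h0
      rcases ht.ny u (mem_evenNbrs.2 ⟨hHE huH, hev u h0⟩) with rfl | rfl
      · have := hN u hwx; omega
      · exact huz rfl
  · simp only [hzw, hzX, if_false, Finset.card_empty]; exact hgz
  · intro v
    by_cases h3 : v = w
    · subst h3; simp [hzw.symm]
    · by_cases h4 : v ∈ X
      · simp [h3, h4]
      · by_cases h5 : v = z
        · rw [if_neg h3, if_neg h4, if_pos h5]; exact Nat.zero_le _
        · simp [h3, h4, h5]

/-- The parity of `w` after the removal does not matter: all its remaining neighbours are odd. The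
other touched vertices turn from even to odd, which is harmless. -/
lemma exists_decGE_sdiff_of_evenNbrs (hE : Tame E U) (ih : IH E) {w : V}
    (hM : M ⊆ E) (hne : M.Nonempty)
    (htouch : ∀ v, (∃ e ∈ M, v ∈ e) → v = w ∨ (Even (deg E v) ∧ Odd (deg (E \ M) v)))
    (hS : ∀ v ∈ evenNbrs E w, Odd (deg (E \ M) v)) :
    ∃ k, 2 * k ≤ U.card ∧ DecGE (E \ M) k (fun v => deg (E \ M) v % 2) := by
  refine exists_decGE_sdiff hE.toAdmissible ih hE.two hM hne ?_
  intro v hv hv'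
  rcases htouch v hv with rfl | ⟨h1, h2⟩
  · intro u hu
    by_contra h
    rw [Nat.not_odd_iff_even] at h
    by_cases hu' : ∃ e ∈ M, u ∈ e
    · rcases htouch u hu' with rfl | h'
      · exact hE.ne (mem_of_mem_sdiff hu) rfl
      · exact not_odd_of_even h h'.2
    · push Not at hu'
      refine not_odd_of_even h (hS u (mem_evenNbrs.2 ⟨mem_of_mem_sdiff hu, ?_⟩))
      rwa [← deg_sdiff_of_untouched hu']
  · rcases hv' with h | h
    · exact absurd h (not_odd_of_even h1)
    · exact absurd h2 (not_odd_of_even h)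

lemma odd_sdiff_of_untouched {v : V} (hv : ¬ ∃ e ∈ M, v ∈ e) (h : Odd (deg E v)) :
    Odd (deg (E \ M) v) := by
  push Not at hv
  rwa [deg_sdiff_of_untouched hv]

lemma odd_sdiff_of_odd_deg (hM : M ⊆ E) {v : V} (h1 : Even (deg E v)) (h2 : Odd (deg M v)) :
    Odd (deg (E \ M) v) := by
  have := deg_sdiff_add hM v
  rw [Nat.even_iff] at h1
  rw [Nat.odd_iff] at h2 ⊢
  omega

lemma odd_sdiff_of_even_deg (hM : M ⊆ E) {v : V} (h1 : Odd (deg E v)) (h2 : Even (deg M v)) :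
    Odd (deg (E \ M) v) := by
  have := deg_sdiff_add hM v
  rw [Nat.even_iff] at h2
  rw [Nat.odd_iff] at h1 ⊢
  omega

lemma one_le_mod_two {n : ℕ} (h : Odd n) : 1 ≤ n % 2 := by rw [Nat.odd_iff.1 h]

/-- All edges from `w` to even vertices are removed except those to `y` and `z`, and `yz` is removed
in their stead. Then `x`, `y`, `z` are odd, `w` loses an even number of edges and stays odd, and
setting `wx` aside leaves a star with an odd number of leaves. -/
lemma Tame.decomposable_of_even_card_sdiff (hE : Tame E U) (ih : IH E) {w x y z : V}
    (hw : Odd (deg E w)) (ht : IsTri E x y z) (hx : x ∈ evenNbrs E w)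
    (hev : Even (evenNbrs E w \ {y, z}).card) : Decomposable E U := by
  have hxS : x ∈ evenNbrs E w \ {y, z} := by
    simp [hx, hE.ne ht.xy, hE.ne ht.xz]
  set X := (evenNbrs E w \ {y, z}).erase x with hX
  have hXS : X ⊆ evenNbrs E w := (Finset.erase_subset _ _).trans Finset.sdiff_subset
  have hcX : X.card + 1 = (evenNbrs E w \ {y, z}).card := Finset.card_erase_add_one hxS
  have hxX : x ∉ X := by simp [hX]
  have hyX : y ∉ X := by simp [hX]
  have hzX : z ∉ X := by simp [hX]
  have hodd : Odd X.card := by rw [← hcX, Nat.even_add_one, Nat.not_even_iff_odd] at hev; exact hev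
  have hXe : ∀ v ∈ X, s(w, v) ∈ E ∧ Even (deg E v) := fun v hv => mem_evenNbrs.1 (hXS hv)
  have hnw : ∀ v, Even (deg E v) → v ≠ w := fun v hv h => not_odd_of_even hv (h ▸ hw)
  have hwX : w ∉ X := fun h => hnw w (hXe w h).2 rfl
  have hyw := hnw y ht.even_y
  have hzw := hnw z ht.even_z
  have hxw := hnw x ht.even_x
  have nxy := hE.ne ht.xy
  have nyz := hE.ne ht.yz
  have nxz := hE.ne ht.xz
  set M := insert s(x, w) (insert s(y, z) (star w X)) with hM
  have hsub : M ⊆ E := by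
    intro e he
    simp only [hM, Finset.mem_insert] at he
    rcases he with rfl | rfl | he
    · exact swap_mem (mem_evenNbrs.1 hx).1
    · exact ht.yz
    · exact star_subset (fun v hv => (hXe v hv).1) he
  have hdegM : ∀ v, deg M v = (if v = w then X.card else if v ∈ X then 1 else 0) +
      (if v = y ∨ v = z then 1 else 0) + if v = x ∨ v = w then 1 else 0 := by
    intro v
    rw [hM, deg_insert, deg_insert, deg_star hwX]
    · simp only [Sym2.mem_iff]
    · rw [mk_mem_star]; tauto
    · rw [Finset.mem_insert, mk_mem_star, Sym2.eq_iff]; tauto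
  have hoddM : ∀ v, (v ∈ X ∨ v = x ∨ v = y ∨ v = z) → Odd (deg M v) := by
    intro v hv
    rw [hdegM]
    rcases hv with hv | rfl | rfl | rfl
    · have h1 : v ≠ w := fun h => hwX (h ▸ hv)
      have h2 : v ≠ x := fun h => hxX (h ▸ hv)
      have h3 : v ≠ y := fun h => hyX (h ▸ hv)
      have h4 : v ≠ z := fun h => hzX (h ▸ hv)
      simp [h1, h2, h3, h4, hv]
    · simp [hxw, hxX, nxy, nxz]
    · simp [hyw, hyX, nxy.symm]
    · simp [hzw, hzX, nxz.symm]
  have htouch : ∀ v, (∃ e ∈ M, v ∈ e) →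
      v = w ∨ ((v ∈ X ∨ v = x ∨ v = y ∨ v = z) ∧ Even (deg E v)) := by
    rintro v ⟨e, he, hv⟩
    simp only [hM, Finset.mem_insert] at he
    rcases he with rfl | rfl | he
    · rcases Sym2.mem_iff.1 hv with rfl | rfl
      · exact Or.inr ⟨by tauto, ht.even_x⟩
      · exact Or.inl rfl
    · rcases Sym2.mem_iff.1 hv with rfl | rfl
      · exact Or.inr ⟨by tauto, ht.even_y⟩
      · exact Or.inr ⟨by tauto, ht.even_z⟩
    · rcases touched_star ⟨e, he, hv⟩ with rfl | hv
      · exact Or.inl rfl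
      · exact Or.inr ⟨Or.inl hv, (hXe v hv).2⟩
  have hS : ∀ v ∈ evenNbrs E w, Odd (deg (E \ M) v) := by
    intro v hv
    refine odd_sdiff_of_odd_deg hsub (mem_evenNbrs.1 hv).2 (hoddM v ?_)
    by_contra! h
    exact h.1 (by simp [hX, hv, h.2])
  have hwM : Odd (deg (E \ M) w) := by
    refine odd_sdiff_of_even_deg hsub hw ?_
    rw [hdegM]
    simp only [if_true, hyw.symm, hzw.symm, or_self, or_true, if_false]
    rw [add_zero, hcX]; exact hev
  have hgo : ∀ v, Odd (deg E v) → Odd (deg (E \ M) v) := by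
    intro v hv
    by_cases h : ∃ e ∈ M, v ∈ e
    · rcases htouch v h with rfl | h'
      · exact hwM
      · exact absurd hv (not_odd_of_even h'.2)
    · exact odd_sdiff_of_untouched h hv
  obtain ⟨k, hk, hD⟩ := exists_decGE_sdiff_of_evenNbrs hE ih (w := w) hsub
    ⟨s(y, z), by simp [hM]⟩
    (fun v hv => (htouch v hv).imp_right fun h => ⟨h.2, odd_sdiff_of_odd_deg hsub h.2
      (hoddM v h.1)⟩) hS
  refine .of_decGE hk (hE.add_reserved hw ht hXS hx hxX hyX hzX hodd hD ?_ ?_ ?_ ?_)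
  · exact one_le_mod_two (odd_sdiff_of_odd_deg hsub ht.even_y (hoddM y (by tauto)))
  · exact one_le_mod_two (odd_sdiff_of_odd_deg hsub ht.even_z (hoddM z (by tauto)))
  · intro v hv
    rcases Nat.even_or_odd (deg E v) with h | h
    · exact one_le_mod_two (hS v (mem_evenNbrs.2 ⟨hv, h⟩))
    · exact one_le_mod_two (hgo v h)
  · exact fun v hv => one_le_mod_two (hgo v hv)

/-- The star without `wx` has an odd number of leaves and leaves two ends at `w`. As `x` has no even
neighbours, `wx` can return last, at `x`. -/
lemma Tame.decomposable_of_isolated_evenNbr (hE : Tame E U) (ih : IH E) {w x : V}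
    (hw : Odd (deg E w)) (hx : x ∈ evenNbrs E w) (hxe : evenNbrs E x = ∅)
    (hev : Even (evenNbrs E w).card) : Decomposable E U := by
  set S := evenNbrs E w with hSdef
  have hSe : ∀ v ∈ S, s(w, v) ∈ E ∧ Even (deg E v) := fun v hv => mem_evenNbrs.1 hv
  have hnw : ∀ v, Even (deg E v) → v ≠ w := fun v hv h => not_odd_of_even hv (h ▸ hw)
  have hwS : w ∉ S := fun h => hnw w (hSe w h).2 rfl
  have hxw := hnw x (hSe x hx).2
  have hsub : star w S ⊆ E := star_subset fun v hv => (hSe v hv).1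
  have hS : ∀ v ∈ S, Odd (deg (E \ star w S) v) := by
    intro v hv
    refine odd_sdiff_of_odd_deg hsub (hSe v hv).2 ?_
    rw [deg_star hwS, if_neg (hnw v (hSe v hv).2), if_pos hv]
    decide
  have hgo : ∀ v, Odd (deg E v) → Odd (deg (E \ star w S) v) := by
    intro v hv
    by_cases h : ∃ e ∈ star w S, v ∈ e
    · rcases touched_star h with rfl | h'
      · exact odd_sdiff_of_even_deg hsub hv (by rw [deg_star hwS, if_pos rfl]; exact hev)
      · exact absurd hv (not_odd_of_even (hSe v h').2)
    · exact odd_sdiff_of_untouched h hv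
  obtain ⟨k, hk, hD⟩ := exists_decGE_sdiff_of_evenNbrs hE ih (w := w) hsub
    ⟨s(w, x), mk_mem_star.2 (Or.inl ⟨rfl, hx⟩)⟩
    (fun v hv => (touched_star hv).imp_right fun h => ⟨(hSe v h).2, hS v h⟩) hS
  have hcX := Finset.card_erase_add_one hx
  have hXS : S.erase x ⊆ S := Finset.erase_subset _ _
  have hN : ∀ v, s(w, v) ∈ E → Odd (deg (E \ star w S) v) := by
    intro v hv
    rcases Nat.even_or_odd (deg E v) with h | h
    · exact hS v (mem_evenNbrs.2 ⟨hv, h⟩)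
    · exact hgo v h
  have hev0 : ∀ v, deg (E \ star w S) v % 2 = 0 → Even (deg E v) := fun v hv =>
    even_deg_of_eq_zero (fun u hu => one_le_mod_two (hgo u hu)) hv
  have h1 := hD.add_star (w := w) (X := S.erase x) (Z := evenNbrs E) (fun h => hwS (hXS h))
    (fun v hv h => (Finset.mem_sdiff.1 h).2 (mk_mem_star.2 (Or.inl ⟨rfl, hXS hv⟩)))
    (fun v hv => one_le_mod_two (hS v (hXS hv)))
    (fun v hv => one_le_mod_two (hN v (mem_of_mem_sdiff hv))) (one_le_mod_two (hgo w hw))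
    (by rw [← hcX, Nat.even_add_one, Nat.not_even_iff_odd] at hev; exact hev)
    (fun v hv u hu h => mem_evenNbrs.2 ⟨mem_of_mem_sdiff hu, h.elim (hev0 u)
      fun h => (hSe u (hXS h)).2⟩)
    (fun v hv => hE.two v (hSe v (hXS hv)).2)
  have hxwH : s(w, x) ∉ E \ star w S ∪ star w (S.erase x) := by
    intro h
    rcases Finset.mem_union.1 h with h | h
    · exact (Finset.mem_sdiff.1 h).2 (mk_mem_star.2 (Or.inl ⟨rfl, hx⟩))
    · rcases mk_mem_star.1 h with h | h
      · simp at h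
      · exact hxw h.1
  have h2 := h1.add (a := x) (x := w) (Z := ∅) (g' := 0) hxw.symm
    (by rw [Sym2.eq_swap]; exact hxwH) ?_ (by simp) (by simp)
  · rw [Sym2.eq_swap, ← Finset.union_insert, ← star_insert, Finset.insert_erase hx,
      Finset.sdiff_union_of_subset hsub] at h2
    exact .of_decGE hk h2
  · intro u hu h0
    exfalso
    have huw : u ≠ w := by rintro rfl; simp at h0
    rw [if_neg huw] at h0
    have huE : s(x, u) ∈ E := by
      rcases Finset.mem_union.1 hu with h | h
      · exact mem_of_mem_sdiff h
      · rcases mk_mem_star.1 h with h | h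
        · exact absurd h.1 hxw
        · exact absurd h.1 huw
    have hue : Even (deg E u) := by
      by_cases huX : u ∈ S.erase x
      · exact (hSe u (hXS huX)).2
      · rw [if_neg huX] at h0
        exact hev0 u h0
    have : u ∈ evenNbrs E x := mem_evenNbrs.2 ⟨huE, hue⟩
    rw [hxe] at this
    simp at this

/-- Two triangles that both have exactly two vertices adjacent to `w`. -/
lemma Tame.decomposable_of_two_triangles (hE : Tame E U) (ih : IH E) {w x y z x' y' z' : V}
    (hw : Odd (deg E w)) (ht : IsTri E x y z) (ht' : IsTri E x' y' z')
    (hx : x ∈ evenNbrs E w) (hy : y ∈ evenNbrs E w) (hz : z ∉ evenNbrs E w)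
    (hx' : x' ∈ evenNbrs E w) (hy' : y' ∈ evenNbrs E w) (hz' : z' ∉ evenNbrs E w)
    (hxx' : x' ≠ x) (hyx' : x' ≠ y)
    (hev : Even (evenNbrs E w).card) : Decomposable E U := by
  have nxy := hE.ne ht.xy
  have nyz := hE.ne ht.yz
  have nxz := hE.ne ht.xz
  have nxy' := hE.ne ht'.xy
  have nyz' := hE.ne ht'.yz
  have nxz' := hE.ne ht'.xz
  have hx'z : x' ≠ z := fun h => hz (h ▸ hx')
  have hd : ∀ u, (u = x ∨ u = y ∨ u = z) → u ∉ evenNbrs E x' := by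
    intro u hu h
    obtain ⟨h1, h2⟩ := mem_evenNbrs.1 h
    have h3 : x' ∈ evenNbrs E u := mem_evenNbrs.2 ⟨swap_mem h1, ht'.even_x⟩
    rcases hu with rfl | rfl | rfl
    · rcases ht.nx x' h3 with h | h
      · exact hyx' h
      · exact hx'z h
    · rcases ht.ny x' h3 with h | h
      · exact hxx' h
      · exact hx'z h
    · rcases ht.nz x' h3 with h | h
      · exact hxx' h
      · exact hyx' h
  have hy'mem : y' ∈ evenNbrs E x' := mem_evenNbrs.2 ⟨ht'.xy, ht'.even_y⟩
  have hz'mem : z' ∈ evenNbrs E x' := mem_evenNbrs.2 ⟨ht'.xz, ht'.even_z⟩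
  have hy'x : y' ≠ x := fun h => hd y' (Or.inl h) hy'mem
  have hy'y : y' ≠ y := fun h => hd y' (Or.inr (Or.inl h)) hy'mem
  have hy'z : y' ≠ z := fun h => hd y' (Or.inr (Or.inr h)) hy'mem
  have hz'x : z' ≠ x := fun h => hd z' (Or.inl h) hz'mem
  have hz'y : z' ≠ y := fun h => hd z' (Or.inr (Or.inl h)) hz'mem
  have hz'z : z' ≠ z := fun h => hd z' (Or.inr (Or.inr h)) hz'mem
  set S := evenNbrs E w with hSdef
  have hSe : ∀ v ∈ S, s(w, v) ∈ E ∧ Even (deg E v) := fun v hv => mem_evenNbrs.1 hv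
  -- The edges `wy` and `wy'` stay, with `yz` and `y'z'` removed in their place, and `wx` is set
  -- aside; this makes the number of leaves odd.
  set X := S \ {x, y, y'} with hX
  have hXS : X ⊆ S := Finset.sdiff_subset
  have hcX : X.card + 3 = S.card := by
    rw [← Finset.card_sdiff_add_card_eq_card (s := {x, y, y'}) (t := S),
      Finset.card_eq_three.2 ⟨x, y, y', nxy, hy'x.symm, hy'y.symm, rfl⟩]
    intro u hu
    simp only [Finset.mem_insert, Finset.mem_singleton] at hu
    rcases hu with rfl | rfl | rfl <;> assumption
  have hxX : x ∉ X := by simp [hX]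
  have hyX : y ∉ X := by simp [hX]
  have hy'X : y' ∉ X := by simp [hX]
  have hzX : z ∉ X := fun h => hz (hXS h)
  have hz'X : z' ∉ X := fun h => hz' (hXS h)
  have hodd : Odd X.card := by
    rw [Nat.even_iff] at hev; rw [Nat.odd_iff]; omega
  have hXe : ∀ v ∈ X, s(w, v) ∈ E ∧ Even (deg E v) := fun v hv => hSe v (hXS hv)
  have hnw : ∀ v, Even (deg E v) → v ≠ w := fun v hv h => not_odd_of_even hv (h ▸ hw)
  have hwX : w ∉ X := fun h => hnw w (hXe w h).2 rfl
  have hyw := hnw y ht.even_y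
  have hzw := hnw z ht.even_z
  have hxw := hnw x ht.even_x
  have hyw' := hnw y' ht'.even_y
  have hzw' := hnw z' ht'.even_z
  set M₀ := insert s(x, w) (insert s(y, z) (star w X)) with hM₀
  set M := insert s(y', z') M₀ with hM
  have hy'z'M₀ : s(y', z') ∉ M₀ := by
    rw [hM₀, Finset.mem_insert, Finset.mem_insert, mk_mem_star, Sym2.eq_iff, Sym2.eq_iff]
    simp [hy'x, hyw', hy'y, hy'z, hzw']
  have hsub₀ : M₀ ⊆ E := by
    intro e he
    simp only [hM₀, Finset.mem_insert] at he
    rcases he with rfl | rfl | he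
    · exact swap_mem (mem_evenNbrs.1 hx).1
    · exact ht.yz
    · exact star_subset (fun v hv => (hXe v hv).1) he
  have hsub : M ⊆ E := Finset.insert_subset ht'.yz hsub₀
  have hdegM : ∀ v, deg M v = (if v = w then X.card else if v ∈ X then 1 else 0) +
      (if v = y ∨ v = z then 1 else 0) + (if v = x ∨ v = w then 1 else 0) +
      if v = y' ∨ v = z' then 1 else 0 := by
    intro v
    rw [hM, deg_insert hy'z'M₀, hM₀, deg_insert, deg_insert, deg_star hwX]
    · simp only [Sym2.mem_iff]
    · rw [mk_mem_star]; simp [hyw, hzw]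
    · rw [Finset.mem_insert, mk_mem_star, Sym2.eq_iff]; simp [nxy, nxz, hxw, hxX]
  have hoddM : ∀ v, (v ∈ X ∨ v = x ∨ v = y ∨ v = z ∨ v = y' ∨ v = z') → Odd (deg M v) := by
    intro v hv
    rw [hdegM]
    rcases hv with hv | rfl | rfl | rfl | rfl | rfl
    · have h1 : v ≠ w := fun h => hwX (h ▸ hv)
      have h2 : v ≠ x := fun h => hxX (h ▸ hv)
      have h3 : v ≠ y := fun h => hyX (h ▸ hv)
      have h4 : v ≠ z := fun h => hzX (h ▸ hv)
      have h5 : v ≠ y' := fun h => hy'X (h ▸ hv)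
      have h6 : v ≠ z' := fun h => hz'X (h ▸ hv)
      simp [h1, h2, h3, h4, h5, h6, hv]
    · simp [hxw, hxX, nxy, nxz, hy'x.symm, hz'x.symm]
    · simp [hyw, hyX, nxy.symm, hy'y.symm, hz'y.symm]
    · simp [hzw, hzX, nxz.symm, hy'z.symm, hz'z.symm]
    · simp [hyw', hy'X, hy'x, hy'y, hy'z]
    · simp [hzw', hz'X, hz'x, hz'y, hz'z]
  have htouch : ∀ v, (∃ e ∈ M, v ∈ e) →
      v = w ∨ ((v ∈ X ∨ v = x ∨ v = y ∨ v = z ∨ v = y' ∨ v = z') ∧ Even (deg E v)) := by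
    rintro v ⟨e, he, hv⟩
    simp only [hM, hM₀, Finset.mem_insert] at he
    rcases he with rfl | rfl | rfl | he
    · rcases Sym2.mem_iff.1 hv with rfl | rfl
      · exact Or.inr ⟨by simp, ht'.even_y⟩
      · exact Or.inr ⟨by simp, ht'.even_z⟩
    · rcases Sym2.mem_iff.1 hv with rfl | rfl
      · exact Or.inr ⟨by simp, ht.even_x⟩
      · exact Or.inl rfl
    · rcases Sym2.mem_iff.1 hv with rfl | rfl
      · exact Or.inr ⟨by simp, ht.even_y⟩
      · exact Or.inr ⟨by simp, ht.even_z⟩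
    · rcases touched_star ⟨e, he, hv⟩ with rfl | hv
      · exact Or.inl rfl
      · exact Or.inr ⟨Or.inl hv, (hXe v hv).2⟩
  have hS : ∀ v ∈ S, Odd (deg (E \ M) v) := by
    intro v hv
    refine odd_sdiff_of_odd_deg hsub (mem_evenNbrs.1 hv).2 (hoddM v ?_)
    by_contra! h
    exact h.1 (by simp [hX, hv, h.2])
  have hwM : Odd (deg (E \ M) w) := by
    refine odd_sdiff_of_even_deg hsub hw ?_
    rw [hdegM]
    simp only [if_true, hyw.symm, hzw.symm, hyw'.symm, hzw'.symm, or_self, or_true, if_false]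
    rw [Nat.odd_iff] at hodd; rw [Nat.even_iff]; omega
  have hgo : ∀ v, Odd (deg E v) → Odd (deg (E \ M) v) := by
    intro v hv
    by_cases h : ∃ e ∈ M, v ∈ e
    · rcases htouch v h with rfl | h'
      · exact hwM
      · exact absurd hv (not_odd_of_even h'.2)
    · exact odd_sdiff_of_untouched h hv
  obtain ⟨k, hk, hD⟩ := exists_decGE_sdiff_of_evenNbrs hE ih (w := w) hsub
    ⟨s(y', z'), by simp [hM]⟩
    (fun v hv => (htouch v hv).imp_right fun h => ⟨h.2, odd_sdiff_of_odd_deg hsub h.2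
      (hoddM v h.1)⟩) hS
  have hset : insert s(y', z') (E \ M) = E \ M₀ := by
    ext e
    simp only [hM, Finset.mem_insert, Finset.mem_sdiff, not_or]
    constructor
    · rintro (rfl | h)
      · exact ⟨ht'.yz, hy'z'M₀⟩
      · exact ⟨h.1, h.2.2⟩
    · rintro ⟨h1, h2⟩
      by_cases h : e = s(y', z')
      · exact Or.inl h
      · exact Or.inr ⟨h1, h, h2⟩
  have hodd2 : ∀ v, (v ∈ X ∨ v = x ∨ v = y ∨ v = z ∨ v = y' ∨ v = z') → Even (deg E v) →
      Odd (deg (E \ M) v) := fun v hv h => odd_sdiff_of_odd_deg hsub h (hoddM v hv)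
  -- This edge uses the end at `z'`, which is not adjacent to `w` and hence is not needed in
  -- `Tame.add_reserved`.
  have hD' := hD.add (a := y') (x := z') (Z := ∅)
    (g' := fun v => if v = z' then 0 else deg (E \ M) v % 2) nyz'.symm (by simp [hM]) ?_
    (by rw [Finset.card_empty]; exact one_le_mod_two (hodd2 z' (by simp) ht'.even_z)) ?_
  · rw [hset] at hD'
    have hgo' : ∀ v, Odd (deg E v) → 1 ≤ (if v = z' then 0 else deg (E \ M) v % 2) := by
      intro v hv
      rw [if_neg (fun h : v = z' => not_odd_of_even ht'.even_z (h ▸ hv))]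
      exact one_le_mod_two (hgo v hv)
    refine .of_decGE hk (hE.add_reserved hw ht hXS hx hxX hyX hzX hodd hD' ?_ ?_ ?_ hgo')
    · rw [if_neg hz'y.symm]
      exact one_le_mod_two (hodd2 y (by simp) ht.even_y)
    · rw [if_neg hz'z.symm]
      exact one_le_mod_two (hodd2 z (by simp) ht.even_z)
    · intro v hv
      rcases Nat.even_or_odd (deg E v) with h | h
      · have hvS : v ∈ S := mem_evenNbrs.2 ⟨hv, h⟩
        rw [if_neg (fun h : v = z' => hz' (h ▸ hvS))]
        exact one_le_mod_two (hS v hvS)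
      · exact hgo' v h
  · intro u hu h0
    exfalso
    have hue : Even (deg E u) := even_deg_of_eq_zero (fun u hu => one_le_mod_two (hgo u hu)) h0
    rcases ht'.ny u (mem_evenNbrs.2 ⟨mem_of_mem_sdiff hu, hue⟩) with rfl | rfl
    · exact not_odd_of_even (Nat.even_iff.2 h0) (hS u hx')
    · simp [hM] at hu
  · intro v
    by_cases h : v = z'
    · simp [h]
    · simp [h]

end

/-! ### Odd vertices with an odd number of even neighbours. -/

section

variable {V : Type*} [DecidableEq V] {E M : Finset (Sym2 V)} {U : Finset V}

/-- Adding back all edges from `w` to its even neighbours, if in a maximal partial solution some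
edge can be added last. -/
lemma Tame.add_star_evenNbrs (hE : Tame E U) {w : V} (hw : Odd (deg E w))
    (hodd : Odd (evenNbrs E w).card) {k : ℕ} {g : V → ℕ}
    (hD : DecGE (E \ star w (evenNbrs E w)) k g) (hgS : ∀ v ∈ evenNbrs E w, 1 ≤ g v)
    (hgo : ∀ v, v ≠ w → Odd (deg E v) → 1 ≤ g v)
    (hlast : ∀ A ⊆ evenNbrs E w, StarState (E \ star w (evenNbrs E w)) k g w A →
      (∀ X' ⊆ evenNbrs E w \ A, ∃ Z ⊆ A, X'.card ≤ Z.card ∧ ∀ y ∈ Z, ∃ x ∈ X',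
        StarState (E \ star w (evenNbrs E w)) k g w (insert x (A.erase y))) →
      (evenNbrs E w \ A).card + 1 = A.card → (evenNbrs E w \ A).Nonempty →
      ∃ A' ⊆ evenNbrs E w, StarState (E \ star w (evenNbrs E w)) k g w A' ∧ A'.card = A.card ∧
        ∃ x ∈ evenNbrs E w \ A', ∃ Zx : Finset V,
          (∀ y ∈ evenNbrs E x, g y = 0 ∨ y ∈ A' → y ∈ Zx) ∧ Zx.card ≤ 1) :
    DecGE E k 0 := by
  set S := evenNbrs E w with hSdef
  have hSe : ∀ v ∈ S, s(w, v) ∈ E ∧ Even (deg E v) := fun v hv => mem_evenNbrs.1 hv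
  have hnw : ∀ v, Even (deg E v) → v ≠ w := fun v hv h => not_odd_of_even hv (h ▸ hw)
  have hwS : w ∉ S := fun h => hnw w (hSe w h).2 rfl
  have hsub : star w S ⊆ E := star_subset fun v hv => (hSe v hv).1
  have hXE : ∀ x ∈ S, s(w, x) ∉ E \ star w S := fun x hx h =>
    (Finset.mem_sdiff.1 h).2 (mk_mem_star.2 (Or.inl ⟨rfl, hx⟩))
  have hN : ∀ y, s(w, y) ∈ E \ star w S → 1 ≤ g y := by
    intro y hy
    rcases Nat.even_or_odd (deg E y) with h | h
    · exact hgS y (mem_evenNbrs.2 ⟨mem_of_mem_sdiff hy, h⟩)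
    · exact hgo y (hE.ne (mem_of_mem_sdiff hy)).symm h
  have hnbr : ∀ v ∈ S, ∀ y, s(v, y) ∈ E \ star w S → ∀ A ⊆ S, g y = 0 ∨ y ∈ A →
      y ∈ evenNbrs E v := by
    intro v hv y hy A hA h
    refine mem_evenNbrs.2 ⟨mem_of_mem_sdiff hy, ?_⟩
    rcases h with h | h
    · by_contra hev
      have hyw : y ≠ w := by rintro rfl; exact hXE v hv (swap_mem hy)
      have := hgo y hyw (Nat.not_even_iff_odd.1 hev)
      omega
    · exact (hSe y (hA h)).2
  obtain ⟨A, hAS, hA, hmax⟩ := hD.exists_max_starState (w := w) S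
  have h1 := hA.card_sdiff_le hwS hXE hgS hN hAS hmax
  have h2 := Finset.card_sdiff_add_card_eq_card hAS
  obtain ⟨m, hm⟩ := hodd
  rw [← Finset.sdiff_union_of_subset hsub]
  rcases (S \ A).eq_empty_or_nonempty with h0 | h0
  · rw [Finset.sdiff_eq_empty_iff_subset] at h0
    rw [Finset.Subset.antisymm hAS h0] at hA
    exact DecGE.mono hA (by simp)
  by_cases h3 : (S \ A).card + 2 ≤ A.card
  · have h4 := hA.complete hwS hXE (Finset.Subset.refl _) (Z := evenNbrs E)
      (fun v hv y hy h => hnbr v (Finset.mem_sdiff.1 hv).1 y hy A hAS h)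
      (fun v hv => hE.two v (hSe v (Finset.mem_sdiff.1 hv).1).2) (by omega)
    rw [Finset.union_sdiff_of_subset hAS] at h4
    exact h4.mono (by simp)
  -- No end at `w` is assumed, since `w` is even after an odd star is removed. So the balance may be
  -- short by one, and the last edge must go to a leaf with at most one neighbour lacking an end.
  · obtain ⟨A', hA'S, hA', hc, x, hx, Zx, hZx, hcx⟩ := hlast A hAS hA
      (fun X' hX' => hA.exchange hwS hXE hgS hN hAS hmax hX') (by omega) h0
    have h4 := Finset.card_sdiff_add_card_eq_card hA'S
    exact hA'.complete_last hwS hXE hA'S (Z := evenNbrs E)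
      (fun v hv y hy h => hnbr v hv y hy A' hA'S h) (fun v hv => hE.two v (hSe v hv).2) hx
      (fun y hy h => hZx y (hnbr x (Finset.mem_sdiff.1 hx).1 y hy A' hA'S h) h) hcx (by omega)

lemma Tame.evenNbrs_trans (hE : Tame E U) {v y u : V} (hv : Even (deg E v))
    (hy : y ∈ evenNbrs E v) (hu : u ∈ evenNbrs E y) : u = v ∨ u ∈ evenNbrs E v := by
  obtain ⟨z, ht⟩ := hE.tri v y hv hy
  rcases ht.ny u hu with rfl | rfl
  · exact Or.inl rfl
  · exact Or.inr (mem_evenNbrs.2 ⟨ht.xz, ht.even_z⟩)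

/-- For an even vertex `v` one can remove an edge between its even neighbours, if there are any,
such that at most one of them is not the end of a path when the edge is added back. -/
lemma Tame.exists_opposite_edge (hE : Tame E U) {v : V} (hv : Even (deg E v)) :
    ∃ (L : Finset (Sym2 V)) (Z : Finset V), L ⊆ E ∧ (∀ e ∈ L, ∀ u ∈ e, u ∈ evenNbrs E v) ∧
      (∀ u ∈ evenNbrs E v, Odd (deg L u)) ∧ Z.card ≤ 1 ∧ Z ⊆ evenNbrs E v ∧
      ∀ (H : Finset (Sym2 V)) (k : ℕ) (g : V → ℕ), Disjoint H L →
        (∀ y ∈ evenNbrs E v, ∀ u, s(y, u) ∈ H → 1 ≤ g u) → (∀ u ∈ evenNbrs E v, 1 ≤ g u) →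
        DecGE H k g → DecGE (H ∪ L) k (fun u => if u ∈ Z then 0 else g u) := by
  rcases (evenNbrs E v).eq_empty_or_nonempty with h0 | ⟨y, hy⟩
  · refine ⟨∅, ∅, by simp, by simp, by simp [h0], by simp, by simp, ?_⟩
    intro H k g _ _ _ hD
    simpa using hD
  · obtain ⟨z, ht⟩ := hE.tri v y hv hy
    have hz : z ∈ evenNbrs E v := mem_evenNbrs.2 ⟨ht.xz, ht.even_z⟩
    refine ⟨{s(y, z)}, {z}, by simpa using ht.yz, ?_, ?_, by simp, by simpa using hz, ?_⟩
    · intro e he u hu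
      rw [Finset.mem_singleton.1 he, Sym2.mem_iff] at hu
      rcases hu with rfl | rfl <;> assumption
    · intro u hu
      rw [deg_singleton, if_pos (by simpa using ht.nx u hu)]
      decide
    · intro H k g hdis hN hg hD
      rw [Finset.disjoint_singleton_right] at hdis
      rw [Finset.union_singleton]
      refine hD.add (Z := ∅) (hE.ne ht.yz).symm hdis ?_ ?_ ?_
      · intro u hu h0
        have := hN y hy u hu
        omega
      · rw [Finset.card_empty]; exact hg z hz
      · intro u
        by_cases h : u = z
        · simp [h]
        · simp [h]

/-- Besides the star, the edges opposite to `v` and `v'` in their triangles are removed, if there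
are any. Restoring such an edge costs the end at only one of its vertices, so `v` and `v'` are both
suitable as the last leaf. Two of them are needed to make sure that one can be exchanged out of `A`.
-/
lemma Tame.decomposable_of_two_good (hE : Tame E U) (ih : IH E) {w v v' : V}
    (hw : Odd (deg E w)) (hv : v ∈ evenNbrs E w) (hv' : v' ∈ evenNbrs E w) (hvv' : v ≠ v')
    (hgood : ∀ u ∈ evenNbrs E v, u ∉ evenNbrs E w)
    (hgood' : ∀ u ∈ evenNbrs E v', u ∉ evenNbrs E w)
    (hodd : Odd (evenNbrs E w).card) : Decomposable E U := by
  have hve := (mem_evenNbrs.1 hv).2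
  have hve' := (mem_evenNbrs.1 hv').2
  obtain ⟨L, Z, hLE, hLv, hLodd, hZc, hZ, hL⟩ := hE.exists_opposite_edge hve
  obtain ⟨L', Z', hLE', hLv', hLodd', hZc', hZ', hL'⟩ := hE.exists_opposite_edge hve'
  set S := evenNbrs E w with hSdef
  have hSe : ∀ v ∈ S, s(w, v) ∈ E ∧ Even (deg E v) := fun v hv => mem_evenNbrs.1 hv
  have hnw : ∀ v, Even (deg E v) → v ≠ w := fun v hv h => not_odd_of_even hv (h ▸ hw)
  have hwS : w ∉ S := fun h => hnw w (hSe w h).2 rfl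
  have hsub : star w S ⊆ E := star_subset fun v hv => (hSe v hv).1
  have hdisj : ∀ u ∈ evenNbrs E v, u ∉ evenNbrs E v' := by
    intro u hu hu'
    have h1 : v' ∈ evenNbrs E u := mem_evenNbrs.2 ⟨swap_mem (mem_evenNbrs.1 hu').1, hve'⟩
    rcases hE.evenNbrs_trans hve hu h1 with h | h
    · exact hvv' h.symm
    · exact hgood v' h hv'
  have hwL : ∀ e ∈ L ∪ L', w ∉ e := by
    intro e he hwe
    rcases Finset.mem_union.1 he with he | he
    · exact hnw w (mem_evenNbrs.1 (hLv e he w hwe)).2 rfl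
    · exact hnw w (mem_evenNbrs.1 (hLv' e he w hwe)).2 rfl
  have hLL' : Disjoint L L' := by
    rw [Finset.disjoint_left]
    intro e he he'
    induction e using Sym2.ind with
    | _ a b => exact hdisj a (hLv _ he a (by simp)) (hLv' _ he' a (by simp))
  have hSL : Disjoint (star w S) (L ∪ L') := by
    rw [Finset.disjoint_left]
    intro e he he'
    obtain ⟨x, hx, rfl⟩ := Finset.mem_image.1 he
    exact hwL _ he' (by simp)
  set M := star w S ∪ (L ∪ L') with hM
  have hME : M ⊆ E := Finset.union_subset hsub (Finset.union_subset hLE hLE')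
  have hdegM : ∀ u, deg M u = (if u = w then S.card else if u ∈ S then 1 else 0) +
      (deg L u + deg L' u) := by
    intro u
    rw [hM, deg_union hSL, deg_union hLL', deg_star hwS]
  have hL0 : ∀ u, u ∉ evenNbrs E v → deg L u = 0 := fun u hu =>
    deg_eq_zero_iff.2 fun e he hue => hu (hLv e he u hue)
  have hL0' : ∀ u, u ∉ evenNbrs E v' → deg L' u = 0 := fun u hu =>
    deg_eq_zero_iff.2 fun e he hue => hu (hLv' e he u hue)
  have hoddM : ∀ u, (u ∈ S ∨ u ∈ evenNbrs E v ∨ u ∈ evenNbrs E v') → Odd (deg M u) := by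
    intro u hu
    rw [hdegM]
    rcases hu with hu | hu | hu
    · rw [if_neg (hnw u (hSe u hu).2), if_pos hu, hL0 u (fun h => hgood u h hu),
        hL0' u (fun h => hgood' u h hu)]
      decide
    · rw [if_neg (hnw u (mem_evenNbrs.1 hu).2), if_neg (hgood u hu), hL0' u (hdisj u hu),
        zero_add, add_zero]
      exact hLodd u hu
    · rw [if_neg (hnw u (mem_evenNbrs.1 hu).2), if_neg (hgood' u hu),
        hL0 u (fun h => hdisj u h hu), zero_add, zero_add]
      exact hLodd' u hu
  have htouch : ∀ u, (∃ e ∈ M, u ∈ e) →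
      u = w ∨ (u ∈ S ∨ u ∈ evenNbrs E v ∨ u ∈ evenNbrs E v') := by
    rintro u ⟨e, he, hu⟩
    rcases Finset.mem_union.1 he with he | he
    · exact (touched_star ⟨e, he, hu⟩).imp_right Or.inl
    · rcases Finset.mem_union.1 he with he | he
      · exact Or.inr (Or.inr (Or.inl (hLv e he u hu)))
      · exact Or.inr (Or.inr (Or.inr (hLv' e he u hu)))
  have hevt : ∀ u, (u ∈ S ∨ u ∈ evenNbrs E v ∨ u ∈ evenNbrs E v') → Even (deg E u) := by
    rintro u (h | h | h) <;> exact (mem_evenNbrs.1 h).2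
  have hoddH : ∀ u, (u ∈ S ∨ u ∈ evenNbrs E v ∨ u ∈ evenNbrs E v') → Odd (deg (E \ M) u) :=
    fun u hu => odd_sdiff_of_odd_deg hME (hevt u hu) (hoddM u hu)
  have hgo : ∀ u, u ≠ w → Odd (deg E u) → Odd (deg (E \ M) u) := by
    intro u huw hu
    by_cases h : ∃ e ∈ M, u ∈ e
    · rcases htouch u h with rfl | h'
      · exact absurd rfl huw
      · exact absurd hu (not_odd_of_even (hevt u h'))
    · exact odd_sdiff_of_untouched h hu
  obtain ⟨k, hk, hD⟩ := exists_decGE_sdiff_of_evenNbrs hE ih (w := w) hME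
    ⟨s(w, v), Finset.mem_union_left _ (mk_mem_star.2 (Or.inl ⟨rfl, hv⟩))⟩
    (fun u hu => (htouch u hu).imp_right fun h => ⟨hevt u h, hoddH u h⟩)
    (fun u hu => hoddH u (Or.inl hu))
  have hnbr : ∀ v₀ ∈ S, (∀ u ∈ evenNbrs E v₀, u ∉ S) → ∀ y ∈ evenNbrs E v₀, ∀ u, s(y, u) ∈ E →
      (Odd (deg E u) ∧ u ≠ w) ∨ u = v₀ ∨ u ∈ evenNbrs E v₀ := by
    intro v₀ hv₀ hg y hy u hyu
    rcases Nat.even_or_odd (deg E u) with h | h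
    · exact Or.inr (hE.evenNbrs_trans (hSe v₀ hv₀).2 hy (mem_evenNbrs.2 ⟨hyu, h⟩))
    · refine Or.inl ⟨h, ?_⟩
      rintro rfl
      exact hg y hy (mem_evenNbrs.2 ⟨swap_mem hyu, (mem_evenNbrs.1 hy).2⟩)
  have hd1 : Disjoint (E \ M) L := by
    rw [Finset.disjoint_left]
    intro e he he'
    exact (Finset.mem_sdiff.1 he).2 (by simp [hM, he'])
  have hD1 := hL _ k _ hd1 ?_ (fun u hu => one_le_mod_two (hoddH u (Or.inr (Or.inl hu)))) hD
  have hd2 : Disjoint (E \ M ∪ L) L' := by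
    rw [Finset.disjoint_union_left]
    refine ⟨?_, hLL'⟩
    rw [Finset.disjoint_left]
    intro e he he'
    exact (Finset.mem_sdiff.1 he).2 (by simp [hM, he'])
  have hD2 := hL' _ k _ hd2 ?_ ?_ hD1
  · have hset : E \ M ∪ L ∪ L' = E \ star w S := by
      ext e
      have h1 := @hLE e
      have h2 := @hLE' e
      have h3 : e ∈ star w S → e ∉ L ∪ L' := fun h h' => Finset.disjoint_left.1 hSL h h'
      simp only [hM, Finset.mem_union, Finset.mem_sdiff] at h3 ⊢
      tauto
    rw [hset] at hD2
    refine .of_decGE hk (hE.add_star_evenNbrs hw hodd hD2 ?_ ?_ ?_)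
    · intro u hu
      rw [if_neg (fun h => hgood' u (hZ' h) hu), if_neg (fun h => hgood u (hZ h) hu)]
      exact one_le_mod_two (hoddH u (Or.inl hu))
    · intro u huw hu
      rw [if_neg (fun h => not_odd_of_even (mem_evenNbrs.1 (hZ' h)).2 hu),
        if_neg (fun h => not_odd_of_even (mem_evenNbrs.1 (hZ h)).2 hu)]
      exact one_le_mod_two (hgo u huw hu)
    · intro A hAS hA hex hcard hne
      have hlast : ∀ v₀ ∈ S, (∀ u ∈ evenNbrs E v₀, u ∉ S) → ∀ A' ⊆ S, ∀ Z₀ : Finset V,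
          (∀ y ∈ evenNbrs E v₀, (if y ∈ Z' then 0 else if y ∈ Z then 0 else
            deg (E \ M) y % 2) = 0 → y ∈ Z₀) → ∀ y ∈ evenNbrs E v₀,
          (if y ∈ Z' then 0 else if y ∈ Z then 0 else
            deg (E \ M) y % 2) = 0 ∨ y ∈ A' → y ∈ Z₀ := by
        intro v₀ _ hg A' hA' Z₀ h y hy hy'
        rcases hy' with h' | h'
        · exact h y hy h'
        · exact absurd (hA' h') (hg y hy)
      have hz : ∀ A' ⊆ S, ∀ y ∈ evenNbrs E v, (if y ∈ Z' then 0 else if y ∈ Z then 0 else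
            deg (E \ M) y % 2) = 0 ∨ y ∈ A' → y ∈ Z := by
        intro A' hA'
        refine hlast v hv hgood A' hA' Z ?_
        intro y hy h
        by_contra hyZ
        rw [if_neg (fun h' => hdisj y hy (hZ' h')), if_neg hyZ] at h
        exact not_odd_of_even (Nat.even_iff.2 h) (hoddH y (Or.inr (Or.inl hy)))
      have hz' : ∀ A' ⊆ S, ∀ y ∈ evenNbrs E v', (if y ∈ Z' then 0 else if y ∈ Z then 0 else
            deg (E \ M) y % 2) = 0 ∨ y ∈ A' → y ∈ Z' := by
        intro A' hA'
        refine hlast v' hv' hgood' A' hA' Z' ?_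
        intro y hy h
        by_contra hyZ
        rw [if_neg hyZ, if_neg (fun h' => hdisj y (hZ h') hy)] at h
        exact not_odd_of_even (Nat.even_iff.2 h) (hoddH y (Or.inr (Or.inr hy)))
      by_cases hvA : v ∉ A
      · exact ⟨A, hAS, hA, rfl, v, Finset.mem_sdiff.2 ⟨hv, hvA⟩, Z, hz A hAS, hZc⟩
      by_cases hvA' : v' ∉ A
      · exact ⟨A, hAS, hA, rfl, v', Finset.mem_sdiff.2 ⟨hv', hvA'⟩, Z', hz' A hAS, hZc'⟩
      push Not at hvA hvA'
      -- The set `Y` of exchangeable leaves misses at most one vertex of `A`, so it contains `v` or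
      -- `v'`.
      obtain ⟨Y, hYA, hYc, hY⟩ := hex _ (Finset.Subset.refl _)
      have hmem : v ∈ Y ∨ v' ∈ Y := by
        by_contra! h
        have h1 : Y ⊆ (A.erase v).erase v' := by
          intro y hy
          rw [Finset.mem_erase, Finset.mem_erase]
          exact ⟨fun h' => h.2 (h' ▸ hy), fun h' => h.1 (h' ▸ hy), hYA hy⟩
        have h2 := Finset.card_le_card h1
        rw [Finset.card_erase_of_mem (Finset.mem_erase.2 ⟨hvv'.symm, hvA'⟩),
          Finset.card_erase_of_mem hvA] at h2
        have h3 : (S \ A).card + 1 = A.card := hcard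
        have h4 : (S \ A).card ≤ Y.card := hYc
        have h5 : 0 < (S \ A).card := Finset.card_pos.2 hne
        omega
      have hswap : ∀ u ∈ A, ∀ x ∈ S \ A, insert x (A.erase u) ⊆ S ∧
          (insert x (A.erase u)).card = A.card ∧ u ∈ S \ insert x (A.erase u) := by
        intro u hu x hx
        obtain ⟨hxS, hxA⟩ := Finset.mem_sdiff.1 hx
        refine ⟨Finset.insert_subset hxS ((Finset.erase_subset _ _).trans hAS), ?_, ?_⟩
        · rw [Finset.card_insert_of_notMem (fun h => hxA (Finset.mem_of_mem_erase h)),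
            Finset.card_erase_add_one hu]
        · rw [Finset.mem_sdiff, Finset.mem_insert]
          refine ⟨hAS hu, ?_⟩
          rintro (rfl | h)
          · exact hxA hu
          · simp at h
      rcases hmem with h | h
      · obtain ⟨x, hx, hst⟩ := hY v h
        obtain ⟨h1, h2, h3⟩ := hswap v hvA x hx
        exact ⟨_, h1, hst, h2, v, h3, Z, hz _ h1, hZc⟩
      · obtain ⟨x, hx, hst⟩ := hY v' h
        obtain ⟨h1, h2, h3⟩ := hswap v' hvA' x hx
        exact ⟨_, h1, hst, h2, v', h3, Z', hz' _ h1, hZc'⟩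
  · intro y hy u hu
    have hyL : s(y, u) ∉ L := fun h => hdisj y (hLv _ h y (by simp)) hy
    have hu := (Finset.mem_union.1 hu).resolve_right hyL
    rcases hnbr v' hv' hgood' y hy u (mem_of_mem_sdiff hu) with ⟨h1, h2⟩ | rfl | h
    · rw [if_neg (fun h => not_odd_of_even (mem_evenNbrs.1 (hZ h)).2 h1)]
      exact one_le_mod_two (hgo u h2 h1)
    · rw [if_neg (fun h => hgood u (hZ h) hv')]
      exact one_le_mod_two (hoddH u (Or.inl hv'))
    · rw [if_neg (fun h' => hdisj u (hZ h') h)]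
      exact one_le_mod_two (hoddH u (Or.inr (Or.inr h)))
  · intro u hu
    rw [if_neg (fun h' => hdisj u (hZ h') hu)]
    exact one_le_mod_two (hoddH u (Or.inr (Or.inr hu)))
  · intro y hy u hu
    rcases hnbr v hv hgood y hy u (mem_of_mem_sdiff hu) with ⟨h1, h2⟩ | rfl | h
    · exact one_le_mod_two (hgo u h2 h1)
    · exact one_le_mod_two (hoddH u (Or.inl hv))
    · exact one_le_mod_two (hoddH u (Or.inr (Or.inl h)))

/-- All even neighbours of `w`, except possibly `o`, come in triangles, and there are many. -/
lemma Tame.decomposable_of_many_triangles (hE : Tame E U) (ih : IH E) {w o : V}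
    (hw : Odd (deg E w)) (hodd : Odd (evenNbrs E w).card) (hcard : 7 ≤ (evenNbrs E w).card)
    (htri : ∀ v ∈ evenNbrs E w, v ≠ o →
      ∃ y ∈ evenNbrs E w, ∃ z ∈ evenNbrs E w, IsTri E v y z) : Decomposable E U := by
  set S := evenNbrs E w with hSdef
  have hSe : ∀ v ∈ S, s(w, v) ∈ E ∧ Even (deg E v) := fun v hv => mem_evenNbrs.1 hv
  have hnw : ∀ v, Even (deg E v) → v ≠ w := fun v hv h => not_odd_of_even hv (h ▸ hw)
  have hwS : w ∉ S := fun h => hnw w (hSe w h).2 rfl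
  have hsub : star w S ⊆ E := star_subset fun v hv => (hSe v hv).1
  have hS : ∀ v ∈ S, Odd (deg (E \ star w S) v) := by
    intro v hv
    refine odd_sdiff_of_odd_deg hsub (hSe v hv).2 ?_
    rw [deg_star hwS, if_neg (hnw v (hSe v hv).2), if_pos hv]
    decide
  obtain ⟨v₀, hv₀⟩ : S.Nonempty := Finset.card_pos.1 (by omega)
  obtain ⟨k, hk, hD⟩ := exists_decGE_sdiff_of_evenNbrs hE ih (w := w) hsub
    ⟨s(w, v₀), mk_mem_star.2 (Or.inl ⟨rfl, hv₀⟩)⟩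
    (fun v hv => (touched_star hv).imp_right fun h => ⟨(hSe v h).2, hS v h⟩) hS
  refine .of_decGE hk (hE.add_star_evenNbrs hw hodd hD (fun v hv => one_le_mod_two (hS v hv)) ?_ ?_)
  · intro v hvw hv
    by_cases h : ∃ e ∈ star w S, v ∈ e
    · rcases touched_star h with rfl | h'
      · exact absurd rfl hvw
      · exact absurd hv (not_odd_of_even (hSe v h').2)
    · exact one_le_mod_two (odd_sdiff_of_untouched h hv)
  · intro A hAS hA hex hcA hne
    by_contra hcon
    -- no partial solution of the same size misses two vertices of a triangle
    have hno : ∀ A' ⊆ S, StarState (E \ star w S) k (fun v => deg (E \ star w S) v % 2) w A' →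
        A'.card = A.card → ∀ x y z, x ∈ S → y ∈ S → IsTri E x y z → x ∉ A' → y ∉ A' →
        False := by
      intro A' hA'S hA' hc x y z hx hy ht hxA hyA
      refine hcon ⟨A', hA'S, hA', hc, x, Finset.mem_sdiff.2 ⟨hx, hxA⟩, {z}, ?_, by simp⟩
      intro u hu h
      rw [Finset.mem_singleton]
      rcases ht.nx u hu with rfl | rfl
      · rcases h with h | h
        · exact absurd (hS u hy) (not_odd_of_even (Nat.even_iff.2 h))
        · exact absurd h hyA
      · rfl
    have hcA : (S \ A).card + 1 = A.card := hcA
    have hcS : (S \ A).card + A.card = S.card := Finset.card_sdiff_add_card_eq_card hAS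
    classical
    -- Hall's theorem matches each missing leaf with a leaf in `A` for which it can be exchanged.
    obtain ⟨f, hfinj, hf⟩ := (Finset.all_card_le_biUnion_card_iff_exists_injective
      (fun x : {x // x ∈ S \ A} => A.filter fun y => StarState (E \ star w S) k
        (fun v => deg (E \ star w S) v % 2) w (insert x.1 (A.erase y)))).1 (by
      intro s
      obtain ⟨Z, hZA, hZc, hZ⟩ := hex (s.map (Function.Embedding.subtype _)) (by
        intro x hx
        obtain ⟨x', -, rfl⟩ := Finset.mem_map.1 hx
        exact x'.2)
      rw [Finset.card_map] at hZc
      refine hZc.trans (Finset.card_le_card ?_)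
      intro y hy
      obtain ⟨x, hx, hst⟩ := hZ y hy
      obtain ⟨x', hx', rfl⟩ := Finset.mem_map.1 hx
      exact Finset.mem_biUnion.2 ⟨x', hx', Finset.mem_filter.2 ⟨hZA hy, hst⟩⟩)
    have hfA : ∀ x, f x ∈ A := fun x => (Finset.mem_filter.1 (hf x)).1
    have hfst : ∀ x, StarState (E \ star w S) k (fun v => deg (E \ star w S) v % 2) w
      (insert x.1 (A.erase (f x))) := fun x => (Finset.mem_filter.1 (hf x)).2
    -- of each triangle that meets `S \ A`, some vertex in `A` is not matched
    have hunm : ∀ x (hx : x ∈ S \ A) (y z : V), y ∈ S → z ∈ S → IsTri E x y z →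
        ∃ u, (u = y ∨ u = z) ∧ u ∈ A ∧ ∀ x', f x' ≠ u := by
      intro x hx y z hy hz ht
      obtain ⟨hxS, hxA⟩ := Finset.mem_sdiff.1 hx
      have hyA : y ∈ A := by
        by_contra h; exact hno A hAS hA rfl x y z hxS hy ht hxA h
      have hzA : z ∈ A := by
        by_contra h; exact hno A hAS hA rfl x z y hxS hz ht.swap_yz hxA h
      have key : ∀ u t, u ∈ A → u ∈ S → IsTri E x u t → ∀ x', f x' = u → x' = ⟨x, hx⟩ := by
        intro u t huA huS ht x' hx'
        -- If another missing leaf `x'` were matched with `u`, that exchange would leave both `x`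
        -- and `u` missing, contrary to `hno`. So at most one of `y` and `z` is matched, and only
        -- with `x`.
        by_contra hne
        have hxx' : x ≠ x'.1 := fun h => hne (Subtype.ext h.symm)
        have hux' : u ≠ x'.1 := fun h => (Finset.mem_sdiff.1 x'.2).2 (h ▸ huA)
        have hst := hfst x'
        rw [hx'] at hst
        refine hno _ ?_ hst ?_ x u t hxS huS ht ?_ ?_
        · exact Finset.insert_subset (Finset.mem_sdiff.1 x'.2).1
            ((Finset.erase_subset _ _).trans hAS)
        · rw [Finset.card_insert_of_notMem
            (fun h => (Finset.mem_sdiff.1 x'.2).2 (Finset.mem_of_mem_erase h)),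
            Finset.card_erase_add_one huA]
        · simp [hxx', hxA]
        · simp [hux']
      by_cases h : ∃ x', f x' = y
      · refine ⟨z, Or.inr rfl, hzA, fun x'' hx'' => ?_⟩
        obtain ⟨x', hx'⟩ := h
        have h1 := key y z hyA hy ht x' hx'
        have h2 := key z y hzA hz ht.swap_yz x'' hx''
        rw [h1] at hx'
        rw [h2] at hx''
        exact hE.ne ht.yz (hx'.symm.trans hx'')
      · push Not at h
        exact ⟨y, Or.inl rfl, hyA, h⟩
    -- Seven even neighbours and `|S \ A| + 1 = |A|` give at least three missing leaves, two of
    -- which differ from `o`.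
    have hc2 : 1 < ((S \ A).erase o).card := by
      have := Finset.pred_card_le_card_erase (s := S \ A) (a := o)
      omega
    obtain ⟨x, hx, x', hx', hxx'⟩ := Finset.one_lt_card.1 hc2
    obtain ⟨hxo, hxR⟩ := Finset.mem_erase.1 hx
    obtain ⟨hxo', hxR'⟩ := Finset.mem_erase.1 hx'
    obtain ⟨hxS, hxA⟩ := Finset.mem_sdiff.1 hxR
    obtain ⟨hxS', hxA'⟩ := Finset.mem_sdiff.1 hxR'
    obtain ⟨y, hy, z, hz, ht⟩ := htri x hxS hxo
    obtain ⟨y', hy', z', hz', ht'⟩ := htri x' hxS' hxo'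
    obtain ⟨u, hu, huA, hfu⟩ := hunm x hxR y z hy hz ht
    obtain ⟨u', hu', huA', hfu'⟩ := hunm x' hxR' y' z' hy' hz' ht'
    have hx'nx : x' ∉ evenNbrs E x := by
      intro h
      rcases ht.nx x' h with rfl | rfl
      · exact hno A hAS hA rfl x x' z hxS hxS' ht hxA hxA'
      · exact hno A hAS hA rfl x x' y hxS hxS' ht.swap_yz hxA hxA'
    have huu' : u ≠ u' := by
      rintro rfl
      have h1 : u ∈ evenNbrs E x := by
        rcases hu with rfl | rfl
        · exact mem_evenNbrs.2 ⟨ht.xy, ht.even_y⟩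
        · exact mem_evenNbrs.2 ⟨ht.xz, ht.even_z⟩
      have h2 : x' ∈ evenNbrs E u := by
        rcases hu' with rfl | rfl
        · exact mem_evenNbrs.2 ⟨swap_mem ht'.xy, ht'.even_x⟩
        · exact mem_evenNbrs.2 ⟨swap_mem ht'.xz, ht'.even_x⟩
      rcases hE.evenNbrs_trans ht.even_x h1 h2 with h | h
      · exact hxx' h.symm
      · exact hx'nx h
    -- The injection `f` leaves exactly one vertex of `A` unmatched, but both `u` and `u'` are.
    have himg : Finset.univ.image f ⊆ (A.erase u).erase u' := by
      intro t ht
      obtain ⟨t', -, rfl⟩ := Finset.mem_image.1 ht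
      rw [Finset.mem_erase, Finset.mem_erase]
      exact ⟨hfu' t', hfu t', hfA t'⟩
    have h1 := Finset.card_le_card himg
    rw [Finset.card_image_of_injective _ hfinj, Finset.card_univ, Fintype.card_coe,
      Finset.card_erase_of_mem (Finset.mem_erase.2 ⟨huu'.symm, huA'⟩),
      Finset.card_erase_of_mem huA] at h1
    omega

end

/-! ### Odd vertices attached to a triangle. -/

section

variable {V : Type*} [DecidableEq V] {E M : Finset (Sym2 V)} {U : Finset V}

/-- If `a` is adjacent to at least two vertices of a triangle of even vertices, and to no other
even vertices, then edges can be removed that change the parity of exactly these four degrees. -/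
lemma Tame.exists_attachment (hE : Tame E U) {a x y z : V} (ha : Odd (deg E a))
    (ht : IsTri E x y z) (hx : s(a, x) ∈ E) (hy : s(a, y) ∈ E) :
    ∃ M ⊆ E, (∀ e ∈ M, ∀ u ∈ e, u = a ∨ u ∈ ({x, y, z} : Finset V)) ∧
      (∀ u, u = a ∨ u ∈ ({x, y, z} : Finset V) → Odd (deg M u)) ∧
      ∀ (H : Finset (Sym2 V)) (k : ℕ) (g : V → ℕ), H ⊆ E → Disjoint H M →
        (∀ u, u = a ∨ u ∈ ({x, y, z} : Finset V) → 1 ≤ g u) →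
        (∀ u, u = a ∨ u ∈ ({x, y, z} : Finset V) → ∀ v, s(u, v) ∈ H → 1 ≤ g v) →
        DecGE H k g → DecGE (H ∪ M) k
          (fun u => if u = a then 2 else if u ∈ ({x, y, z} : Finset V) then 0 else g u) := by
  have nxy := hE.ne ht.xy
  have nyz := hE.ne ht.yz
  have nxz := hE.ne ht.xz
  have hnw : ∀ v, Even (deg E v) → v ≠ a := fun v hv h => not_odd_of_even hv (h ▸ ha)
  have hxa := hnw x ht.even_x
  have hya := hnw y ht.even_y
  have hza := hnw z ht.even_z
  by_cases hz : s(a, z) ∈ E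
  · have haT : a ∉ ({x, y, z} : Finset V) := by simp [hxa.symm, hya.symm, hza.symm]
    have hcT : ({x, y, z} : Finset V).card = 3 := by
      rw [Finset.card_eq_three]; exact ⟨x, y, z, nxy, nxz, nyz, rfl⟩
    refine ⟨star a {x, y, z}, star_subset (by simp [hx, hy, hz]), ?_, ?_, ?_⟩
    · exact fun e he u hu => touched_star ⟨e, he, hu⟩
    · intro u hu
      rw [deg_star haT]
      rcases hu with rfl | hu
      · rw [if_pos rfl, hcT]; decide
      · rw [if_neg (fun h : u = a => haT (h ▸ hu)), if_pos hu]; decide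
    · intro H k g hH hdis hg hN hD
      refine hD.add_star (Z := fun v => ({x, y, z} : Finset V).erase v) haT ?_
        (fun v hv => hg v (Or.inr hv)) (hN a (Or.inl rfl)) (hg a (Or.inl rfl))
        (by rw [hcT]; decide) ?_ ?_
      · exact fun v hv h => Finset.disjoint_left.1 hdis h (mk_mem_star.2 (Or.inl ⟨rfl, hv⟩))
      · intro v hv u hu h
        refine Finset.mem_erase.2 ⟨(hE.ne (hH hu)).symm, h.resolve_left fun h => ?_⟩
        have := hN v (Or.inr hv) u hu
        omega
      · intro v hv
        rw [Finset.card_erase_of_mem hv, hcT]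
  · have hne : s(a, x) ∉ ({s(y, z)} : Finset (Sym2 V)) := by
      simp only [Finset.mem_singleton, Sym2.eq_iff]
      rintro (⟨h, -⟩ | ⟨h, -⟩)
      · exact hya h.symm
      · exact hza h.symm
    -- When `az` is not an edge, `ay` stays and `yz` is removed instead. The end at `z` used when
    -- `yz` returns is not missed at `a`, because `z` is not adjacent to `a`.
    refine ⟨{s(a, x), s(y, z)}, ?_, ?_, ?_, ?_⟩
    · intro e he
      rcases Finset.mem_insert.1 he with rfl | he
      · exact hx
      · rw [Finset.mem_singleton.1 he]; exact ht.yz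
    · intro e he u hu
      simp only [Finset.mem_insert, Finset.mem_singleton] at he
      rcases he with rfl | rfl <;> rcases Sym2.mem_iff.1 hu with rfl | rfl <;> simp
    · intro u hu
      rw [deg_insert hne, deg_singleton]
      simp only [Finset.mem_insert, Finset.mem_singleton, Sym2.mem_iff] at hu ⊢
      rcases hu with rfl | rfl | rfl | rfl
      · simp [hya.symm, hza.symm]
      · simp [nxy, nxz]
      · simp [nxy.symm, hya]
      · simp [nxz.symm, hza]
    · intro H k g hH hdis hg hN hD
      have hyzH : s(y, z) ∉ H := fun h => Finset.disjoint_left.1 hdis h (by simp)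
      have haxH : s(a, x) ∉ H := fun h => Finset.disjoint_left.1 hdis h (by simp)
      have h1 := hD.add (a := y) (x := z) (Z := ∅) (g' := fun u => if u = z then 0 else g u)
        nyz.symm hyzH ?_ ?_ ?_
      · have h2 := h1.add (a := a) (x := x) (Z := ∅) (g' := fun u => if u = a then 2 else
          if u ∈ ({x, y, z} : Finset V) then 0 else g u) hxa ?_ ?_ ?_ ?_
        · rwa [show insert s(a, x) (insert s(y, z) H) = H ∪ {s(a, x), s(y, z)} by
            rw [Finset.union_insert, Finset.union_singleton]] at h2
        · intro h
          rcases Finset.mem_insert.1 h with h | h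
          · exact hne (by simp [h])
          · exact haxH h
        · intro u hu h0
          exfalso
          rcases Finset.mem_insert.1 hu with hu | hu
          · rcases Sym2.eq_iff.1 hu with h | h
            · exact hya h.1.symm
            · exact hza h.1.symm
          · by_cases huz : u = z
            · exact hz (huz ▸ hH hu)
            · rw [if_neg huz] at h0
              have := hN a (Or.inl rfl) u hu
              omega
        · rw [if_neg nxz, Finset.card_empty]
          exact hg x (by simp)
        · intro u
          by_cases h3 : u = a
          · subst h3
            have := hg u (Or.inl rfl)
            simp only [if_true, hza.symm, hxa.symm, if_false]
            omega
          · by_cases h4 : u ∈ ({x, y, z} : Finset V)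
            · simp [h3, h4]
            · have h5 := h4
              simp only [Finset.mem_insert, Finset.mem_singleton, not_or] at h5
              simp [h3, h5]
      · intro u hu h0
        have := hN y (by simp) u hu
        omega
      · rw [Finset.card_empty]; exact hg z (by simp)
      · intro u
        by_cases h : u = z
        · simp [h]
        · simp [h]

/-- The possible neighbourhoods of an odd vertex that remain. -/
def Attached (E : Finset (Sym2 V)) (w : V) : Prop :=
  ∀ u ∈ evenNbrs E w, ∃ x y z, IsTri E x y z ∧ evenNbrs E w ⊆ {x, y, z} ∧
    s(w, x) ∈ E ∧ s(w, y) ∈ E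

/-- The case in which `b` has no even neighbours is included, with `T` and `M` empty; then the
parity of `b` is not changed, and `Odd (deg M u)` is therefore claimed only on `T`. -/
lemma Attached.exists_attachment {b : V} (hb : Attached E b) (hE : Tame E U)
    (hbo : Odd (deg E b)) :
    ∃ T : Finset V, ∃ M ⊆ E, evenNbrs E b ⊆ T ∧ (∀ u ∈ T, Even (deg E u) ∧ evenNbrs E u ⊆ T) ∧
      (∀ u ∈ T, ∃ v ∈ evenNbrs E b, v = u ∨ v ∈ evenNbrs E u) ∧
      (∀ e ∈ M, ∀ u ∈ e, u = b ∨ u ∈ T) ∧ (∀ u ∈ T, Odd (deg M u)) ∧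
      ∀ (H : Finset (Sym2 V)) (k : ℕ) (g : V → ℕ), H ⊆ E → Disjoint H M →
        (∀ u, u = b ∨ u ∈ T → 1 ≤ g u) → (∀ u, u = b ∨ u ∈ T → ∀ v, s(u, v) ∈ H → 1 ≤ g v) →
        DecGE H k g → DecGE (H ∪ M) k 0 := by
  rcases (evenNbrs E b).eq_empty_or_nonempty with h0 | ⟨u, hu⟩
  · refine ⟨∅, ∅, by simp, by simp [h0], by simp, by simp, by simp, by simp, ?_⟩
    intro H k g _ _ _ _ hD
    rw [Finset.union_empty]
    exact hD.mono (by simp)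
  · obtain ⟨x, y, z, ht, hsub, hx, hy⟩ := hb u hu
    obtain ⟨M, hM, hin, hodd, hre⟩ := hE.exists_attachment hbo ht hx hy
    have hxb : x ∈ evenNbrs E b := mem_evenNbrs.2 ⟨hx, ht.even_x⟩
    refine ⟨{x, y, z}, M, hM, hsub, ?_, ?_, hin, fun u hu => hodd u (Or.inr hu), ?_⟩
    · intro u hu
      simp only [Finset.mem_insert, Finset.mem_singleton] at hu
      rcases hu with rfl | rfl | rfl
      · exact ⟨ht.even_x, fun v hv => by simp [ht.nx v hv]⟩
      · exact ⟨ht.even_y, fun v hv => by rcases ht.ny v hv with rfl | rfl <;> simp⟩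
      · exact ⟨ht.even_z, fun v hv => by rcases ht.nz v hv with rfl | rfl <;> simp⟩
    · intro u hu
      simp only [Finset.mem_insert, Finset.mem_singleton] at hu
      refine ⟨x, hxb, ?_⟩
      rcases hu with rfl | rfl | rfl
      · exact Or.inl rfl
      · exact Or.inr (mem_evenNbrs.2 ⟨swap_mem ht.xy, ht.even_x⟩)
      · exact Or.inr (mem_evenNbrs.2 ⟨swap_mem ht.xz, ht.even_x⟩)
    · intro H k g hH hdis hg hN hD
      exact (hre H k g hH hdis hg hN hD).mono (by simp)

/-- Some edge leaves the set of all vertices in a triangle or adjacent to it. -/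
lemma Tame.decomposable_of_exit (hE : Tame E U) (ih : IH E) {a b x y z : V}
    (ha : Odd (deg E a)) (hb : Odd (deg E b)) (hab : s(a, b) ∈ E) (ht : IsTri E x y z)
    (hax : s(a, x) ∈ E) (hay : s(a, y) ∈ E) (haT : evenNbrs E a ⊆ {x, y, z})
    (hbT : ¬ Touches E x y z b) (hbA : Attached E b) : Decomposable E U := by
  obtain ⟨M₁, hM₁, hin₁, hodd₁, hre₁⟩ := hE.exists_attachment ha ht hax hay
  obtain ⟨T', M₂, hM₂, hbT', hT', hTb, hin₂, hodd₂, hre₂⟩ := hbA.exists_attachment hE hb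
  have nab := hE.ne hab
  set T : Finset V := {x, y, z} with hTdef
  have hT : ∀ u ∈ T, Even (deg E u) ∧ (∀ v ∈ evenNbrs E u, v ∈ T) ∧ s(b, u) ∉ E := by
    intro u hu
    simp only [hTdef, Finset.mem_insert, Finset.mem_singleton] at hu
    rcases hu with rfl | rfl | rfl
    · exact ⟨ht.even_x, fun v hv => by rcases ht.nx v hv with rfl | rfl <;> simp [hTdef],
        fun h => hbT (Or.inl h)⟩
    · exact ⟨ht.even_y, fun v hv => by rcases ht.ny v hv with rfl | rfl <;> simp [hTdef],
        fun h => hbT (Or.inr (Or.inl h))⟩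
    · exact ⟨ht.even_z, fun v hv => by rcases ht.nz v hv with rfl | rfl <;> simp [hTdef],
        fun h => hbT (Or.inr (Or.inr h))⟩
  have haT₀ : a ∉ T := fun h => not_odd_of_even (hT a h).1 ha
  have hbT₀ : b ∉ T := fun h => not_odd_of_even (hT b h).1 hb
  have haT' : a ∉ T' := fun h => not_odd_of_even (hT' a h).1 ha
  have hbT'₀ : b ∉ T' := fun h => not_odd_of_even (hT' b h).1 hb
  have hTT' : ∀ u ∈ T, u ∉ T' := by
    intro u hu hu'
    obtain ⟨v, hv, hvu⟩ := hTb u hu'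
    have hvT : v ∈ T := by
      rcases hvu with rfl | h
      · exact hu
      · exact (hT u hu).2.1 v h
    exact (hT v hvT).2.2 (mem_evenNbrs.1 hv).1
  have hnot₁ : ∀ u, u = b ∨ u ∈ T' → ∀ e ∈ M₁, u ∉ e := by
    intro u hu e he hue
    rcases hin₁ e he u hue with h | h <;> rcases hu with h' | h'
    · exact nab (h.symm.trans h')
    · exact haT' (h ▸ h')
    · exact hbT₀ (h' ▸ h)
    · exact hTT' u h h'
  have hnot₂ : ∀ u, u = a ∨ u ∈ T → ∀ e ∈ M₂, u ∉ e := by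
    intro u hu e he hue
    rcases hin₂ e he u hue with h | h <;> rcases hu with h' | h'
    · exact nab (h'.symm.trans h)
    · exact hbT₀ (h ▸ h')
    · exact haT' (h' ▸ h)
    · exact hTT' u h' h
  have hab₁ : s(a, b) ∉ M₁ := fun h => hnot₁ b (Or.inl rfl) _ h (by simp)
  have hab₂ : s(a, b) ∉ M₂ := fun h => hnot₂ a (Or.inl rfl) _ h (by simp)
  have h12 : Disjoint M₁ M₂ := by
    rw [Finset.disjoint_left]
    intro e h1 h2
    induction e using Sym2.ind with
    | _ p q => exact hnot₂ p (hin₁ _ h1 p (by simp)) _ h2 (by simp)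
  set M := insert s(a, b) (M₁ ∪ M₂) with hM
  have hsub : M ⊆ E := Finset.insert_subset hab (Finset.union_subset hM₁ hM₂)
  have hdegM : ∀ u, deg M u = deg M₁ u + deg M₂ u + if u = a ∨ u = b then 1 else 0 := by
    intro u
    rw [hM, deg_insert, deg_union h12]
    · simp only [Sym2.mem_iff]
    · rw [Finset.mem_union]; exact fun h => h.elim hab₁ hab₂
  have hevt : ∀ u, u ∈ T ∨ u ∈ T' → Even (deg E u) := by
    rintro u (h | h)
    · exact (hT u h).1
    · exact (hT' u h).1
  have hoddT : ∀ u, u ∈ T ∨ u ∈ T' → Odd (deg (E \ M) u) := by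
    intro u hu
    refine odd_sdiff_of_odd_deg hsub (hevt u hu) ?_
    have hua : u ≠ a := fun h => not_odd_of_even (hevt u hu) (h ▸ ha)
    have hub : u ≠ b := fun h => not_odd_of_even (hevt u hu) (h ▸ hb)
    rw [hdegM, if_neg (by simp [hua, hub]), add_zero]
    rcases hu with hu | hu
    · rw [deg_eq_zero_iff.2 (hnot₂ u (Or.inr hu)), add_zero]
      exact hodd₁ u (Or.inr hu)
    · rw [deg_eq_zero_iff.2 (hnot₁ u (Or.inr hu)), zero_add]
      exact hodd₂ u hu
  -- The attachment and the edge `ab` together remove an even number of edges at `a`. In contrast,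
  -- `b` becomes even if it has no even neighbours.
  have hoddA : Odd (deg (E \ M) a) := by
    refine odd_sdiff_of_even_deg hsub ha ?_
    rw [hdegM, if_pos (Or.inl rfl), deg_eq_zero_iff.2 (hnot₂ a (Or.inl rfl)), add_zero,
      Nat.even_add_one, Nat.not_even_iff_odd]
    exact hodd₁ a (Or.inl rfl)
  have htouch : ∀ u, (∃ e ∈ M, u ∈ e) → u = a ∨ u = b ∨ u ∈ T ∨ u ∈ T' := by
    rintro u ⟨e, he, hu⟩
    simp only [hM, Finset.mem_insert, Finset.mem_union] at he
    rcases he with rfl | he | he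
    · rcases Sym2.mem_iff.1 hu with h | h <;> simp [h]
    · rcases hin₁ e he u hu with h | h <;> simp [h]
    · rcases hin₂ e he u hu with h | h <;> simp [h]
  have hgo : ∀ u, u ≠ b → Odd (deg E u) → Odd (deg (E \ M) u) := by
    intro u hub hu
    by_cases h : ∃ e ∈ M, u ∈ e
    · rcases htouch u h with rfl | rfl | h'
      · exact hoddA
      · exact absurd rfl hub
      · exact absurd hu (not_odd_of_even (hevt u h'))
    · exact odd_sdiff_of_untouched h hu
  have hnbr : ∀ u, u = a ∨ u = b ∨ u ∈ T ∨ u ∈ T' → ∀ v, s(u, v) ∈ E → Even (deg E v) →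
      v ∈ T ∨ v ∈ T' := by
    intro u hu v huv hv
    have hv' := mem_evenNbrs.2 ⟨huv, hv⟩
    rcases hu with rfl | rfl | hu | hu
    · exact Or.inl (haT hv')
    · exact Or.inr (hbT' hv')
    · exact Or.inl ((hT u hu).2.1 v hv')
    · exact Or.inr ((hT' u hu).2 hv')
  have hnbrH : ∀ u, u = a ∨ u = b ∨ u ∈ T ∨ u ∈ T' → ∀ v, s(u, v) ∈ E → v ≠ b →
      Odd (deg (E \ M) v) := by
    intro u hu v huv hvb
    rcases Nat.even_or_odd (deg E v) with h | h
    · exact hoddT v (hnbr u hu v huv h)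
    · exact hgo v hvb h
  have habM : s(a, b) ∈ M := by simp [hM]
  obtain ⟨k, hk, hD⟩ := exists_decGE_sdiff hE.toAdmissible ih hE.two hsub ⟨_, habM⟩ (by
    intro v hv hv' u hu
    have huE := mem_of_mem_sdiff hu
    rcases htouch v hv with rfl | rfl | h
    · refine hnbrH v (by simp) u huE ?_
      rintro rfl
      exact (Finset.mem_sdiff.1 hu).2 habM
    · exact hnbrH v (by simp) u huE (hE.ne huE).symm
    · rcases hv' with hv' | hv'
      · exact absurd hv' (not_odd_of_even (hevt v h))
      · exact absurd (hoddT v h) (not_odd_of_even hv'))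
  have hd1 : Disjoint (E \ M) M₁ := by
    rw [Finset.disjoint_left]
    exact fun e he he' => (Finset.mem_sdiff.1 he).2 (by simp [hM, he'])
  have h1 := hre₁ (E \ M) k _ Finset.sdiff_subset hd1 ?_ ?_ hD
  -- The first attachment leaves two ends at `a`. One of them pays for `ab`, and this provides the
  -- end at `b` that the second attachment needs, whatever the parity of `b`.
  · have h2 := h1.add (a := b) (x := a) (Z := ∅) (g' := fun u => if u = b then 1 else
      if u = a then 1 else if u ∈ T then 0 else deg (E \ M) u % 2) nab ?_ ?_ ?_ ?_
    · have hH : insert s(b, a) (E \ M ∪ M₁) ⊆ E := Finset.insert_subset (swap_mem hab)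
        (Finset.union_subset Finset.sdiff_subset hM₁)
      have h3 := hre₂ _ k _ hH ?_ ?_ ?_ h2
      · rw [show insert s(b, a) (E \ M ∪ M₁) ∪ M₂ = E \ M ∪ M by
          rw [hM, Sym2.eq_swap, Finset.insert_union, Finset.union_insert, Finset.union_assoc],
          Finset.sdiff_union_of_subset hsub] at h3
        exact .of_decGE hk h3
      · rw [Finset.disjoint_insert_left, Finset.disjoint_union_left]
        refine ⟨by rw [Sym2.eq_swap]; exact hab₂, ?_, h12⟩
        rw [Finset.disjoint_left]
        exact fun e he he' => (Finset.mem_sdiff.1 he).2 (by simp [hM, he'])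
      · rintro u (rfl | hu)
        · simp
        · split_ifs with h4 h5 h6
          · exact le_rfl
          · exact le_rfl
          · exact absurd hu (hTT' u h6)
          · exact one_le_mod_two (hoddT u (Or.inr hu))
      · intro u hu v huv
        have huvE := hH huv
        split_ifs with h4 h5 h6
        · exact le_rfl
        · exact le_rfl
        · exfalso
          rcases hu with rfl | hu
          · exact (hT v h6).2.2 huvE
          · exact hTT' u ((hT v h6).2.1 u
              (mem_evenNbrs.2 ⟨swap_mem huvE, (hT' u hu).1⟩)) hu
        · exact one_le_mod_two (hnbrH u (by tauto) v huvE h4)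
    · intro h
      rw [Sym2.eq_swap] at h
      rcases Finset.mem_union.1 h with h | h
      · exact (Finset.mem_sdiff.1 h).2 habM
      · exact hab₁ h
    · intro v hv h0
      exfalso
      have hvE : s(b, v) ∈ E := (Finset.union_subset Finset.sdiff_subset hM₁) hv
      split_ifs at h0 with h4 h5
      · exact (hT v h5).2.2 hvE
      · exact not_odd_of_even (Nat.even_iff.2 h0) (hnbrH b (by simp) v hvE (hE.ne hvE).symm)
    · simp
    · intro u
      by_cases h4 : u = b
      · subst h4; simp [nab.symm]
      · by_cases h5 : u = a
        · subst h5; simp [h4]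
        · simp [h4, h5]
  · rintro u (rfl | hu)
    · exact one_le_mod_two hoddA
    · exact one_le_mod_two (hoddT u (Or.inl hu))
  · intro u hu v huv
    refine one_le_mod_two (hnbrH u (by tauto) v (mem_of_mem_sdiff huv) ?_)
    rintro rfl
    rcases hu with rfl | hu
    · exact (Finset.mem_sdiff.1 huv).2 habM
    · exact (hT u hu).2.2 (swap_mem (mem_of_mem_sdiff huv))

end

/-! ### Excluding even vertices on edges. -/

section

variable {V : Type*} [DecidableEq V] {E M : Finset (Sym2 V)} {U : Finset V}

lemma card_sdiff_pair {S : Finset V} {y z : V} (hyz : y ≠ z) :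
    (S \ {y, z}).card + (if y ∈ S then 1 else 0) + (if z ∈ S then 1 else 0) = S.card := by
  rw [show S \ {y, z} = (S.erase z).erase y by ext; simp; tauto]
  by_cases hy : y ∈ S <;> by_cases hz : z ∈ S
  · have h1 := Finset.card_erase_add_one hz
    have h2 := Finset.card_erase_add_one (Finset.mem_erase.2 ⟨hyz, hy⟩)
    simp only [hy, hz, if_true]; omega
  · have h2 := Finset.card_erase_add_one hy
    rw [Finset.erase_eq_of_notMem hz]
    simp only [hy, hz, if_true, if_false]; omega
  · have h1 := Finset.card_erase_add_one hz
    rw [Finset.erase_eq_of_notMem (fun h => hy (Finset.mem_of_mem_erase h))]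
    simp only [hy, hz, if_true, if_false]; omega
  · rw [Finset.erase_eq_of_notMem hz, Finset.erase_eq_of_notMem hy]
    simp [hy, hz]

/-- No even neighbour is isolated in the E-subgraph, and by parity exactly one of the other two
vertices of its triangle is adjacent to `w`. Two such triangles are excluded by
`Tame.decomposable_of_two_triangles`. -/
lemma Tame.attached_of_even (hE : Tame E U) (ih : IH E) (hn : ¬ Decomposable E U) {w : V}
    (hw : Odd (deg E w)) (hev : Even (evenNbrs E w).card) : Attached E w := by
  have key : ∀ x ∈ evenNbrs E w, ∃ y z, IsTri E x y z ∧ y ∈ evenNbrs E w ∧ z ∉ evenNbrs E w := by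
    intro x hx
    rcases (evenNbrs E x).eq_empty_or_nonempty with h0 | ⟨y, hy⟩
    · exact absurd (hE.decomposable_of_isolated_evenNbr ih hw hx h0 hev) hn
    obtain ⟨z, ht⟩ := hE.tri x y (mem_evenNbrs.1 hx).2 hy
    have h1 : ¬ Even (evenNbrs E w \ {y, z}).card :=
      fun h => hn (hE.decomposable_of_even_card_sdiff ih hw ht hx h)
    have h2 := card_sdiff_pair (S := evenNbrs E w) (hE.ne ht.yz)
    rw [Nat.even_iff] at h1 hev
    by_cases h3 : y ∈ evenNbrs E w <;> by_cases h4 : z ∈ evenNbrs E w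
    · rw [if_pos h3, if_pos h4] at h2; omega
    · exact ⟨y, z, ht, h3, h4⟩
    · exact ⟨z, y, ht.swap_yz, h4, h3⟩
    · rw [if_neg h3, if_neg h4] at h2; omega
  intro x hx
  obtain ⟨y, z, ht, hy, hz⟩ := key x hx
  refine ⟨x, y, z, ht, ?_, (mem_evenNbrs.1 hx).1, (mem_evenNbrs.1 hy).1⟩
  intro x' hx'
  by_contra hcon
  simp only [Finset.mem_insert, Finset.mem_singleton, not_or] at hcon
  obtain ⟨y', z', ht', hy', hz'⟩ := key x' hx'
  exact hn (hE.decomposable_of_two_triangles ih hw ht ht' hx hy hz hx' hy' hz' hcon.1 hcon.2.1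
    hev)

/-- By parity, each triangle that meets the even neighbours of `w` meets them in one or three
vertices. At most one even neighbour has no even neighbour adjacent to `w`, so nearly all come in
full triangles. Two full triangles give six vertices, hence seven by parity, and
`Tame.decomposable_of_many_triangles` applies. -/
lemma Tame.attached_of_odd (hE : Tame E U) (ih : IH E) (hn : ¬ Decomposable E U) {w : V}
    (hw : Odd (deg E w)) (hodd : Odd (evenNbrs E w).card) : Attached E w := by
  have key : ∀ x ∈ evenNbrs E w, ∀ y ∈ evenNbrs E x, y ∈ evenNbrs E w →
      ∃ y ∈ evenNbrs E w, ∃ z ∈ evenNbrs E w, IsTri E x y z := by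
    intro x hx y hy hyS
    obtain ⟨z, ht⟩ := hE.tri x y (mem_evenNbrs.1 hx).2 hy
    refine ⟨y, hyS, z, ?_, ht⟩
    by_contra hz
    have h1 : ¬ Even (evenNbrs E w \ {y, z}).card :=
      fun h => hn (hE.decomposable_of_even_card_sdiff ih hw ht hx h)
    have h2 := card_sdiff_pair (S := evenNbrs E w) (hE.ne ht.yz)
    rw [if_pos hyS, if_neg hz] at h2
    rw [Nat.even_iff] at h1
    rw [Nat.odd_iff] at hodd
    omega
  have htwo : ∀ x ∈ evenNbrs E w, ∀ x' ∈ evenNbrs E w, x ≠ x' →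
      (∀ u ∈ evenNbrs E x, u ∉ evenNbrs E w) → (∀ u ∈ evenNbrs E x', u ∉ evenNbrs E w) → False :=
    fun x hx x' hx' h h1 h2 => hn (hE.decomposable_of_two_good ih hw hx hx' h h1 h2 hodd)
  have hpick : ∀ R ⊆ evenNbrs E w, 1 < R.card →
      ∃ x ∈ R, ∃ y ∈ evenNbrs E w, ∃ z ∈ evenNbrs E w, IsTri E x y z := by
    intro R hR hc
    obtain ⟨x, hx, x', hx', hne⟩ := Finset.one_lt_card.1 hc
    by_contra! h
    refine htwo x (hR hx) x' (hR hx') hne ?_ ?_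
    · intro u hu huS
      obtain ⟨y, hy, z, hz, ht⟩ := key x (hR hx) u hu huS
      exact h x hx y hy z hz ht
    · intro u hu huS
      obtain ⟨y, hy, z, hz, ht⟩ := key x' (hR hx') u hu huS
      exact h x' hx' y hy z hz ht
  obtain ⟨m, hm⟩ := hodd
  have hc1 : 1 < (evenNbrs E w).card := by
    by_contra h
    exact hn (hE.decomposable_of_one_evenNbr ih hw (by omega))
  obtain ⟨x, hx, y, hy, z, hz, ht⟩ := hpick _ (Finset.Subset.refl _) hc1
  intro _ _
  refine ⟨x, y, z, ht, ?_, (mem_evenNbrs.1 hx).1, (mem_evenNbrs.1 hy).1⟩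
  by_contra hsub
  have hTS : ({x, y, z} : Finset V) ⊆ evenNbrs E w := by
    simp [Finset.insert_subset_iff, hx, hy, hz]
  have hcT : ∀ {x y z}, IsTri E x y z → ({x, y, z} : Finset V).card = 3 := fun ht =>
    Finset.card_eq_three.2 ⟨_, _, _, hE.ne ht.xy, hE.ne ht.xz, hE.ne ht.yz, rfl⟩
  have h1 := Finset.card_sdiff_add_card_eq_card hTS
  rw [hcT ht] at h1
  have h2 : 0 < (evenNbrs E w \ {x, y, z}).card := Finset.card_pos.2 (Finset.sdiff_nonempty.2 hsub)
  obtain ⟨x', hx', y', hy', z', hz', ht'⟩ := hpick _ Finset.sdiff_subset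
    (by omega : 1 < (evenNbrs E w \ {x, y, z}).card)
  obtain ⟨hx'S, hx'T⟩ := Finset.mem_sdiff.1 hx'
  have hdis : Disjoint ({x, y, z} : Finset V) {x', y', z'} := by
    rw [Finset.disjoint_left]
    intro u hu hu'
    simp only [Finset.mem_insert, Finset.mem_singleton] at hu hu'
    have h3 : u = x' ∨ x' ∈ evenNbrs E u := by
      rcases hu' with rfl | rfl | rfl
      · exact Or.inl rfl
      · exact Or.inr (mem_evenNbrs.2 ⟨swap_mem ht'.xy, ht'.even_x⟩)
      · exact Or.inr (mem_evenNbrs.2 ⟨swap_mem ht'.xz, ht'.even_x⟩)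
    apply hx'T
    simp only [Finset.mem_insert, Finset.mem_singleton]
    rcases h3 with rfl | h3
    · exact hu
    · rcases hu with rfl | rfl | rfl
      · rcases ht.nx x' h3 with h | h <;> simp [h]
      · rcases ht.ny x' h3 with h | h <;> simp [h]
      · rcases ht.nz x' h3 with h | h <;> simp [h]
  have h3 := Finset.card_le_card (Finset.union_subset hTS
    (by simp [Finset.insert_subset_iff, hx'S, hy', hz'] : ({x', y', z'} : Finset V) ⊆ _))
  rw [Finset.card_union_of_disjoint hdis, hcT ht, hcT ht'] at h3
  by_cases hg : ∃ o ∈ evenNbrs E w, ∀ u ∈ evenNbrs E o, u ∉ evenNbrs E w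
  · obtain ⟨o, ho, hgo⟩ := hg
    refine hn (hE.decomposable_of_many_triangles ih hw (o := o) ⟨m, hm⟩ (by omega) ?_)
    intro v hv hvo
    by_contra hcon
    exact htwo v hv o ho hvo (fun u hu huS => hcon (key v hv u hu huS)) hgo
  · push Not at hg
    refine hn (hE.decomposable_of_many_triangles ih hw (o := w) ⟨m, hm⟩ (by omega) ?_)
    intro v hv _
    obtain ⟨u, hu, huS⟩ := hg v hv
    exact key v hv u hu huS

lemma Tame.attached (hE : Tame E U) (ih : IH E) (hn : ¬ Decomposable E U) {w : V}
    (hw : Odd (deg E w)) : Attached E w :=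
  (Nat.even_or_odd (evenNbrs E w).card).elim (hE.attached_of_even ih hn hw)
    (hE.attached_of_odd ih hn hw)

lemma IsTri.subset {x y z p q r u : V} (ht : IsTri E x y z) (ht' : IsTri E p q r)
    (hu : u ∈ ({x, y, z} : Finset V)) (hu' : u ∈ ({p, q, r} : Finset V)) :
    ({p, q, r} : Finset V) ⊆ {x, y, z} := by
  intro t hmem
  have h : t = u ∨ t ∈ evenNbrs E u := by
    simp only [Finset.mem_insert, Finset.mem_singleton] at hu' hmem
    rcases hu' with rfl | rfl | rfl <;> rcases hmem with rfl | rfl | rfl <;>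
      simp [mem_evenNbrs, ht'.even_x, ht'.even_y, ht'.even_z, ht'.xy, ht'.yz, ht'.xz,
        swap_mem ht'.xy, swap_mem ht'.yz, swap_mem ht'.xz]
  rcases h with rfl | h
  · exact hu
  · simp only [Finset.mem_insert, Finset.mem_singleton] at hu ⊢
    rcases hu with rfl | rfl | rfl
    · rcases ht.nx t h with rfl | rfl <;> simp
    · rcases ht.ny t h with rfl | rfl <;> simp
    · rcases ht.nz t h with rfl | rfl <;> simp

/-- An even vertex on an edge leads to a triangle, directly or through an odd neighbour. Odd
vertices touching it are attached to it and to no other triangle, and no edge leaves from them to a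
vertex not touching it, by `Tame.decomposable_of_exit`. So its component is a SET graph, which is
excluded. -/
lemma Tame.decomposable_of_even (hE : Tame E U) (ih : IH E) {v u : V} (hv : Even (deg E v))
    (hvu : s(v, u) ∈ E) : Decomposable E U := by
  by_contra hn
  have hatt : ∀ w, Odd (deg E w) → Attached E w := fun w hw => hE.attached ih hn hw
  obtain ⟨x, y, z, ht⟩ : ∃ x y z, IsTri E x y z := by
    rcases Nat.even_or_odd (deg E u) with hu | hu
    · obtain ⟨z, ht⟩ := hE.tri v u hv (mem_evenNbrs.2 ⟨hvu, hu⟩)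
      exact ⟨v, u, z, ht⟩
    · obtain ⟨x, y, z, ht, -⟩ := hatt u hu v (mem_evenNbrs.2 ⟨swap_mem hvu, hv⟩)
      exact ⟨x, y, z, ht⟩
  have hodd : ∀ v, v ≠ x → v ≠ y → v ≠ z → Touches E x y z v → Odd (deg E v) := by
    intro v hx hy hz hv
    by_contra hev
    rw [Nat.not_odd_iff_even] at hev
    rcases hv with h | h | h
    · have := ht.nx v (mem_evenNbrs.2 ⟨swap_mem h, hev⟩); tauto
    · have := ht.ny v (mem_evenNbrs.2 ⟨swap_mem h, hev⟩); tauto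
    · have := ht.nz v (mem_evenNbrs.2 ⟨swap_mem h, hev⟩); tauto
  have hnbr : ∀ v, v ≠ x → v ≠ y → v ≠ z → Touches E x y z v → ∃ p q r, IsTri E p q r ∧
      ({p, q, r} : Finset V) ⊆ {x, y, z} ∧ evenNbrs E v ⊆ {p, q, r} ∧ s(v, p) ∈ E ∧
      s(v, q) ∈ E := by
    intro v hx hy hz hv
    have hvo := hodd v hx hy hz hv
    obtain ⟨u, hu, huv⟩ : ∃ u ∈ ({x, y, z} : Finset V), u ∈ evenNbrs E v := by
      rcases hv with h | h | h
      · exact ⟨x, by simp, mem_evenNbrs.2 ⟨h, ht.even_x⟩⟩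
      · exact ⟨y, by simp, mem_evenNbrs.2 ⟨h, ht.even_y⟩⟩
      · exact ⟨z, by simp, mem_evenNbrs.2 ⟨h, ht.even_z⟩⟩
    obtain ⟨p, q, r, ht', hsub, hp, hq⟩ := hatt v hvo u huv
    exact ⟨p, q, r, ht', ht.subset ht' hu (hsub huv), hsub, hp, hq⟩
  refine hE.noSET x y z ⟨ht.xy, ht.yz, ht.xz, ht.even_x, ht.even_y, ht.even_z, hodd, ?_, ?_⟩
  · intro v hx hy hz hv
    obtain ⟨p, q, r, ht', hsub, -, hp, hq⟩ := hnbr v hx hy hz hv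
    have hpq := hE.ne ht'.xy
    have h1 := @hsub p (by simp)
    have h2 := @hsub q (by simp)
    simp only [Finset.mem_insert, Finset.mem_singleton] at h1 h2
    rcases h1 with rfl | rfl | rfl <;> rcases h2 with rfl | rfl | rfl <;> simp_all
  · intro v hx hy hz hv u huv
    by_contra hcon
    push Not at hcon
    obtain ⟨hux, huy, huz, hut⟩ := hcon
    obtain ⟨p, q, r, ht', hsub, hvT, hp, hq⟩ := hnbr v hx hy hz hv
    have huo : Odd (deg E u) := by
      by_contra hev
      have h1 := hsub (hvT (mem_evenNbrs.2 ⟨huv, Nat.not_odd_iff_even.1 hev⟩))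
      simp [hux, huy, huz] at h1
    refine hn (hE.decomposable_of_exit ih (hodd v hx hy hz hv) huo huv ht' hp hq hvT ?_
      (hatt u huo))
    have h1 : ∀ t ∈ ({x, y, z} : Finset V), s(u, t) ∉ E := by
      intro t hmem hut'
      simp only [Finset.mem_insert, Finset.mem_singleton] at hmem
      rcases hmem with rfl | rfl | rfl
      · exact hut (Or.inl hut')
      · exact hut (Or.inr (Or.inl hut'))
      · exact hut (Or.inr (Or.inr hut'))
    rintro (h | h | h)
    · exact h1 p (hsub (by simp)) h
    · exact h1 q (hsub (by simp)) h
    · exact h1 r (hsub (by simp)) h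

end

/-! ### All degrees odd, and the induction. -/

section

variable {V : Type*} [DecidableEq V] {E M : Finset (Sym2 V)} {U : Finset V}

/-- A pendant edge can be removed from the path that contains it. -/
lemma DecGE.erase_pendant {K : Finset (Sym2 V)} {k : ℕ} {g : V → ℕ} {z u : V}
    (h : DecGE (insert s(z, u) K) k g) (hz : ∀ e ∈ K, z ∉ e) :
    DecGE K k (fun v => g v + (if v = u then 1 else 0) - (if v = z then 1 else 0)) := by
  obtain ⟨p, hp, hg⟩ := h
  have hzK : s(z, u) ∉ K := fun h => hz _ h (by simp)
  have hmem : s(z, u) ∈ ∑ i, pathEdges (p i) := by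
    rw [hp.sum_eq, Finset.mem_val]; simp
  obtain ⟨i₀, -, hi₀⟩ := Multiset.mem_sum.1 hmem
  have hin : ∀ e ∈ pathEdges (p i₀), e ∈ insert s(z, u) K := fun e he => by
    rw [← Finset.mem_val, ← hp.sum_eq]
    exact Multiset.mem_sum.2 ⟨i₀, Finset.mem_univ _, he⟩
  have hnbr : ∀ v, s(z, v) ∈ pathEdges (p i₀) → v = u := fun v hv => by
    rcases Finset.mem_insert.1 (hin _ hv) with h | h
    · rcases Sym2.eq_iff.1 h with h | h
      · exact h.2
      · exact h.2.trans h.1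
    · exact absurd (by simp) (hz _ h)
  have hnd := hp.nodup i₀
  -- Two nonempty arms at `z` would both start with `u`, so `z` is an end of its path.
  obtain ⟨t, ht1, ht2, ht3⟩ : ∃ t, pathEdges (z :: t) = pathEdges (p i₀) ∧
      ends (z :: t) = ends (p i₀) ∧ (z :: t).Nodup := by
    obtain ⟨arms, ha⟩ := exists_arms z (p i₀) (mem_of_mem_pathEdges hi₀ (by simp))
    cases h0 : arms false with
    | nil => exact ⟨arms true, by simp [ha, h0], by simp [ha, h0], by simpa [ha, h0] using hnd⟩
    | cons a l =>
      cases h1 : arms true with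
      | nil =>
        have : p i₀ = (z :: a :: l).reverse := by rw [ha, h0, h1]; simp
        refine ⟨a :: l, ?_, ?_, ?_⟩
        · rw [this, pathEdges_reverse]
        · rw [this, ends_reverse]
        · rw [this] at hnd; exact List.nodup_reverse.1 hnd
      | cons b l' =>
        rw [h0, h1] at ha
        have e1 := pathEdges_reverse_append_cons (a :: l) z (b :: l')
        rw [← ha] at e1
        have hau := hnbr a (by rw [e1]; simp [pathEdges])
        have hbu := hnbr b (by rw [e1]; simp [pathEdges])
        rw [ha, hau, hbu] at hnd
        simp [List.nodup_append] at hnd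
  cases t with
  | nil => rw [← ht1] at hi₀; simp [pathEdges] at hi₀
  | cons a t =>
    have ha := hnbr a (by rw [← ht1]; simp [pathEdges])
    subst ha
    have hsum : ∀ F : List V → Multiset (Sym2 V), ∑ i, F (Function.update p i₀ (a :: t) i) +
        F (p i₀) = ∑ i, F (p i) + F (a :: t) := by
      intro F
      rw [← Finset.add_sum_erase _ _ (Finset.mem_univ i₀),
        ← Finset.add_sum_erase _ (fun i => F (p i)) (Finset.mem_univ i₀), Function.update_self,
        Finset.sum_congr rfl fun i hi => by
          rw [Function.update_of_ne (Finset.ne_of_mem_erase hi)]]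
      abel
    have hsum' : ∀ F : List V → Multiset V, ∑ i, F (Function.update p i₀ (a :: t) i) +
        F (p i₀) = ∑ i, F (p i) + F (a :: t) := by
      intro F
      rw [← Finset.add_sum_erase _ _ (Finset.mem_univ i₀),
        ← Finset.add_sum_erase _ (fun i => F (p i)) (Finset.mem_univ i₀), Function.update_self,
        Finset.sum_congr rfl fun i hi => by
          rw [Function.update_of_ne (Finset.ne_of_mem_erase hi)]]
      abel
    refine ⟨Function.update p i₀ (a :: t), ⟨?_, ?_, ?_⟩, ?_⟩
    · intro i
      by_cases hi : i = i₀
      · subst hi; simp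
      · rw [Function.update_of_ne hi]; exact hp.ne_nil i
    · intro i
      by_cases hi : i = i₀
      · subst hi; simpa using (List.nodup_cons.1 ht3).2
      · rw [Function.update_of_ne hi]; exact hp.nodup i
    · have h1 := hsum pathEdges
      rw [hp.sum_eq, ← ht1, Finset.insert_val_of_notMem hzK] at h1
      simp only [pathEdges, ← Multiset.singleton_add] at h1
      have h2 : ∑ i, pathEdges (Function.update p i₀ (a :: t) i) +
          ({s(z, a)} + pathEdges (a :: t)) = K.val + ({s(z, a)} + pathEdges (a :: t)) := by
        rw [h1]; abel
      exact add_right_cancel h2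
    · intro v
      have h1 := congrArg (Multiset.count v) (hsum' ends)
      rw [← ht2] at h1
      simp only [ends, hd_cons, lst_cons_of_ne_nil z (List.cons_ne_nil a t), Multiset.count_add,
        Multiset.count_singleton] at h1
      have h2 := hg v
      simp only [ends] at h2 ⊢
      omega

lemma decGE_card (hE : ∀ e ∈ E, ¬ e.IsDiag) : DecGE E E.card 0 := by
  have h : ∀ e : E, ∃ l : List V, l ≠ [] ∧ l.Nodup ∧ pathEdges l = {e.1} := by
    rintro ⟨e, he⟩
    have := hE e he
    induction e using Sym2.ind with
    | _ a b => exact ⟨[a, b], by simp, by simpa using this, by simp [pathEdges]⟩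
  choose f h1 h2 h3 using h
  refine ⟨fun i => f (E.equivFin.symm i), ⟨fun i => h1 _, fun i => h2 _, ?_⟩, by simp⟩
  simp only [h3]
  rw [Equiv.sum_comp E.equivFin.symm (fun e => ({e.1} : Multiset (Sym2 V))),
    Finset.sum_coe_sort E (fun e => ({e} : Multiset (Sym2 V))), Finset.sum_multiset_singleton]

lemma sum_deg (hE : ∀ e ∈ E, ¬ e.IsDiag) (hU : ∀ e ∈ E, ∀ v ∈ e, v ∈ U) :
    ∑ v ∈ U, deg E v = 2 * E.card := by
  have h := Finset.sum_card_bipartiteAbove_eq_sum_card_bipartiteBelow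
    (s := U) (t := E) (fun v e => v ∈ e)
  unfold Finset.bipartiteAbove Finset.bipartiteBelow at h
  simp only [deg]
  rw [h, Finset.sum_congr rfl (g := fun _ => 2), Finset.sum_const, smul_eq_mul, mul_comm]
  intro e he
  rw [← Sym2.card_toFinset_of_not_isDiag e (hE e he)]
  congr 1
  ext v
  simp only [Finset.mem_filter, Sym2.mem_toFinset, and_iff_right_iff_imp]
  exact hU e he v

lemma Admissible.decomposable_of_deg_le_one (hE : Admissible E U) (h : ∀ v, deg E v ≤ 1) :
    Decomposable E U := by
  refine .of_decGE ?_ (decGE_card hE.loopless)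
  rw [← sum_deg hE.loopless hE.supp]
  refine (Finset.sum_le_sum fun v _ => h v).trans ?_
  simp

/-- The pendant edge `zu` stands in for `wu` and keeps `u` odd, so that a path ends there. In the
smaller graph `v` is the only even vertex that can lie on an edge. First `vw` returns at `v`, then
`zu` is dropped, and `wu` returns at `w`, where `v` now has an end. -/
lemma Admissible.decomposable_of_forall_odd [Infinite V] (hE : Admissible E U) (ih : IH E)
    (hall : ∀ v u, s(v, u) ∈ E → Odd (deg E v)) {w u v : V} (hu : s(w, u) ∈ E)
    (hv : s(w, v) ∈ E) (huv : u ≠ v) : Decomposable E U := by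
  obtain ⟨z, hz⟩ := Infinite.exists_notMem_finset U
  have nwu := hE.ne hu
  have nwv := hE.ne hv
  have hzE : ∀ e ∈ E, z ∉ e := fun e he hze => hz (hE.supp e he z hze)
  have nzw : z ≠ w := fun h => hzE _ hu (by simp [h])
  have nzu : z ≠ u := fun h => hzE _ hu (by simp [h])
  have nzv : z ≠ v := fun h => hzE _ hv (by simp [h])
  set M : Finset (Sym2 V) := {s(w, u), s(w, v)} with hM
  have hsub : M ⊆ E := by
    intro e he
    rcases Finset.mem_insert.1 he with rfl | he
    · exact hu
    · rw [Finset.mem_singleton.1 he]; exact hv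
  have huvM : s(w, u) ∉ ({s(w, v)} : Finset (Sym2 V)) := by
    simp [huv, nwv]
  set H := insert s(z, u) (E \ M) with hH
  have hzuM : s(z, u) ∉ E \ M := fun h => hzE _ (mem_of_mem_sdiff h) (by simp)
  have hcM : M.card = 2 := by rw [hM, Finset.card_insert_of_notMem huvM, Finset.card_singleton]
  have hcH : H.card < E.card := by
    have := Finset.card_sdiff_add_card_eq_card hsub
    rw [hH, Finset.card_insert_of_notMem hzuM]
    omega
  have hdeg : ∀ t, deg H t + ((if t = w ∨ t = v then 1 else 0) +
      if t = w ∨ t = u then 1 else 0) = deg E t + if t = z ∨ t = u then 1 else 0 := by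
    intro t
    have h1 := deg_sdiff_add hsub t
    have h2 := deg_insert huvM t
    rw [deg_singleton, ← hM] at h2
    rw [hH, deg_insert hzuM]
    simp only [Sym2.mem_iff] at h2 ⊢
    omega
  have hEz : deg E z = 0 := deg_eq_zero_iff.2 hzE
  have hoddH : ∀ t, t ≠ v → t = z ∨ Odd (deg E t) → Odd (deg H t) := by
    intro t htv h
    have h1 := hdeg t
    by_cases h2 : t = z
    · subst h2
      simp only [nzw, nzv, nzu, or_self, if_false, true_or, if_true] at h1
      rw [Nat.odd_iff]; omega
    · have h3 := Nat.odd_iff.1 (h.resolve_left h2)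
      rw [Nat.odd_iff]
      by_cases h4 : t = w
      · subst h4; simp only [true_or, if_true, h2, nwu, or_self, if_false] at h1; omega
      · simp only [h2, htv, h4, or_self, if_false, false_or] at h1
        omega
  have hnbrH : ∀ t s, s(t, s) ∈ H → s = z ∨ Odd (deg E s) := by
    intro t s hts
    rcases Finset.mem_insert.1 hts with h | h
    · rcases Sym2.eq_iff.1 h with ⟨-, rfl⟩ | ⟨-, rfl⟩
      · exact Or.inr (hall s w (swap_mem hu))
      · exact Or.inl rfl
    · exact Or.inr (hall s t (swap_mem (mem_of_mem_sdiff h)))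
  have hevH : ∀ t s, s(t, s) ∈ H → Even (deg H s) → s = v := by
    intro t s hts hs
    by_contra h
    exact not_odd_of_even hs (hoddH s h (hnbrH t s hts))
  have hlH : ∀ e ∈ H, ¬ e.IsDiag := by
    intro e he
    rcases Finset.mem_insert.1 he with rfl | he
    · simpa using nzu
    · exact hE.loopless e (mem_of_mem_sdiff he)
  set W := U.filter (fun t => Odd (deg E t)) with hW
  have hWev : Even W.card := by
    rw [hW, ← Finset.even_sum_iff_even_card_odd, sum_deg hE.loopless hE.supp]
    exact even_two_mul _
  have hsupp : ∀ e ∈ H, ∀ t ∈ e, t ∈ insert z W := by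
    have h1 : ∀ t s, s(t, s) ∈ E → t ∈ insert z W := fun t s hts =>
      Finset.mem_insert_of_mem (Finset.mem_filter.2 ⟨hE.supp _ hts t (by simp), hall t s hts⟩)
    intro e he t hte
    rcases Finset.mem_insert.1 he with rfl | he
    · rcases Sym2.mem_iff.1 hte with rfl | rfl
      · simp
      · exact h1 t w (swap_mem hu)
    · obtain ⟨s, rfl⟩ := Sym2.mem_iff_exists.1 hte
      exact h1 t s (mem_of_mem_sdiff he)
  have hadm : Admissible H (insert z W) := by
    refine ⟨hlH, hsupp, ?_, ?_⟩
    · intro t _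
      refine (Finset.card_le_one.2 ?_).trans (by norm_num)
      intro a ha b hb
      rw [mem_evenNbrs] at ha hb
      rw [hevH _ _ ha.1 ha.2, hevH _ _ hb.1 hb.2]
    · intro x y z' hs
      have h1 := hevH _ _ hs.xy hs.even_y
      have h2 := hevH _ _ (swap_mem hs.xy) hs.even_x
      exact hlH _ hs.xy (by rw [h1, h2]; simp)
  obtain ⟨k, hk, hD⟩ := ih H _ hcH hadm
  -- The new vertex costs nothing: `2 * k ≤ |W| + 1` with `|W|` even gives `2 * k ≤ |W|`.
  have hk' : 2 * k ≤ U.card := by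
    have h1 := Finset.card_insert_le z W
    have h2 := Finset.card_filter_le U (fun t => Odd (deg E t))
    obtain ⟨m, hm⟩ := hWev
    rw [← hW] at h2
    omega
  have hg : ∀ t s, s(t, s) ∈ H → s ≠ v → deg H s % 2 = 1 := fun t s hts hsv =>
    Nat.odd_iff.1 (hoddH s hsv (hnbrH t s hts))
  have hvwH : s(v, w) ∉ H := by
    intro h
    rcases Finset.mem_insert.1 h with h | h
    · rcases Sym2.eq_iff.1 h with h | h
      · exact nzv h.1.symm
      · exact nzw h.2.symm
    · exact (Finset.mem_sdiff.1 h).2 (by rw [Sym2.eq_swap]; simp [hM])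
  have hwodd : deg H w % 2 = 1 := Nat.odd_iff.1 (hoddH w nwv (Or.inr (hall w u hu)))
  have huodd : deg H u % 2 = 1 := Nat.odd_iff.1 (hoddH u huv (Or.inr (hall u w (swap_mem hu))))
  have h1 := hD.add (a := v) (x := w) (Z := ∅) (g' := fun t => if t = v then 1 else
    if t = w then 0 else deg H t % 2) nwv hvwH ?_ (by simp [hwodd]) ?_
  · have hins : insert s(v, w) H = insert s(z, u) (E.erase s(w, u)) := by
      ext e
      simp only [hH, hM, Finset.mem_insert, Finset.mem_sdiff, Finset.mem_singleton,
        Finset.mem_erase, Sym2.eq_swap (a := v)]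
      by_cases h : e = s(w, v)
      · subst h; simp [hv, huv.symm, nwu, nwv.symm]
      · simp only [h, false_or, or_false]; tauto
    rw [hins] at h1
    have h2 := h1.erase_pendant (fun e he => hzE e (Finset.mem_of_mem_erase he))
    have h3 := h2.add (a := w) (x := u) (Z := ∅) (g' := 0) nwu.symm (by simp) ?_ ?_ (by simp)
    · rw [Finset.insert_erase hu] at h3
      exact .of_decGE hk' h3
    · intro t ht h0
      exfalso
      obtain ⟨h4, h5⟩ := Finset.mem_erase.1 ht
      have htz : t ≠ z := fun h => hzE _ h5 (by simp [h])
      have htw : t ≠ w := (hE.ne h5).symm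
      rw [if_neg htz, if_neg htw] at h0
      split_ifs at h0 with h6 h7
      have := Nat.odd_iff.1 (hoddH t h6 (Or.inr (hall t w (swap_mem h5))))
      omega
    · simp [nzu.symm, nwu.symm, huv, huodd]
  · intro t ht h0
    rw [hg v t ht (fun h => hlH _ ht (by simp [h]))] at h0
    omega
  · intro t
    by_cases h : t = v
    · subst h; simp [nwv.symm]
    · by_cases h' : t = w
      · simp [h', nwv]
      · simp [h, h']

theorem Admissible.decomposable [Infinite V] (hE : Admissible E U) : Decomposable E U := by
  induction hn : E.card using Nat.strong_induction_on generalizing E U with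
  | _ n IHn =>
    have ih : IH E := fun E' U' hlt hE' => IHn _ (hn ▸ hlt) hE' rfl
    by_contra hcon
    have hT := tame_of_not_decomposable hE ih hcon
    have hall : ∀ v u, s(v, u) ∈ E → Odd (deg E v) := by
      intro v u hvu
      by_contra h
      exact hcon (hT.decomposable_of_even ih (Nat.not_odd_iff_even.1 h) hvu)
    refine hcon (hE.decomposable_of_deg_le_one fun w => ?_)
    by_contra! h
    obtain ⟨e, he, f, hf, hef⟩ := Finset.one_lt_card.1 h
    obtain ⟨heE, hwe⟩ := Finset.mem_filter.1 he
    obtain ⟨hfE, hwf⟩ := Finset.mem_filter.1 hf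
    obtain ⟨u, rfl⟩ := Sym2.mem_iff_exists.1 hwe
    obtain ⟨v, rfl⟩ := Sym2.mem_iff_exists.1 hwf
    exact hcon (hE.decomposable_of_forall_odd ih hall heE hfE fun h => hef (h ▸ rfl))

end

/-! ### Transfer to graphs. -/

section

variable {V : Type*} [Fintype V] [DecidableEq V] (G : SimpleGraph V) [DecidableRel G.Adj]

/-- The edges of `G`, as edges on an infinite set of vertices. -/
def edgesInl : Finset (Sym2 (V ⊕ ℕ)) := G.edgeFinset.image (Sym2.map Sum.inl)

lemma map_mem_edgesInl {e : Sym2 V} : e.map Sum.inl ∈ edgesInl G ↔ e ∈ G.edgeSet := by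
  rw [edgesInl, (Sym2.map.injective Sum.inl_injective).mem_finset_image, SimpleGraph.mem_edgeFinset]

lemma mk_mem_edgesInl {u v : V} : s(Sum.inl u, Sum.inl v) ∈ edgesInl G ↔ G.Adj u v := by
  rw [← SimpleGraph.mem_edgeSet, ← map_mem_edgesInl, Sym2.map_mk]

lemma exists_inl_of_mem_edgesInl {e : Sym2 (V ⊕ ℕ)} (he : e ∈ edgesInl G) {v : V ⊕ ℕ}
    (hv : v ∈ e) : ∃ u, v = Sum.inl u := by
  obtain ⟨e', -, rfl⟩ := Finset.mem_image.1 he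
  obtain ⟨u, -, rfl⟩ := Sym2.mem_map.1 hv
  exact ⟨u, rfl⟩

lemma deg_edgesInl (v : V) : deg (edgesInl G) (Sum.inl v) = G.degree v := by
  rw [← G.card_incidenceFinset_eq_degree, deg, edgesInl, Finset.filter_image,
    Finset.card_image_of_injective _ (Sym2.map.injective Sum.inl_injective)]
  congr 1
  ext e
  simp [SimpleGraph.mem_incidenceFinset, SimpleGraph.incidenceSet]

/-- By connectedness the triangle and the vertices touching it, being closed under adjacency, are
all the vertices; so `G` itself would be a SET graph. -/
lemma not_isSETAt_edgesInl (hconn : G.Connected) (hS : ¬ G.IsSET) (x y z : V ⊕ ℕ) :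
    ¬ IsSETAt (edgesInl G) x y z := by
  intro h
  obtain ⟨a, rfl⟩ := exists_inl_of_mem_edgesInl G h.xy (v := x) (by simp)
  obtain ⟨b, rfl⟩ := exists_inl_of_mem_edgesInl G h.yz (v := y) (by simp)
  obtain ⟨c, rfl⟩ := exists_inl_of_mem_edgesInl G h.yz (v := z) (by simp)
  have hab := (mk_mem_edgesInl G).1 h.xy
  have hbc := (mk_mem_edgesInl G).1 h.yz
  have hac := (mk_mem_edgesInl G).1 h.xz
  have ha := h.even_x
  have hb := h.even_y
  have hc := h.even_z
  rw [deg_edgesInl] at ha hb hc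
  have hall : ∀ v, (v = a ∨ v = b ∨ v = c) ∨
      Touches (edgesInl G) (Sum.inl a) (Sum.inl b) (Sum.inl c) (Sum.inl v) := by
    intro v
    have hr := (SimpleGraph.reachable_iff_reflTransGen a v).1 (hconn.preconnected a v)
    induction hr with
    | refl => exact Or.inl (Or.inl rfl)
    | @tail v u _ hvu ih =>
      have hvu' := (mk_mem_edgesInl G).2 hvu
      have huv' := (mk_mem_edgesInl G).2 hvu.symm
      by_cases hv : v = a ∨ v = b ∨ v = c
      · right
        rcases hv with rfl | rfl | rfl
        · exact Or.inl huv'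
        · exact Or.inr (Or.inl huv')
        · exact Or.inr (Or.inr huv')
      · have ht := ih.resolve_left hv
        push Not at hv
        have := h.closed (Sum.inl v) (by simpa using hv.1) (by simpa using hv.2.1)
          (by simpa using hv.2.2) ht _ hvu'
        simp only [Sum.inl.injEq] at this
        tauto
  have heven : ∀ v, Even (G.degree v) ↔ v = a ∨ v = b ∨ v = c := by
    intro v
    constructor
    · intro hv
      by_contra hv'
      have ht := (hall v).resolve_left hv'
      push Not at hv'
      have := h.odd (Sum.inl v) (by simpa using hv'.1) (by simpa using hv'.2.1)
        (by simpa using hv'.2.2) ht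
      rw [deg_edgesInl] at this
      exact not_odd_of_even hv this
    · rintro (rfl | rfl | rfl) <;> assumption
  refine hS ⟨?_, ?_⟩
  · have hcard : Fintype.card {v : V // Even (G.degree v)} = 3 := by
      rw [Fintype.card_of_subtype ({a, b, c} : Finset V) (by simp [heven])]
      exact Finset.card_eq_three.2 ⟨a, b, c, hab.ne, hac.ne, hbc.ne, rfl⟩
    refine ⟨⟨Fintype.equivFinOfCardEq hcard, ?_⟩⟩
    rintro ⟨u, hu⟩ ⟨v, hv⟩
    rw [SimpleGraph.completeGraph_eq_top, SimpleGraph.top_adj, (Equiv.injective _).ne_iff,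
      SimpleGraph.comap_adj, Ne, Subtype.mk.injEq]
    refine ⟨fun hne => ?_, fun h => h.ne⟩
    dsimp only
    rw [heven] at hu hv
    rcases hu with rfl | rfl | rfl <;> rcases hv with rfl | rfl | rfl <;>
      first
        | exact absurd rfl hne
        | assumption
        | (apply SimpleGraph.Adj.symm; assumption)
  · intro v hv
    have hv' : ¬ (v = a ∨ v = b ∨ v = c) := fun h => not_odd_of_even ((heven v).2 h) hv
    have ht := (hall v).resolve_left hv'
    push Not at hv'
    have := h.two (Sum.inl v) (by simpa using hv'.1) (by simpa using hv'.2.1)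
      (by simpa using hv'.2.2) ht
    simp only [mk_mem_edgesInl] at this
    have hfil : ∀ {p q}, p ≠ q → G.Adj v p → G.Adj v q → Even (G.degree p) →
        Even (G.degree q) → 2 ≤ ((G.neighborFinset v).filter fun w => Even (G.degree w)).card :=
      fun hpq h1 h2 h3 h4 => Finset.one_lt_card.2 ⟨_, by simp [h1, h3], _, by simp [h2, h4], hpq⟩
    rcases this with h | h | h
    · exact hfil hab.ne h.1 h.2 ha hb
    · exact hfil hbc.ne h.1 h.2 hb hc
    · exact hfil hac.ne h.1 h.2 ha hc

lemma admissible_edgesInl (hconn : G.Connected) (hdeg : G.eSubgraph.maxDegree ≤ 3)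
    (hS : ¬ G.IsSET) : Admissible (edgesInl G) (Finset.univ.image Sum.inl) := by
  refine ⟨?_, ?_, ?_, not_isSETAt_edgesInl G hconn hS⟩
  · intro e he
    obtain ⟨e', he', rfl⟩ := Finset.mem_image.1 he
    rw [Sym2.isDiag_map Sum.inl_injective]
    exact G.not_isDiag_of_mem_edgeSet (SimpleGraph.mem_edgeFinset.1 he')
  · intro e he v hv
    obtain ⟨u, rfl⟩ := exists_inl_of_mem_edgesInl G he hv
    simp
  · rintro (v | n) hv
    · rw [deg_edgesInl] at hv
      refine le_trans ?_ ((G.eSubgraph.degree_le_maxDegree ⟨v, hv⟩).trans hdeg)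
      rw [← SimpleGraph.card_neighborFinset_eq_degree]
      refine (Finset.card_le_card (t := (G.eSubgraph.neighborFinset ⟨v, hv⟩).image
        fun u => Sum.inl u.1) ?_).trans Finset.card_image_le
      intro u hu
      obtain ⟨h1, h2⟩ := mem_evenNbrs.1 hu
      obtain ⟨u, rfl⟩ := exists_inl_of_mem_edgesInl G h1 (v := u) (by simp)
      rw [deg_edgesInl] at h2
      refine Finset.mem_image.2 ⟨⟨u, h2⟩, ?_, rfl⟩
      rw [SimpleGraph.mem_neighborFinset]
      exact (mk_mem_edgesInl G).1 h1
    · rw [Finset.eq_empty_of_forall_notMem (s := evenNbrs (edgesInl G) (Sum.inr n))]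
      · simp
      · intro u hu
        obtain ⟨v, hv⟩ := exists_inl_of_mem_edgesInl G (mem_evenNbrs.1 hu).1 (v := Sum.inr n)
          (by simp)
        simp at hv

lemma exists_walk_of_pathEdges (l : List (V ⊕ ℕ)) (v : V)
    (hl : ∀ e ∈ pathEdges (Sum.inl v :: l), e ∈ edgesInl G) :
    ∃ u, ∃ w : G.Walk v u, w.support.map Sum.inl = Sum.inl v :: l ∧
      ((w.edges.map (Sym2.map Sum.inl) : List (Sym2 (V ⊕ ℕ))) : Multiset (Sym2 (V ⊕ ℕ))) =
        pathEdges (Sum.inl v :: l) := by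
  induction l generalizing v with
  | nil => exact ⟨v, .nil, by simp, by simp [pathEdges]⟩
  | cons b l ih =>
    have hb : s(Sum.inl v, b) ∈ edgesInl G := hl _ (by simp [pathEdges])
    obtain ⟨b, rfl⟩ := exists_inl_of_mem_edgesInl G hb (v := b) (by simp)
    obtain ⟨u, w, h1, h2⟩ := ih b fun e he => hl e (by simp [pathEdges, he])
    refine ⟨u, .cons ((mk_mem_edgesInl G).1 hb) w, by simp [h1], ?_⟩
    rw [SimpleGraph.Walk.edges_cons, List.map_cons, ← Multiset.cons_coe, h2]
    simp [pathEdges]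

lemma exists_path_of_pathEdges {l : List (V ⊕ ℕ)} (hnd : l.Nodup)
    (hl : ∀ e ∈ pathEdges l, e ∈ edgesInl G) (hne : pathEdges l ≠ 0) :
    ∃ P : Σ u v : V, G.Path u v, ∀ e, e ∈ P.2.2.1.edges ↔ e.map Sum.inl ∈ pathEdges l := by
  match l with
  | [] => exact absurd rfl hne
  | [_] => exact absurd rfl hne
  | a :: b :: l =>
    obtain ⟨a, rfl⟩ := exists_inl_of_mem_edgesInl G (hl s(a, b) (by simp [pathEdges])) (v := a)
      (by simp)
    obtain ⟨u, w, h1, h2⟩ := exists_walk_of_pathEdges G _ a hl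
    refine ⟨⟨a, u, w, ?_⟩, fun e => ?_⟩
    · rw [SimpleGraph.Walk.isPath_def]
      rw [← h1] at hnd
      exact hnd.of_map
    · rw [← h2, Multiset.mem_coe, List.mem_map_of_injective (Sym2.map.injective Sum.inl_injective)]

lemma pathNumber_le_of_decGE {k : ℕ} {g : V ⊕ ℕ → ℕ} (h : DecGE (edgesInl G) k g) :
    G.pathNumber ≤ k := by
  classical
  obtain ⟨p, hp, -⟩ := h
  have hmem : ∀ e, e ∈ edgesInl G ↔ ∃ i, e ∈ pathEdges (p i) := by
    intro e
    rw [← Finset.mem_val, ← hp.sum_eq, Multiset.mem_sum]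
    simp
  -- Paths without edges are discarded. They may lie at vertices outside `G`, and the bound only
  -- improves.
  choose f hf using fun i : {i // pathEdges (p i) ≠ 0} =>
    exists_path_of_pathEdges G (hp.nodup i) (fun e he => (hmem e).2 ⟨i, he⟩) i.2
  have hD : G.IsPathDecomposition (Finset.univ.image f) := by
    refine ⟨?_, ?_⟩
    · intro P hP Q hQ hPQ e heP heQ
      obtain ⟨i, -, rfl⟩ := Finset.mem_image.1 hP
      obtain ⟨j, -, rfl⟩ := Finset.mem_image.1 hQ
      rw [hf] at heP heQ
      have hij : j.1 ≠ i.1 := fun h => hPQ (congrArg f (Subtype.ext h).symm)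
      have hnd := (edgesInl G).nodup
      rw [← hp.sum_eq, ← Finset.add_sum_erase _ _ (Finset.mem_univ i.1), Multiset.nodup_add] at hnd
      exact Multiset.disjoint_left.1 hnd.2.2 heP
        (Multiset.mem_sum.2 ⟨j.1, Finset.mem_erase.2 ⟨hij, Finset.mem_univ _⟩, heQ⟩)
    · intro e he
      obtain ⟨i, hi⟩ := (hmem _).1 ((map_mem_edgesInl G).2 he)
      have hi0 : pathEdges (p i) ≠ 0 := fun h => by simp [h] at hi
      exact ⟨f ⟨i, hi0⟩, Finset.mem_image_of_mem _ (Finset.mem_univ _), (hf ⟨i, hi0⟩ e).2 hi⟩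
  have h1 : G.pathNumber ≤ (Finset.univ.image f).card := Nat.sInf_le ⟨_, hD, rfl⟩
  refine h1.trans (Finset.card_image_le.trans ?_)
  rw [Finset.card_univ]
  exact (Fintype.card_subtype_le _).trans (Fintype.card_fin k).le

end

end GallaiPath

theorem mainTheorem3 {V : Type*} [Fintype V] (G : SimpleGraph V) [DecidableRel G.Adj]
    (hconn : G.Connected) (hdeg : G.eSubgraph.maxDegree ≤ 3) :
    G.IsGallai ∨ G.IsSET := by
  classical
  by_cases hS : G.IsSET
  · exact Or.inr hS
  obtain ⟨k, hk, hD⟩ := (GallaiPath.admissible_edgesInl G hconn hdeg hS).decomposable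
  rw [Finset.card_image_of_injective _ Sum.inl_injective, Finset.card_univ] at hk
  have := GallaiPath.pathNumber_le_of_decGE G hD
  left
  unfold SimpleGraph.IsGallai
  omega
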